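/- **Setting.** Let $\mathfrak n$ be a finite-dimensional real nilpotent Lie algebra of dimension $d$ and step $s$ (so $\gamma_{s+1}(\mathfrak n)=0\neq\gamma_s(\mathfrak n)$; $s=0$ if $\mathfrak n=0$), and let $N$ be the simply connected nilpotent Lie group with Lie algebra $\mathfrak n$, identified with $\mathfrak n$ by the exponential map; its product is the Baker–Campbell–Hausdorff product $*$. Let $Q$ be a compact Hausdorff group acting continuously on $\mathfrak n$ by Lie algebra automorphisms, and fix a $Q$-invariant Euclidean norm $\|\cdot\|$ on $\mathfrak n$. Write $G=N\rtimes Q=\mathfrak n\times Q$ with $(\xi,\kappa)(\xi',\kappa')=(\xi*\kappa\xi',\kappa\kappa')$. For $v\in\mathfrak n$ the weight filtration $\mathfrak F_v$ is $\mathfrak n^{(0)}=\mathfrak n^{(1)}=\mathfrak n$, $\mathfrak n^{(i+1)}=[\mathfrak n,\mathfrak n^{(i)}]+[v,\mathfrak n^{(i-1)}]$ for $i\ge1$. Let $\mathfrak m_i$ be the orthogonal complement of $\mathfrak n^{(i+1)}$ in $\mathfrak n^{(i)}$ and $u_i$ the orthogonal projection of $u$ to $\mathfrak m_i$. (The space $\mathfrak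 m_1=[\mathfrak n,\mathfrak n]^\perp$ does not depend on $v$.) Given a norm $\varphi$ on $\mathfrak n$, the homogeneous norm is $|u|_{\mathfrak F_v,\varphi}=\sup_{i\ge1}\varphi(u_i)^{1/i}$, and $|(\xi,\kappa)|_{\mathfrak F_v,\varphi}:=|\xi|_{\mathfrak F_v,\varphi}$. Call $\varphi$ *admissible* if it is $Q$-invariant and $C_\varphi:=\sup\{\varphi([u,v]):\varphi(u),\varphi(v)\le1\}\le1$. Say that $\varphi$ has *projection constant at most $K$* for $v$ if $\varphi(u_i)\le K\varphi(u)$ for all $u\in\mathfrak n$ and all $i$, the components being those for $\mathfrak F_v$. Let $\mu$ be a compactly supported Borel probability measure on $G$. Put $R_\mu=\sup\{\varphi(\xi):(\xi,\kappa)\in\operatorname{supp}\mu\}$ and $\mathrm{Ad}(\mu_Q)u=\int\kappa u\,d\mu(\xi,\kappa)$. Let $V\subset\mathfrak m_1$ be the space of vectors of $\mathfrak m_1$ fixed by $\mu$-almost every $\kappa$, and $W$ its orthogonal complement in $\mathfrak m_1$. The essential average $v_\mu\in V$ is the $V$-component of $\int\xi_1\,d\mu(\xi,\kappa)\in\mathfrak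 m_1=V\oplus W$. A number $\kappa_\mu>0$ is a spectral constant of $\mu$ if $\varphi\big((\mathrm{id}-\mathrm{Ad}(\mu_Q))^{-1}w\big)\le\varphi(w)/\kappa_\mu$ for all $w\in W$, that is, if $\varphi(w)\le\varphi(w-\mathrm{Ad}(\mu_Q)w)/\kappa_\mu$ for all $w\in W$. Let $w_k=g_1\cdots g_k$ with $g_1,g_2,\dots$ independent of law $\mu$, and $w_0=1$. **Theorem.** (a) For all $d,s\in\mathbb N$ and $R,\kappa,K\in\mathbb R$ there are constants $c_1,c_2>0$ such that, for all $\mathfrak n$ of dimension $d$ and step $s$, all $Q$ and $\|\cdot\|$ as above, all admissible norms $\varphi$, and all compactly supported probability measures $\mu$ on $N\rtimes Q$ such that $R_\mu\le R$, $\kappa$ is a spectral constant of $\mu$, and $\varphi$ has projection constant at most $K$ for $v_\mu$, $$\sup_{n\ge1}\ \mathbb P\Big(\frac1{\sqrt n}\max_{0\le k\le n}\big|w_k\exp(-kv_\mu)\big|_{\mathfrak F_{v_\mu},\varphi}\ge t\Big)\le c_2e^{-c_1t^2}\qquad\text{for all }t>0 .$$ (b) For all $\mathfrak n$, $Q$,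 $\|\cdot\|$ as above there is an admissible norm $\varphi\ge\|\cdot\|$ which on $\mathfrak m_1$ is equal to $r\|\cdot\|$ for some $1\le r\le\max(1,C_{\|\cdot\|})$, and which has projection constant at most $1$ for every $v\in\mathfrak n$; for such a norm the constants $c_1,c_2$ in (a) thus depend only on $d$, $s$, $R$, $\kappa$. (c) For every admissible norm $\varphi$ there is a $K$ such that $\varphi$ has projection constant at most $K$ for every $v\in\mathfrak n$, and every compactly supported probability measure $\mu$ on $N\rtimes Q$ has a spectral constant $\kappa_\mu>0$. Hence (a) applies to every admissible $\varphi$ and every compactly supported $\mu$. -/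

import Mathlib

open MeasureTheory ProbabilityTheory

universe u v w

noncomputable section

/-- A real Lie algebra structure on a Euclidean space (no compatibility between the bracket and the
inner product is required). -/
class EuclideanLieAlgebra (𝔫 : Type*) [NormedAddCommGroup 𝔫] [InnerProductSpace ℝ 𝔫]
    extends Bracket 𝔫 𝔫 where
  add_lie_eq : ∀ x y z : 𝔫, ⁅x + y, z⁆ = ⁅x, z⁆ + ⁅y, z⁆
  lie_add_eq : ∀ x y z : 𝔫, ⁅x, y + z⁆ = ⁅x, y⁆ + ⁅x, z⁆
  lie_self_eq : ∀ x : 𝔫, ⁅x, x⁆ = 0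
  leibniz_lie_eq : ∀ x y z : 𝔫, ⁅x, ⁅y, z⁆⁆ = ⁅⁅x, y⁆, z⁆ + ⁅y, ⁅x, z⁆⁆
  lie_smul_eq : ∀ (r : ℝ) (x y : 𝔫), ⁅x, r • y⁆ = r • ⁅x, y⁆

/-- The underlying Lie ring, in the sense of Mathlib. -/
instance EuclideanLieAlgebra.toLieRing (𝔫 : Type*) [NormedAddCommGroup 𝔫] [InnerProductSpace ℝ 𝔫]
    [EuclideanLieAlgebra 𝔫] : LieRing 𝔫 where
  toAddCommGroup := NormedAddCommGroup.toAddCommGroup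
  add_lie := EuclideanLieAlgebra.add_lie_eq
  lie_add := EuclideanLieAlgebra.lie_add_eq
  lie_self := EuclideanLieAlgebra.lie_self_eq
  leibniz_lie := EuclideanLieAlgebra.leibniz_lie_eq

/-- The underlying real Lie algebra, in the sense of Mathlib. -/
instance EuclideanLieAlgebra.toLieAlgebra (𝔫 : Type*) [NormedAddCommGroup 𝔫]
    [InnerProductSpace ℝ 𝔫] [EuclideanLieAlgebra 𝔫] : LieAlgebra ℝ 𝔫 where
  toModule := NormedSpace.toModule
  lie_smul := EuclideanLieAlgebra.lie_smul_eq

section Group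

variable {𝔫 : Type*} [NormedAddCommGroup 𝔫] [InnerProductSpace ℝ 𝔫] [EuclideanLieAlgebra 𝔫]

/-- The right-nested bracket `[a₁, [a₂, …, [aₖ₋₁, aₖ]]]` of a word. -/
def nestedBracket : List 𝔫 → 𝔫
  | [] => 0
  | [a] => a
  | a :: b :: l => ⁅a, nestedBracket (b :: l)⁆

/-- The word `x^{r₁} y^{s₁} ⋯ x^{rₙ} y^{sₙ}`, where `e i = (rᵢ, sᵢ)`. -/
def dynkinWord (x y : 𝔫) {n N : ℕ} (e : Fin n → Fin N × Fin N) : List 𝔫 :=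
  (List.ofFn fun i => List.replicate (e i).1 x ++ List.replicate (e i).2 y).flatten

/-- The Lie product `x ∗ y = log (exp x exp y)` of an `s`-step nilpotent Lie algebra, given by the
Baker–Campbell–Hausdorff formula in Dynkin's form
`∑ₙ (-1)ⁿ⁻¹ / n ∑ [x^{r₁} y^{s₁} ⋯ x^{rₙ} y^{sₙ}] / (∑ (rᵢ + sᵢ) ∏ rᵢ! sᵢ!)`, the inner sum being over
`rᵢ + sᵢ > 0`.  Brackets of more than `s` letters vanish, so that only `n ≤ s` and `rᵢ, sᵢ ≤ s`
contribute.  The simply connected nilpotent Lie group `N` with Lie algebra `𝔫` is `𝔫` with this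
product, the exponential map being the identity. -/
def lieProduct (x y : 𝔫) : 𝔫 :=
  let s := LieModule.nilpotencyLength 𝔫 𝔫
  ∑ n ∈ Finset.Icc 1 s,
    ∑ e : Fin n → Fin (s + 1) × Fin (s + 1),
      if ∀ i, 0 < ((e i).1 : ℕ) + ((e i).2 : ℕ) then
        ((-1 : ℝ) ^ (n - 1) / (n : ℝ) /
          (((∑ i, (((e i).1 : ℕ) + ((e i).2 : ℕ)) : ℕ) : ℝ) *
            ((∏ i, ((e i).1 : ℕ).factorial * ((e i).2 : ℕ).factorial : ℕ) : ℝ))) •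
          nestedBracket (dynkinWord x y e)
      else 0

variable {Q : Type*} [Group Q] [DistribMulAction Q 𝔫]

/-- The product of `G = N ⋊ Q`, in the coordinates `G = 𝔫 × Q`, where `(ξ, κ)` stands for
`exp ξ · κ`. -/
def semidirectMul (g h : 𝔫 × Q) : 𝔫 × Q :=
  (lieProduct g.1 (g.2 • h.1), g.2 * h.2)

/-- The products `w₀ = 1`, `wₖ = g₁ ⋯ gₖ` in `N ⋊ Q`; the increment `gₖ` is `g (k - 1)`. -/
def walk (g : ℕ → 𝔫 × Q) : ℕ → 𝔫 × Q
  | 0 => (0, 1)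
  | k + 1 => semidirectMul (walk g k) (g k)

end Group

section Filtration

variable {𝔫 : Type*} [NormedAddCommGroup 𝔫] [InnerProductSpace ℝ 𝔫] [EuclideanLieAlgebra 𝔫]

/-- The weight filtration `𝔉_v`: `𝔫⁽⁰⁾ = 𝔫⁽¹⁾ = 𝔫` and `𝔫⁽ⁱ⁺¹⁾ = [𝔫, 𝔫⁽ⁱ⁾] + [v, 𝔫⁽ⁱ⁻¹⁾]`. -/
def weightFiltration (v : 𝔫) : ℕ → Submodule ℝ 𝔫
  | 0 => ⊤
  | 1 => ⊤
  | i + 2 =>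
    Submodule.span ℝ {z | ∃ x : 𝔫, ∃ y ∈ weightFiltration v (i + 1), ⁅x, y⁆ = z} ⊔
      Submodule.span ℝ {z | ∃ y ∈ weightFiltration v i, ⁅v, y⁆ = z}

/-- `𝔪ᵢ`, the orthogonal complement of `𝔫⁽ⁱ⁺¹⁾` in `𝔫⁽ⁱ⁾`. -/
def weightLayer (v : 𝔫) (i : ℕ) : Submodule ℝ 𝔫 :=
  weightFiltration v i ⊓ (weightFiltration v (i + 1))ᗮ

/-- The orthogonal complement of `[𝔫, 𝔫]`; it is `𝔪₁` for every filtration `𝔉_v`. -/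
def abelianPart (𝔫 : Type*) [NormedAddCommGroup 𝔫] [InnerProductSpace ℝ 𝔫]
    [EuclideanLieAlgebra 𝔫] : Submodule ℝ 𝔫 :=
  (Submodule.span ℝ {z : 𝔫 | ∃ x y : 𝔫, ⁅x, y⁆ = z})ᗮ

variable [FiniteDimensional ℝ 𝔫]

/-- The component `uᵢ ∈ 𝔪ᵢ` of `u`, that is, its orthogonal projection. -/
def weightComponent (v : 𝔫) (i : ℕ) (u : 𝔫) : 𝔫 :=
  (weightLayer v i).starProjection u

/-- The homogeneous norm `|u|_{𝔉_v, φ} = supᵢ φ(uᵢ)^{1/i}`.  The supremum is taken over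
`1 ≤ i ≤ 2 s`, as `𝔪ᵢ = 0` for larger `i`. -/
def homogeneousNorm (φ : Seminorm ℝ 𝔫) (v u : 𝔫) : ℝ :=
  ⨆ i : Fin (2 * LieModule.nilpotencyLength 𝔫 𝔫),
    φ (weightComponent v (i + 1) u) ^ (1 / ((i : ℝ) + 1))

/-- The constant of bilinearity `C_φ = sup {φ([u, v]) : φ(u) ≤ 1, φ(v) ≤ 1}`. -/
def bilinearityConstant (φ : Seminorm ℝ 𝔫) : ℝ :=
  sSup {r | ∃ u v : 𝔫, φ u ≤ 1 ∧ φ v ≤ 1 ∧ φ ⁅u, v⁆ = r}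

/-- The projections `u ↦ uᵢ` attached to `𝔉_v` increase `φ` by a factor at most `K`. -/
def ProjectionsBoundedBy (φ : Seminorm ℝ 𝔫) (v : 𝔫) (K : ℝ) : Prop :=
  ∀ (i : ℕ) (u : 𝔫), φ (weightComponent v i u) ≤ K * φ u

end Filtration

section Action

variable (Q : Type*) {𝔫 : Type*} [NormedAddCommGroup 𝔫] [InnerProductSpace ℝ 𝔫]
  [EuclideanLieAlgebra 𝔫] [Group Q] [DistribMulAction Q 𝔫]

/-- `Q` acts by automorphisms of the Lie algebra which are isometries of the Euclidean norm. -/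
structure IsEuclideanLieAction (𝔫 : Type*) [NormedAddCommGroup 𝔫] [InnerProductSpace ℝ 𝔫]
    [EuclideanLieAlgebra 𝔫] [DistribMulAction Q 𝔫] : Prop where
  smul_smul_comm : ∀ (q : Q) (r : ℝ) (x : 𝔫), q • (r • x) = r • (q • x)
  smul_lie : ∀ (q : Q) (x y : 𝔫), q • ⁅x, y⁆ = ⁅q • x, q • y⁆
  norm_smul : ∀ (q : Q) (x : 𝔫), ‖q • x‖ = ‖x‖

/-- `φ` is a `Q`-invariant norm with `C_φ ≤ 1`. -/
structure IsAdmissibleNorm [FiniteDimensional ℝ 𝔫] (φ : Seminorm ℝ 𝔫) : Prop where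
  eq_zero : ∀ u : 𝔫, φ u = 0 → u = 0
  map_smul : ∀ (q : Q) (u : 𝔫), φ (q • u) = φ u
  bilinearity_le : bilinearityConstant φ ≤ 1

end Action

section StepDistribution

variable {𝔫 : Type*} [NormedAddCommGroup 𝔫] [InnerProductSpace ℝ 𝔫] [EuclideanLieAlgebra 𝔫]
  [FiniteDimensional ℝ 𝔫] [MeasurableSpace 𝔫]
  {Q : Type*} [Group Q] [TopologicalSpace Q] [MeasurableSpace Q] [DistribMulAction Q 𝔫]

/-- `μ` is carried by a compact set. -/
def IsCompactlySupported (μ : Measure (𝔫 × Q)) : Prop :=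
  ∃ S : Set (𝔫 × Q), IsCompact S ∧ μ Sᶜ = 0

/-- `R_μ = sup {φ(ξ) : (ξ, κ) ∈ supp μ}`. -/
def supportRadius (φ : Seminorm ℝ 𝔫) (μ : Measure (𝔫 × Q)) : ℝ :=
  sSup ((fun g : 𝔫 × Q => φ g.1) '' μ.support)

/-- The operator `Ad(μ_Q) u = ∫ κ u dμ_Q(κ)`. -/
def averagedAction (μ : Measure (𝔫 × Q)) (u : 𝔫) : 𝔫 :=
  ∫ g, g.2 • u ∂μ

/-- The space `V` of vectors of `𝔪₁` fixed by `μ_Q`-almost every element of `Q`. -/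
def fixedPart (hQ : IsEuclideanLieAction Q 𝔫) (μ : Measure (𝔫 × Q)) : Submodule ℝ 𝔫 where
  carrier := {u | u ∈ abelianPart 𝔫 ∧ ∀ᵐ g ∂μ, g.2 • u = u}
  add_mem' := by
    rintro a b ⟨ha, ha'⟩ ⟨hb, hb'⟩
    refine ⟨add_mem ha hb, ?_⟩
    filter_upwards [ha', hb'] with g h₁ h₂
    rw [smul_add, h₁, h₂]
  zero_mem' := ⟨zero_mem _, by simp⟩
  smul_mem' := by
    rintro c a ⟨ha, ha'⟩
    refine ⟨Submodule.smul_mem _ c ha, ?_⟩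
    filter_upwards [ha'] with g h₁
    rw [hQ.smul_smul_comm, h₁]

/-- The space `W`, the orthogonal complement of `V` in `𝔪₁`. -/
def movedPart (hQ : IsEuclideanLieAction Q 𝔫) (μ : Measure (𝔫 × Q)) : Submodule ℝ 𝔫 :=
  abelianPart 𝔫 ⊓ (fixedPart hQ μ)ᗮ

/-- `κ` is a spectral constant of `μ`: `φ((id - Ad(μ_Q))⁻¹ w) ≤ φ(w) / κ` on `W`, the inverse being
that of the restriction of `id - Ad(μ_Q)` to `W`. -/
def IsSpectralConstant (hQ : IsEuclideanLieAction Q 𝔫) (φ : Seminorm ℝ 𝔫) (μ : Measure (𝔫 × Q))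
    (κ : ℝ) : Prop :=
  0 < κ ∧ ∀ w ∈ movedPart hQ μ, φ w ≤ φ (w - averagedAction μ w) / κ

/-- The essential average `v_μ`: the `V`-component, in `𝔪₁ = V ⊕ W`, of the mean of the projection
of `μ` to `𝔪₁`. -/
def essentialAverage (hQ : IsEuclideanLieAction Q 𝔫) (μ : Measure (𝔫 × Q)) : 𝔫 :=
  (fixedPart hQ μ).starProjection (∫ g, (abelianPart 𝔫).starProjection g.1 ∂μ)

/-- `|wₖ exp(-k v)|_{𝔉_v, φ}`, the norm of an element `(ξ, κ)` of `N ⋊ Q` being that of `ξ`. -/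
def recentredNorm (φ : Seminorm ℝ 𝔫) (v : 𝔫) (g : ℕ → 𝔫 × Q) (k : ℕ) : ℝ :=
  homogeneousNorm φ v (semidirectMul (walk g k) (-((k : ℝ) • v), 1)).1

/-- `(1 / √n) max_{k ≤ n} |wₖ exp(-k v)|_{𝔉_v, φ}`. -/
def maximalDeviation (φ : Seminorm ℝ 𝔫) (v : 𝔫) (g : ℕ → 𝔫 × Q) (n : ℕ) : ℝ :=
  1 / Real.sqrt n *
    (Finset.range (n + 1)).sup' Finset.nonempty_range_add_one (recentredNorm φ v g)

end StepDistribution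

end

/-! Part (a) is a martingale estimate at a scale adapted to the weight filtration. Write v for v_μ.

Corrector. Let h ∈ 𝔪₁ solve h − Ad(μ_Q)h = ∫ξ₁ dμ − v; applying the spectral constant twice bounds
φ(h) in terms of K, R, κ (`exists_corrector`). As almost every κ fixes v, the corrected walk Y_k =
w_k h exp(−kv) satisfies Y_{k+1} = Y_k ∗ exp(k ad v)(κ_k X), where κ_k is the Q-part of w_k and X =
(−h) ∗ ξ ∗ κh ∗ (−v) depends on the new increment (ξ, κ) alone (`correctedWalk_succ`). By the choice
of h, the abelian part X₁ has mean zero.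

Scale. For given n and t put ε = 1/(t√n) and p(u) = ∑ εⁱ φ(uᵢ). A homogeneous norm of at least t√n =
1/ε forces p ≥ 1. Brackets are bounded for p uniformly in ε, because the filtration is
multiplicative. Bracketing with v gains ε², because v has weight two in 𝔉_v; hence exp(k ad v) is
bounded for all k ≤ n, as nε² ≤ 1. Transported increments have p of order ε, and they have order ε²
once X₁ is removed from X.

Linearisation. While p(Y_k) < 1/2, the Baker–Campbell–Hausdorff formula writes Y_{k+1} − Y_k as D_k,
which is linear in X₁, plus an error of order ε². The n errors add up to order nε² = t⁻², which is
at most 1/8 once t exceeds a fixed threshold. So if p(Y) ever reaches 1/2, the sum of the D_k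
stopped at that time has p at least 1/4 (`le_seminorm_stopped_sum`). The stopped D_k are martingale
differences of size O(ε). The Azuma inequality (`measureReal_abs_sum_ge_le`), applied to d
functionals that control p (`exists_dual_seminorm_le_sum`), gives the bound 2d·exp(−c/(nε²)) =
2d·exp(−ct²). Below the threshold a large c₂ makes the claim trivial.

Group law. As the product is defined by Dynkin's series, its associativity and the formula x ∗ y ∗
(−x) = exp(ad x) y have to be proved. In an associative algebra the series equals log(eᵘeʷ) for
letters whose long words vanish (`truncLog_eq_dynkinSeries`). A nilpotent Lie algebra L is reached
through the action of tL[t] on L[t] ⊕ ℝ, which is the adjoint action made faithful by adding the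
derivation −t d/dt; identities between operators then descend to L by setting t = 1
(`eq_of_loopGraph`).

Parts (b) and (c). A multiple of the Euclidean norm is admissible, and orthogonal projections
contract it. Equivalence of norms gives K, and id − Ad(μ_Q) is injective on W because an average of
isometries fixes a vector only if almost all of them do. -/

set_option linter.unusedSectionVars false

noncomputable section

/-! ### Truncated exponential and logarithm of nilpotent elements -/

section TruncatedExpLog

variable {A : Type*} [Ring A] [Algebra ℝ A]

/-- The exponential series, truncated after degree `M`. -/
def truncExp (M : ℕ) (a : A) : A :=
  ∑ k ∈ Finset.range (M + 1), ((k.factorial : ℝ)⁻¹) • a ^ k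

/-- The logarithmic series around `1`, truncated after degree `M`. -/
def truncLog (M : ℕ) (g : A) : A :=
  ∑ n ∈ Finset.Icc 1 M, ((-1 : ℝ) ^ (n - 1) / n) • (g - 1) ^ n

theorem map_truncExp {B : Type*} [Ring B] [Algebra ℝ B] (f : A →ₐ[ℝ] B) (M : ℕ) (a : A) :
    f (truncExp M a) = truncExp M (f a) := by
  simp [truncExp, map_sum, map_smul, map_pow]

theorem map_truncLog {B : Type*} [Ring B] [Algebra ℝ B] (f : A →ₐ[ℝ] B) (M : ℕ) (a : A) :
    f (truncLog M a) = truncLog M (f a) := by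
  simp [truncLog, map_sum, map_smul, map_pow]

theorem truncExp_zero (M : ℕ) : truncExp M (0 : A) = 1 := by
  rw [truncExp, Finset.sum_eq_single 0] <;> simp +contextual

theorem truncExp_add {M : ℕ} {a b : A} (hab : Commute a b) (ha : a ^ (M + 1) = 0)
    (hb : b ^ (M + 1) = 0) (hc : (a + b) ^ (M + 1) = 0) :
    truncExp M (a + b) = truncExp M a * truncExp M b := by
  let _ : Module ℚ A := Module.compHom A (algebraMap ℚ ℝ)
  have key : ∀ x : A, x ^ (M + 1) = 0 → truncExp M x = IsNilpotent.exp x := by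
    intro x hx
    rw [IsNilpotent.exp_eq_sum hx, truncExp]
    refine Finset.sum_congr rfl fun k _ => ?_
    change _ = (algebraMap ℚ ℝ (k.factorial : ℚ)⁻¹) • x ^ k
    simp
  rw [key _ ha, key _ hb, key _ hc, IsNilpotent.exp_add_of_commute hab ⟨_, ha⟩ ⟨_, hb⟩]

theorem truncExp_mul_neg {M : ℕ} {a : A} (ha : a ^ (M + 1) = 0) :
    truncExp M a * truncExp M (-a) = 1 := by
  rw [← truncExp_add (Commute.neg_right rfl) ha (by rw [neg_pow, ha, mul_zero]) (by simp),
    add_neg_cancel, truncExp_zero]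

theorem truncExp_neg_mul {M : ℕ} {a : A} (ha : a ^ (M + 1) = 0) :
    truncExp M (-a) * truncExp M a = 1 := by
  simpa using truncExp_mul_neg (M := M) (a := -a) (by rw [neg_pow, ha, mul_zero])

open Polynomial in
theorem derivative_truncExp (M : ℕ) (f : ℝ[X]) :
    derivative (truncExp (M + 1) f) = derivative f * truncExp M f := by
  rw [truncExp, Finset.sum_range_succ', derivative_add, derivative_sum, truncExp, Finset.mul_sum]
  simp only [pow_zero, derivative_smul, derivative_one, smul_zero, add_zero]
  refine Finset.sum_congr rfl fun k _ => ?_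
  rw [derivative_pow_succ, ← C_mul', ← C_mul', Nat.factorial_succ]
  push_cast
  rw [mul_inv]
  have h : (C ((k : ℝ) + 1)⁻¹ : ℝ[X]) * C ((k : ℝ) + 1) = 1 := by
    rw [← C_mul, inv_mul_cancel₀ (by positivity), C_1]
  rw [C_mul]
  linear_combination (C (k.factorial : ℝ)⁻¹ * f ^ k * derivative f) * h

open Polynomial in
theorem derivative_truncLog_one_add_X (M : ℕ) :
    (1 + X) * derivative (truncLog M (1 + X) : ℝ[X]) = 1 - (-X) ^ M := by
  induction M with
  | zero => simp [truncLog]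
  | succ M ih =>
    have h : truncLog (M + 1) (1 + X : ℝ[X]) =
        truncLog M (1 + X) + ((-1 : ℝ) ^ M / (M + 1 : ℕ)) • X ^ (M + 1) := by
      rw [truncLog, Finset.sum_Icc_succ_top (by omega), truncLog]
      simp
    have h2 : derivative (((-1 : ℝ) ^ M / (M + 1 : ℕ)) • (X : ℝ[X]) ^ (M + 1)) = (-X) ^ M := by
      rw [derivative_smul, derivative_X_pow_succ, neg_pow (X : ℝ[X]), ← C_mul', ← mul_assoc, ← C_mul,
        Nat.cast_add, Nat.cast_one, div_mul_cancel₀ _ (by positivity)]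
      simp
    rw [h, derivative_add, mul_add, ih, h2]
    ring

open Polynomial in
theorem X_dvd_truncLog (M : ℕ) {g : ℝ[X]} (hg : X ∣ g - 1) : X ∣ truncLog M g := by
  refine Finset.dvd_sum fun n hn => ?_
  rw [← C_mul']
  exact Dvd.dvd.mul_left (dvd_pow hg (by have := (Finset.mem_Icc.1 hn).1; omega)) _

open Polynomial in
-- Modulo X^(M+1) the difference G satisfies the differential equation (1 + X)G' = G of the function
-- 1 + X. With G(0) = 0 the coefficients vanish one after the other; integration gains the last
-- power of X.
theorem X_pow_dvd_truncExp_truncLog (M : ℕ) :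
    (X : ℝ[X]) ^ (M + 2) ∣ truncExp (M + 1) (truncLog (M + 1) (1 + X)) - (1 + X) := by
  set f : ℝ[X] := truncLog (M + 1) (1 + X) with hf
  set G : ℝ[X] := truncExp (M + 1) f - (1 + X) with hG
  have hXf : X ∣ f := X_dvd_truncLog _ (by simp)
  have hF : truncExp (M + 1) f = truncExp M f + C (((M + 1).factorial : ℝ)⁻¹) * f ^ (M + 1) := by
    rw [truncExp, Finset.sum_range_succ, ← C_mul', truncExp]
  have hdvd : (X : ℝ[X]) ^ (M + 1) ∣ (1 + X) * derivative G - G := by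
    have e : (1 + X) * derivative G - G = -((-X) ^ (M + 1) * truncExp M f) -
        C (((M + 1).factorial : ℝ)⁻¹) * f ^ (M + 1) := by
      rw [hG, derivative_sub, derivative_truncExp]
      simp only [derivative_add, derivative_one, derivative_X, zero_add]
      have := derivative_truncLog_one_add_X (M + 1)
      rw [← hf] at this
      linear_combination truncExp M f * this - hF
    rw [e]
    refine dvd_sub (dvd_neg.2 (Dvd.dvd.mul_right ?_ _)) (Dvd.dvd.mul_left (pow_dvd_pow_of_dvd hXf _) _)
    rw [neg_pow]
    exact Dvd.intro_left _ rfl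
  rw [X_pow_dvd_iff] at hdvd ⊢
  have h0 : G.coeff 0 = 0 := by
    have h1 : truncExp (M + 1) f = 1 + f * (∑ k ∈ Finset.range (M + 1),
        (((k + 1).factorial : ℝ)⁻¹) • f ^ k) := by
      rw [truncExp, Finset.sum_range_succ', Finset.mul_sum, add_comm]
      simp [pow_succ']
    obtain ⟨q, hq⟩ := hXf
    rw [hG, h1, hq]
    simp [mul_assoc]
  intro d hd
  induction d with
  | zero => exact h0
  | succ n ih =>
    have h1 := hdvd n (by omega)
    have h2 := ih (by omega)
    rw [add_mul, one_mul, coeff_sub, coeff_add, coeff_derivative, h2] at h1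
    have h3 : (X * derivative G).coeff n = 0 := by
      cases n with
      | zero => simp
      | succ m => rw [coeff_X_mul, coeff_derivative, h2, zero_mul]
    rw [h3, add_zero, sub_zero] at h1
    exact (mul_eq_zero.1 h1).resolve_right (by positivity)

open Polynomial in
-- With f the truncated exponential, X^(M+1) divides f·G' for the difference G. As f has constant
-- term 1 it is coprime to X, so G' is divisible, and G(0) = 0.
theorem X_pow_dvd_truncLog_truncExp (M : ℕ) :
    (X : ℝ[X]) ^ (M + 2) ∣ truncLog (M + 1) (truncExp (M + 1) X) - X := by
  set f : ℝ[X] := truncExp (M + 1) X with hf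
  have hd : derivative f = f - C (((M + 1).factorial : ℝ)⁻¹) * X ^ (M + 1) := by
    rw [hf, derivative_truncExp, derivative_X, one_mul, truncExp, truncExp,
      Finset.sum_range_succ _ (M + 1), ← C_mul']
    ring
  have hXf : X ∣ f - 1 := by
    rw [hf, truncExp, Finset.sum_range_succ']
    simp only [pow_zero, Nat.factorial_zero, Nat.cast_one, inv_one, one_smul, add_sub_cancel_right]
    refine Finset.dvd_sum fun n _ => ?_
    rw [← C_mul', pow_succ']
    exact Dvd.dvd.mul_left (Dvd.intro _ rfl) _
  have hlog : ∀ M, f * derivative (truncLog M f) = derivative f * (1 - (1 - f) ^ M) := by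
    intro M
    induction M with
    | zero => simp [truncLog]
    | succ M ih =>
      have h : truncLog (M + 1) f =
          truncLog M f + ((-1 : ℝ) ^ M / (M + 1 : ℕ)) • (f - 1) ^ (M + 1) := by
        rw [truncLog, Finset.sum_Icc_succ_top (by omega), truncLog]
        simp
      have h2 : derivative (((-1 : ℝ) ^ M / (M + 1 : ℕ)) • (f - 1) ^ (M + 1)) =
          (1 - f) ^ M * derivative f := by
        rw [derivative_smul, derivative_pow_succ, derivative_sub, derivative_one, sub_zero,
          ← neg_sub f 1, neg_pow (f - 1), ← C_mul', ← mul_assoc, ← mul_assoc, ← C_mul,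
          Nat.cast_add, Nat.cast_one, div_mul_cancel₀ _ (by positivity)]
        simp
      rw [h, derivative_add, mul_add, ih, h2]
      ring
  set L : ℝ[X] := truncLog (M + 1) f with hL
  set G : ℝ[X] := L - X with hG
  have hdvd : (X : ℝ[X]) ^ (M + 1) ∣ f * derivative G := by
    have e : f * derivative G = -(C (((M + 1).factorial : ℝ)⁻¹) * X ^ (M + 1)) -
        derivative f * (1 - f) ^ (M + 1) := by
      rw [hG, derivative_sub, derivative_X]
      linear_combination hlog (M + 1) + hd
    rw [e]
    refine dvd_sub (dvd_neg.2 (Dvd.intro_left _ rfl)) (Dvd.dvd.mul_left (pow_dvd_pow_of_dvd ?_ _) _)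
    rw [← neg_sub f 1]
    exact (dvd_neg).2 hXf
  have hcop : IsCoprime ((X : ℝ[X]) ^ (M + 1)) f := by
    refine IsCoprime.pow_left ?_
    obtain ⟨q, hq⟩ := hXf
    exact ⟨-q, 1, by linear_combination hq⟩
  have hdG := hcop.dvd_of_dvd_mul_left hdvd
  rw [X_pow_dvd_iff] at hdG ⊢
  intro d hd'
  cases d with
  | zero =>
    have : X ∣ G := dvd_sub (X_dvd_truncLog _ hXf) dvd_rfl
    exact X_dvd_iff.1 this
  | succ n =>
    have := hdG n (by omega)
    rw [coeff_derivative] at this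
    exact (mul_eq_zero.1 this).resolve_right (by positivity)

open Polynomial in
theorem truncExp_truncLog {M : ℕ} {g : A} (hg : (g - 1) ^ (M + 2) = 0) :
    truncExp (M + 1) (truncLog (M + 1) g) = g := by
  obtain ⟨q, hq⟩ := X_pow_dvd_truncExp_truncLog M
  have := congrArg (aeval (g - 1)) hq
  rw [map_sub, map_mul, map_pow, aeval_X, hg, zero_mul, map_truncExp, map_truncLog, sub_eq_zero]
    at this
  simpa using this

open Polynomial in
theorem truncLog_truncExp {M : ℕ} {a : A} (ha : a ^ (M + 2) = 0) :
    truncLog (M + 1) (truncExp (M + 1) a) = a := by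
  obtain ⟨q, hq⟩ := X_pow_dvd_truncLog_truncExp M
  have := congrArg (aeval a) hq
  rw [map_sub, map_mul, map_pow, aeval_X, ha, zero_mul, map_truncLog, map_truncExp, sub_eq_zero]
    at this
  simpa using this

end TruncatedExpLog

end

noncomputable section

/-! ### Words and Dynkin's series -/

section Words

/-- The word `x^{r₁} y^{s₁} ⋯ x^{rₙ} y^{sₙ}` over an arbitrary alphabet. -/
def powerWord {α : Type*} (x y : α) {n N : ℕ} (e : Fin n → Fin N × Fin N) : List α :=
  (List.ofFn fun i => List.replicate (e i).1 x ++ List.replicate (e i).2 y).flatten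

theorem map_powerWord {α β : Type*} (f : α → β) (x y : α) {n N : ℕ} (e : Fin n → Fin N × Fin N) :
    (powerWord x y e).map f = powerWord (f x) (f y) e := by
  simp only [powerWord, List.map_flatten, List.map_ofFn]
  congr 2
  funext i
  simp

theorem length_powerWord {α : Type*} (x y : α) {n N : ℕ} (e : Fin n → Fin N × Fin N) :
    (powerWord x y e).length = ∑ i, (((e i).1 : ℕ) + ((e i).2 : ℕ)) := by
  simp [powerWord, List.length_flatten, List.map_ofFn, List.sum_ofFn]

theorem mem_powerWord {α : Type*} {x y z : α} {n N : ℕ} {e : Fin n → Fin N × Fin N}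
    (hz : z ∈ powerWord x y e) : z = x ∨ z = y := by
  simp only [powerWord, List.mem_flatten, List.mem_ofFn] at hz
  obtain ⟨l, ⟨i, rfl⟩, hl⟩ := hz
  rcases List.mem_append.1 hl with h | h
  · exact Or.inl (List.eq_of_mem_replicate h)
  · exact Or.inr (List.eq_of_mem_replicate h)

/-- The factor `∏ rᵢ! sᵢ!` of Dynkin's formula. -/
def factorialWeight {n N : ℕ} (e : Fin n → Fin N × Fin N) : ℕ :=
  ∏ i, ((e i).1 : ℕ).factorial * ((e i).2 : ℕ).factorial

/-- The expansion from which Dynkin's index set arises: subtracting 1 deletes the empty block aʳbˢ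
with r = s = 0, hence the condition that every block be nonempty. -/
theorem pow_truncExp_mul_truncExp_sub_one {A : Type*} [Ring A] [Algebra ℝ A] (M : ℕ) (a b : A)
    (n : ℕ) :
    (truncExp M a * truncExp M b - 1) ^ n =
      ∑ e : Fin n → Fin (M + 1) × Fin (M + 1),
        if ∀ i, 0 < ((e i).1 : ℕ) + ((e i).2 : ℕ) then
          ((factorialWeight e : ℝ)⁻¹) • (powerWord a b e).prod else 0 := by
  have h1 : truncExp M a * truncExp M b - 1 = ∑ p : Fin (M + 1) × Fin (M + 1),
      if 0 < (p.1 : ℕ) + (p.2 : ℕ) then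
        (((p.1 : ℕ).factorial * (p.2 : ℕ).factorial : ℕ) : ℝ)⁻¹ • (a ^ (p.1 : ℕ) * b ^ (p.2 : ℕ))
      else 0 := by
    have h2 : truncExp M a * truncExp M b = ∑ p : Fin (M + 1) × Fin (M + 1),
        (((p.1 : ℕ).factorial * (p.2 : ℕ).factorial : ℕ) : ℝ)⁻¹ •
          (a ^ (p.1 : ℕ) * b ^ (p.2 : ℕ)) := by
      rw [truncExp, truncExp, Finset.sum_range, Finset.sum_range, Finset.sum_mul_sum,
        Fintype.sum_prod_type]
      refine Finset.sum_congr rfl fun i _ => Finset.sum_congr rfl fun j _ => ?_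
      rw [smul_mul_smul_comm, Nat.cast_mul, mul_inv]
    have h3 : (1 : A) = ∑ p : Fin (M + 1) × Fin (M + 1),
        if p = (0, 0) then (((p.1 : ℕ).factorial * (p.2 : ℕ).factorial : ℕ) : ℝ)⁻¹ •
          (a ^ (p.1 : ℕ) * b ^ (p.2 : ℕ)) else 0 := by
      rw [Finset.sum_ite_eq' Finset.univ]
      simp
    conv_lhs => rw [h2, h3]
    rw [← Finset.sum_sub_distrib]
    refine Finset.sum_congr rfl fun p _ => ?_
    by_cases hp : p = (0, 0)
    · simp [hp]
    · have : 0 < (p.1 : ℕ) + (p.2 : ℕ) := by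
        by_contra h
        exact hp (Prod.ext (Fin.ext (by rw [Fin.val_zero]; omega))
          (Fin.ext (by rw [Fin.val_zero]; omega)))
      simp [hp, this]
  induction n with
  | zero => simp [factorialWeight, powerWord]
  | succ n ih =>
    rw [pow_succ', ih, h1, Finset.sum_mul_sum, ← Fintype.sum_prod_type']
    refine Fintype.sum_equiv (Fin.consEquiv fun _ => Fin (M + 1) × Fin (M + 1)) _ _ fun q => ?_
    obtain ⟨p, e⟩ := q
    have hc : Fin.consEquiv (fun _ => Fin (M + 1) × Fin (M + 1)) (p, e) = Fin.cons p e := rfl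
    rw [hc]
    simp only [Fin.forall_fin_succ, Fin.cons_zero, Fin.cons_succ]
    by_cases hp : 0 < (p.1 : ℕ) + (p.2 : ℕ)
    · by_cases he : ∀ i, 0 < ((e i).1 : ℕ) + ((e i).2 : ℕ)
      · rw [if_pos hp, if_pos he, if_pos ⟨hp, he⟩, smul_mul_smul_comm]
        congr 1
        · rw [factorialWeight, factorialWeight, Fin.prod_univ_succ]
          simp only [Fin.cons_zero, Fin.cons_succ]
          rw [Nat.cast_mul _ (∏ _, _), mul_inv]
        · simp [powerWord, List.ofFn_succ, mul_assoc]
      · rw [if_neg he, mul_zero]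
        exact (if_neg fun h : _ ∧ _ => he h.2).symm
    · rw [if_neg hp, zero_mul]
      exact (if_neg fun h : _ ∧ _ => hp h.1).symm

end Words

section Dynkin

variable {L : Type*} [LieRing L]

/-- The right-nested bracket of a word in a Lie ring. -/
def lieWord : List L → L
  | [] => 0
  | [a] => a
  | a :: b :: l => ⁅a, lieWord (b :: l)⁆

theorem lieWord_cons (a : L) {l : List L} (hl : l ≠ []) : lieWord (a :: l) = ⁅a, lieWord l⁆ := by
  cases l with
  | nil => exact absurd rfl hl
  | cons b l => rfl

variable [LieAlgebra ℝ L]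

theorem map_lieWord {L' : Type*} [LieRing L'] [LieAlgebra ℝ L'] (f : L →ₗ⁅ℝ⁆ L') (l : List L) :
    f (lieWord l) = lieWord (l.map f) := by
  induction l with
  | nil => simp [lieWord]
  | cons a l ih =>
    cases l with
    | nil => simp [lieWord]
    | cons b l =>
      rw [lieWord_cons a (List.cons_ne_nil _ _), LieHom.map_lie, ih, List.map_cons (a := a),
        lieWord_cons _ (by simp)]

/-- Dynkin's form of the Baker–Campbell–Hausdorff series, truncated at `M`. -/
def dynkinSeries (M : ℕ) (x y : L) : L :=
  ∑ n ∈ Finset.Icc 1 M, ∑ e : Fin n → Fin (M + 1) × Fin (M + 1),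
    if ∀ i, 0 < ((e i).1 : ℕ) + ((e i).2 : ℕ) then
      ((-1 : ℝ) ^ (n - 1) / (n : ℝ) /
        (((∑ i, (((e i).1 : ℕ) + ((e i).2 : ℕ)) : ℕ) : ℝ) * (factorialWeight e : ℝ))) •
        lieWord (powerWord x y e)
    else 0

theorem map_dynkinSeries {L' : Type*} [LieRing L'] [LieAlgebra ℝ L'] (f : L →ₗ⁅ℝ⁆ L') (M : ℕ)
    (x y : L) : f (dynkinSeries M x y) = dynkinSeries M (f x) (f y) := by
  simp only [dynkinSeries, map_sum]
  refine Finset.sum_congr rfl fun n _ => Finset.sum_congr rfl fun e _ => ?_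
  split_ifs
  · rw [map_smul, map_lieWord, map_powerWord]
  · simp

/-- The innermost `ad` turns E into minus the last letter; the others build the right-nested bracket
around it. -/
theorem prod_ad_apply_of_lie_eq_neg {E : L} {l : List L} (hl : l ≠ [])
    (h : ∀ z ∈ l, ⁅z, E⁆ = -z) : (l.map (LieAlgebra.ad ℝ L)).prod E = -lieWord l := by
  induction l with
  | nil => exact absurd rfl hl
  | cons a l ih =>
    cases l with
    | nil => simpa [lieWord] using h a (by simp)
    | cons b l =>
      rw [List.map_cons, List.prod_cons, Module.End.mul_apply,
        ih (by simp) fun z hz => h z (List.mem_cons_of_mem _ hz), lieWord_cons a (by simp)]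
      simp

/-- Bracketing with E is a derivation, so it counts letters. This is the origin of the denominators
∑ (rᵢ + sᵢ) in Dynkin's formula. -/
theorem lieWord_lie_of_lie_eq_neg {E : L} {l : List L} (h : ∀ z ∈ l, ⁅z, E⁆ = -z) :
    ⁅lieWord l, E⁆ = -((l.length : ℝ) • lieWord l) := by
  induction l with
  | nil => simp [lieWord]
  | cons a l ih =>
    cases l with
    | nil => simpa [lieWord] using h a (by simp)
    | cons b l =>
      rw [lieWord_cons a (by simp), lie_lie, ih fun z hz => h z (List.mem_cons_of_mem _ hz),
        h a (by simp), lie_neg, lie_smul, lie_neg, ← lie_skew (lieWord _) a, List.length_cons (a := a)]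
      push_cast
      module

/-- Dynkin's argument: evaluating the associative logarithm on an Euler element E turns each product
of `ad`s into a nested bracket, and the division by the word length cancels the number of letters
that E counts. -/
theorem truncLog_ad_apply_eq_dynkinSeries_lie (M : ℕ) {x y E : L} (hx : ⁅x, E⁆ = -x)
    (hy : ⁅y, E⁆ = -y) :
    truncLog M (truncExp M (LieAlgebra.ad ℝ L x) * truncExp M (LieAlgebra.ad ℝ L y)) E =
      ⁅dynkinSeries M x y, E⁆ := by
  rw [truncLog, dynkinSeries, LinearMap.sum_apply, sum_lie]
  refine Finset.sum_congr rfl fun n hn => ?_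
  rw [LinearMap.smul_apply, pow_truncExp_mul_truncExp_sub_one, LinearMap.sum_apply, sum_lie,
    Finset.smul_sum]
  refine Finset.sum_congr rfl fun e _ => ?_
  split_ifs with he
  · have hlen : 0 < ∑ i, (((e i).1 : ℕ) + ((e i).2 : ℕ)) := by
      have hn1 := (Finset.mem_Icc.1 hn).1
      exact Finset.sum_pos (fun i _ => he i) ⟨⟨0, hn1⟩, Finset.mem_univ _⟩
    have hz : ∀ z ∈ powerWord x y e, ⁅z, E⁆ = -z := by
      intro z hz
      rcases mem_powerWord hz with rfl | rfl <;> assumption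
    rw [LinearMap.smul_apply, ← map_powerWord, prod_ad_apply_of_lie_eq_neg _ hz, smul_lie,
      lieWord_lie_of_lie_eq_neg hz, length_powerWord, smul_smul, smul_neg, smul_neg, smul_smul]
    · congr 2
      have : ((∑ i, (((e i).1 : ℕ) + ((e i).2 : ℕ)) : ℕ) : ℝ) ≠ 0 := by exact_mod_cast hlen.ne'
      field_simp
    · intro h0
      rw [← List.length_eq_zero_iff, length_powerWord] at h0
      omega
  · simp

end Dynkin

end

noncomputable section

/-! ### The Baker–Campbell–Hausdorff formula in an associative algebra -/

section AssociativeBCH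

attribute [local instance] LieRing.ofAssociativeRing

/-- All words of length more than `N` in the letters `u` and `w` vanish. -/
def WordsVanish {A : Type*} [Monoid A] [Zero A] (N : ℕ) (u w : A) : Prop :=
  ∀ l : List Bool, N < l.length → (l.map fun b => cond b u w).prod = 0

theorem powerWord_eq_map {α : Type*} (x y : α) {n N : ℕ} (e : Fin n → Fin N × Fin N) :
    powerWord x y e = (powerWord true false e).map fun b => cond b x y := by
  rw [map_powerWord]; rfl

theorem WordsVanish.pow_left {A : Type*} [Ring A] {N : ℕ} {u w : A} (h : WordsVanish N u w) {k : ℕ} (hk : N < k) :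
    u ^ k = 0 := by
  simpa using h (List.replicate k true) (by simpa using hk)

theorem WordsVanish.pow_right {A : Type*} [Ring A] {N : ℕ} {u w : A} (h : WordsVanish N u w)
    {k : ℕ} (hk : N < k) : w ^ k = 0 := by
  simpa using h (List.replicate k false) (by simpa using hk)

variable {A : Type*} [Ring A] [Algebra ℝ A]

theorem WordsVanish.map {B : Type*} [Ring B] [Algebra ℝ B] (f : A →ₐ[ℝ] B) {N : ℕ} {u w : A}
    (h : WordsVanish N u w) : WordsVanish N (f u) (f w) := by
  intro l hl
  have := congrArg f (h l hl)
  rw [map_list_prod, List.map_map, map_zero] at this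
  rw [← this]
  congr 2
  funext b
  cases b <;> rfl

theorem WordsVanish.pow_truncExp_sub_one {N : ℕ} {u w : A} (h : WordsVanish N u w) (M : ℕ)
    {k : ℕ} (hk : N < k) : (truncExp M u * truncExp M w - 1) ^ k = 0 := by
  rw [pow_truncExp_mul_truncExp_sub_one]
  refine Finset.sum_eq_zero fun e _ => ?_
  split_ifs with he
  · rw [powerWord_eq_map, h, smul_zero]
    rw [length_powerWord]
    calc N < k := hk
      _ = ∑ i : Fin k, 1 := by simp
      _ ≤ _ := Finset.sum_le_sum fun i _ => he i
  · rfl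

theorem pow_truncLog_eq_zero {M k : ℕ} {g : A} (hg : (g - 1) ^ k = 0) :
    truncLog M g ^ k = 0 := by
  have h : truncLog M g = (g - 1) *
      ∑ n ∈ Finset.Icc 1 M, ((-1 : ℝ) ^ (n - 1) / n) • (g - 1) ^ (n - 1) := by
    rw [truncLog, Finset.mul_sum]
    refine Finset.sum_congr rfl fun n hn => ?_
    rw [mul_smul_comm, ← pow_succ', Nat.sub_add_cancel (Finset.mem_Icc.1 hn).1]
  have hc : Commute (g - 1) (∑ n ∈ Finset.Icc 1 M, ((-1 : ℝ) ^ (n - 1) / n) • (g - 1) ^ (n - 1)) :=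
    Commute.sum_right _ _ _ fun n _ => ((Commute.refl _).pow_right _).smul_right _
  rw [h, hc.mul_pow, hg, zero_mul]

theorem map_truncExp_mulRight (M : ℕ) (a : A) :
    truncExp M (LinearMap.mulRight ℝ a) = LinearMap.mulRight ℝ (truncExp M a) := by
  ext x
  simp [truncExp, LinearMap.sum_apply, Finset.mul_sum]

theorem map_truncExp_mulLeft (M : ℕ) (a : A) :
    truncExp M (LinearMap.mulLeft ℝ a) = LinearMap.mulLeft ℝ (truncExp M a) := by
  ext x
  simp [truncExp, LinearMap.sum_apply, Finset.sum_mul]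

theorem ad_eq_mulLeft_add_mulRight (a : A) :
    LieAlgebra.ad ℝ A a = LinearMap.mulLeft ℝ a + LinearMap.mulRight ℝ (-a) := by
  ext x
  simp [LieRing.of_associative_ring_bracket, sub_eq_add_neg]

/-- `ad a` is the difference of two commuting multiplications, each of nilpotency order N + 1. This
doubling is why series are truncated beyond 2N. -/
theorem pow_ad_eq_zero {N k : ℕ} (hk : 2 * N < k) {a : A} (ha : a ^ (N + 1) = 0) :
    LieAlgebra.ad ℝ A a ^ k = 0 := by
  rw [ad_eq_mulLeft_add_mulRight]
  refine (LinearMap.commute_mulLeft_right a (-a)).add_pow_eq_zero_of_add_le_succ_of_pow_eq_zero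
    (m := N + 1) (n := N + 1) ?_ ?_ (by omega)
  · rw [LinearMap.pow_mulLeft, ha, LinearMap.mulLeft_zero_eq_zero]
  · rw [LinearMap.pow_mulRight, neg_pow, ha, mul_zero, LinearMap.mulRight_zero_eq_zero]

theorem truncExp_ad {N M : ℕ} (hM : 2 * N ≤ M) {a : A} (ha : a ^ (N + 1) = 0) :
    truncExp M (LieAlgebra.ad ℝ A a) =
      LinearMap.mulLeft ℝ (truncExp M a) * LinearMap.mulRight ℝ (truncExp M (-a)) := by
  have ha' : a ^ (M + 1) = 0 := pow_eq_zero_of_le (by omega) ha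
  have h := pow_ad_eq_zero (k := M + 1) (by omega) ha
  rw [ad_eq_mulLeft_add_mulRight] at h ⊢
  rw [truncExp_add (LinearMap.commute_mulLeft_right a (-a)) _ _ h, map_truncExp_mulLeft,
    map_truncExp_mulRight]
  · rw [LinearMap.pow_mulLeft, ha', LinearMap.mulLeft_zero_eq_zero]
  · rw [LinearMap.pow_mulRight, neg_pow, ha', mul_zero, LinearMap.mulRight_zero_eq_zero]

theorem truncExp_ad_apply {N M : ℕ} (hM : 2 * N ≤ M) {a : A} (ha : a ^ (N + 1) = 0) (b : A) :
    truncExp M (LieAlgebra.ad ℝ A a) b = truncExp M a * b * truncExp M (-a) := by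
  rw [truncExp_ad hM ha]
  simp [mul_assoc]

/-- If l = log(eˣeʸ), then exp(ad l) is conjugation by eˣeʸ, that is, exp(ad x)exp(ad y). Taking
logarithms gives ad l, whose value on E is given by Dynkin's argument. -/
theorem truncLog_lie_eq_dynkinSeries_lie {N K : ℕ} (hK : 2 * N ≤ K) {x y E : A}
    (h : WordsVanish N x y) (hx : ⁅x, E⁆ = -x) (hy : ⁅y, E⁆ = -y) :
    ⁅truncLog (K + 1) (truncExp (K + 1) x * truncExp (K + 1) y), E⁆ =
      ⁅dynkinSeries (K + 1) x y, E⁆ := by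
  set g := truncExp (K + 1) x * truncExp (K + 1) y with hg
  set l := truncLog (K + 1) g with hl
  have hgN : (g - 1) ^ (N + 1) = 0 := h.pow_truncExp_sub_one _ (Nat.lt_succ_self N)
  have hlN : l ^ (N + 1) = 0 := pow_truncLog_eq_zero hgN
  have hxN := h.pow_left (Nat.lt_succ_self N)
  have hyN := h.pow_right (Nat.lt_succ_self N)
  have hexp : truncExp (K + 1) l = g := truncExp_truncLog (pow_eq_zero_of_le (by omega) hgN)
  have hinv : truncExp (K + 1) (-l) = truncExp (K + 1) (-y) * truncExp (K + 1) (-x) := by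
    have h1 : truncExp (K + 1) (-l) * g = 1 := by
      rw [← hexp, truncExp_neg_mul (pow_eq_zero_of_le (by omega) hlN)]
    have h2 : g * (truncExp (K + 1) (-y) * truncExp (K + 1) (-x)) = 1 := by
      rw [hg, mul_assoc, ← mul_assoc _ (truncExp (K + 1) (-y)),
        truncExp_mul_neg (pow_eq_zero_of_le (by omega) hyN), one_mul,
        truncExp_mul_neg (pow_eq_zero_of_le (by omega) hxN)]
    exact left_inv_eq_right_inv h1 h2
  have had : truncExp (K + 1) (LieAlgebra.ad ℝ A l) =
      truncExp (K + 1) (LieAlgebra.ad ℝ A x) * truncExp (K + 1) (LieAlgebra.ad ℝ A y) := by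
    ext b
    rw [Module.End.mul_apply, truncExp_ad_apply (N := N) (by omega) hlN,
      truncExp_ad_apply (N := N) (by omega) hxN, truncExp_ad_apply (N := N) (by omega) hyN, hexp,
      hinv, hg]
    simp only [mul_assoc]
  rw [← truncLog_ad_apply_eq_dynkinSeries_lie (K + 1) hx hy, ← had,
    truncLog_truncExp (pow_ad_eq_zero (by omega) hlN), LieAlgebra.ad_apply]

theorem dynkinSeries_zero (M : ℕ) {L : Type*} [LieRing L] [LieAlgebra ℝ L] :
    dynkinSeries M (0 : L) 0 = 0 := by
  refine Finset.sum_eq_zero fun n _ => Finset.sum_eq_zero fun e _ => ?_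
  have h : ∀ l : List L, (∀ z ∈ l, z = 0) → lieWord l = 0 := by
    intro l hl
    cases l with
    | nil => rfl
    | cons a l =>
      cases l with
      | nil => exact hl a (by simp)
      | cons b l => rw [lieWord_cons a (by simp), hl a (by simp), zero_lie]
  rw [h, smul_zero, ite_self]
  intro z hz
  simpa using mem_powerWord hz

open Polynomial in
/-- The operator `t d/dt` on polynomials over an `ℝ`-algebra. -/
def eulerOperator (A : Type*) [Ring A] [Algebra ℝ A] : Module.End ℝ A[X] where
  toFun p := X * derivative p
  map_add' p q := by simp [mul_add]
  map_smul' r p := by simp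

open Polynomial in
theorem lie_lmul_eulerOperator (p : A[X]) :
    ⁅Algebra.lmul ℝ A[X] p, eulerOperator A⁆ = -Algebra.lmul ℝ A[X] (X * derivative p) := by
  refine LinearMap.ext fun q => ?_
  simp only [LieRing.of_associative_ring_bracket, eulerOperator, LinearMap.sub_apply,
    Module.End.mul_apply, Algebra.coe_lmul_eq_mul, LinearMap.mul_apply', LinearMap.coe_mk,
    AddHom.coe_mk, derivative_mul, LinearMap.neg_apply]
  rw [← mul_assoc p X, ← X_mul, mul_add]
  simp only [mul_assoc]
  abel

open Polynomial in
/-- The Baker–Campbell–Hausdorff formula in an associative algebra. -/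
theorem truncLog_eq_dynkinSeries {N K : ℕ} (hK : 2 * N ≤ K) {u w : A} (h : WordsVanish N u w) :
    truncLog (K + 1) (truncExp (K + 1) u * truncExp (K + 1) w) = dynkinSeries (K + 1) u w := by
  -- The letters are made homogeneous of degree one in a variable, so that multiplication by them
  -- satisfies the Euler relation with t d/dt.
  set U : A[X] := C u * X with hU
  set W : A[X] := C w * X with hW
  have hword : ∀ l : List Bool, (l.map fun b => cond b U W).prod =
      C ((l.map fun b => cond b u w).prod) * X ^ l.length := by
    intro l
    induction l with
    | nil => simp
    | cons b l ih =>
      have : cond b U W = C (cond b u w) * X := by cases b <;> rfl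
      rw [List.map_cons, List.prod_cons, ih, this, List.map_cons, List.prod_cons, C_mul,
        List.length_cons, pow_succ', mul_assoc, mul_assoc, ← mul_assoc X, X_mul, mul_assoc]
  have hUW : WordsVanish N U W := fun l hl => by rw [hword, h l hl, C_0, zero_mul]
  set p : A[X] := truncLog (K + 1) (truncExp (K + 1) U * truncExp (K + 1) W) -
    dynkinSeries (K + 1) U W with hp
  have hE : ∀ a : A, ⁅Algebra.lmul ℝ A[X] (C a * X), eulerOperator A⁆ =
      -Algebra.lmul ℝ A[X] (C a * X) := by
    intro a
    rw [lie_lmul_eulerOperator]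
    simp [X_mul]
  have hdyn : Algebra.lmul ℝ A[X] (dynkinSeries (K + 1) U W) =
      dynkinSeries (K + 1) (Algebra.lmul ℝ A[X] U) (Algebra.lmul ℝ A[X] W) :=
    map_dynkinSeries (Algebra.lmul ℝ A[X]).toLieHom _ _ _
  -- The two sides of the formula have the same bracket with the Euler operator, so their difference
  -- p has zero Euler derivative and is constant.
  have hlie : ⁅Algebra.lmul ℝ A[X] p, eulerOperator A⁆ = 0 := by
    rw [hp, map_sub, sub_lie, map_truncLog, map_mul, map_truncExp, map_truncExp, hdyn,
      truncLog_lie_eq_dynkinSeries_lie hK (hUW.map (Algebra.lmul ℝ A[X])) (hE u) (hE w), sub_self]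
  have hder : X * derivative p = 0 := by
    rw [lie_lmul_eulerOperator, neg_eq_zero] at hlie
    simpa using LinearMap.congr_fun hlie 1
  have hcoeff : ∀ n, n ≠ 0 → p.coeff n = 0 := by
    intro n hn
    obtain ⟨m, rfl⟩ := Nat.exists_eq_succ_of_ne_zero hn
    have h1 := congrArg (fun q => coeff q (m + 1)) hder
    simp only [coeff_X_mul, coeff_derivative, coeff_zero] at h1
    have h2 : ((m : ℝ) + 1) • p.coeff (m + 1) = 0 := by
      rw [← h1, Algebra.smul_def]
      simp [mul_add, add_mul, Nat.cast_comm]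
    exact (smul_eq_zero.1 h2).resolve_left (by positivity)
  have hpC : p = C (p.coeff 0) := by
    ext n
    rcases eq_or_ne n 0 with rfl | hn
    · simp
    · rw [hcoeff n hn, coeff_C_of_ne_zero hn]
  -- A constant polynomial has the same value at every central r: at r = 1 it is the desired
  -- difference, at r = 0 it is zero.
  have heval : ∀ (r : A) (hr : ∀ a : A, Commute a r), p.coeff 0 =
      truncLog (K + 1) (truncExp (K + 1) (u * r) * truncExp (K + 1) (w * r)) -
        dynkinSeries (K + 1) (u * r) (w * r) := by
    intro r hr
    set q : A[X] →ₐ[ℝ] A := eval₂AlgHom (AlgHom.id ℝ A) r hr with hq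
    have hqC : ∀ a, q (C a) = a := fun a => eval₂_C _ _
    have hqX : ∀ a, q (C a * X) = a * r := fun a => by
      rw [map_mul, hqC]
      exact congrArg (a * ·) (eval₂_X _ _)
    have hd : q (dynkinSeries (K + 1) U W) = dynkinSeries (K + 1) (q U) (q W) :=
      map_dynkinSeries q.toLieHom _ _ _
    have h1 : q p = p.coeff 0 := by
      conv_lhs => rw [hpC]
      exact hqC _
    rw [← h1, hp, map_sub, hd, map_truncLog, map_mul, map_truncExp, map_truncExp, hqX, hqX]
  have h0 := heval 0 fun a => Commute.zero_right a
  have h1 := heval 1 fun a => Commute.one_right a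
  simp only [mul_zero, mul_one, truncExp_zero, dynkinSeries_zero, sub_zero] at h0 h1
  rw [h0] at h1
  rw [← sub_eq_zero, ← h1]
  refine Finset.sum_eq_zero fun n hn => ?_
  rw [sub_self, zero_pow (by have := (Finset.mem_Icc.1 hn).1; omega), smul_zero]

end AssociativeBCH

end

noncomputable section

/-! ### From associative algebras to nilpotent Lie algebras -/

section LieCorrespondence

variable {E L : Type*} [LieRing E] [LieAlgebra ℝ E] [LieRing L] [LieAlgebra ℝ L]
  {S : Submodule ℝ (E × L)} (hS : ∀ p q : E × L, p ∈ S → q ∈ S → (⁅p.1, q.1⁆, ⁅p.2, q.2⁆) ∈ S)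

include hS

theorem lieWord_mem_prod {l : List (E × L)} (hl : ∀ z ∈ l, z ∈ S) :
    (lieWord (l.map Prod.fst), lieWord (l.map Prod.snd)) ∈ S := by
  induction l with
  | nil => exact zero_mem _
  | cons a l ih =>
    cases l with
    | nil => exact hl a (by simp)
    | cons b l =>
      exact hS _ _ (hl a (by simp)) (ih fun z hz => hl z (List.mem_cons_of_mem _ hz))

theorem dynkinSeries_mem_prod (M : ℕ) {p q : E × L} (hp : p ∈ S) (hq : q ∈ S) :
    (dynkinSeries M p.1 q.1, dynkinSeries M p.2 q.2) ∈ S := by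
  have : (dynkinSeries M p.1 q.1, dynkinSeries M p.2 q.2) =
      ∑ n ∈ Finset.Icc 1 M, ∑ e : Fin n → Fin (M + 1) × Fin (M + 1),
        if ∀ i, 0 < ((e i).1 : ℕ) + ((e i).2 : ℕ) then
          ((-1 : ℝ) ^ (n - 1) / (n : ℝ) /
            (((∑ i, (((e i).1 : ℕ) + ((e i).2 : ℕ)) : ℕ) : ℝ) * (factorialWeight e : ℝ))) •
            (lieWord ((powerWord p q e).map Prod.fst), lieWord ((powerWord p q e).map Prod.snd))
        else 0 := by
    refine Prod.ext ?_ ?_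
    · simp only [dynkinSeries, Prod.fst_sum, apply_ite Prod.fst, Prod.smul_fst, map_powerWord,
        Prod.fst_zero]
    · simp only [dynkinSeries, Prod.snd_sum, apply_ite Prod.snd, Prod.smul_snd, map_powerWord,
        Prod.snd_zero]
  rw [this]
  refine Submodule.sum_mem _ fun n _ => Submodule.sum_mem _ fun e _ => ?_
  split_ifs
  · refine Submodule.smul_mem _ _ (lieWord_mem_prod hS fun z hz => ?_)
    rcases mem_powerWord hz with rfl | rfl <;> assumption
  · exact zero_mem _

theorem truncExp_ad_mem_prod (M : ℕ) {p q : E × L} (hp : p ∈ S) (hq : q ∈ S) :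
    (truncExp M (LieAlgebra.ad ℝ E p.1) q.1, truncExp M (LieAlgebra.ad ℝ L p.2) q.2) ∈ S := by
  have hpow : ∀ k : ℕ, ((LieAlgebra.ad ℝ E p.1 ^ k) q.1, (LieAlgebra.ad ℝ L p.2 ^ k) q.2) ∈ S := by
    intro k
    induction k with
    | zero => simpa using hq
    | succ k ih =>
      rw [pow_succ', pow_succ', Module.End.mul_apply, Module.End.mul_apply]
      exact hS _ _ hp ih
  have := Submodule.sum_mem S (t := Finset.range (M + 1)) fun k _ =>
    Submodule.smul_mem _ ((k.factorial : ℝ)⁻¹) (hpow k)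
  convert this using 1
  refine Prod.ext ?_ ?_
  · simp [truncExp, Prod.fst_sum, LinearMap.sum_apply]
  · simp [truncExp, Prod.snd_sum, LinearMap.sum_apply]

end LieCorrespondence

section NilpotentLie

theorem truncLog_mul_of_commute {A : Type*} [Ring A] [Algebra ℝ A] {M : ℕ} {a b : A}
    (hab : Commute a b) (ha : a ^ (M + 2) = 0) (hb : b ^ (M + 2) = 0) (hc : (a + b) ^ (M + 2) = 0) :
    truncLog (M + 1) (truncExp (M + 1) a * truncExp (M + 1) b) = a + b := by
  rw [← truncExp_add hab ha hb hc, truncLog_truncExp hc]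

theorem mul_mul_truncExp_neg_pow {A : Type*} [Ring A] [Algebra ℝ A] {M : ℕ} {a : A}
    (ha : a ^ (M + 1) = 0) (b : A) (k : ℕ) :
    (truncExp M a * b * truncExp M (-a)) ^ k = truncExp M a * b ^ k * truncExp M (-a) := by
  induction k with
  | zero => rw [pow_zero, pow_zero, mul_one, truncExp_mul_neg ha]
  | succ k ih =>
    rw [pow_succ, ih, pow_succ]
    simp only [mul_assoc]
    rw [← mul_assoc (truncExp M (-a)) (truncExp M a), truncExp_neg_mul ha, one_mul]

theorem truncExp_mul_mul_neg {A : Type*} [Ring A] [Algebra ℝ A] {M : ℕ} {a : A}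
    (ha : a ^ (M + 1) = 0) (b : A) :
    truncExp M (truncExp M a * b * truncExp M (-a)) =
      truncExp M a * truncExp M b * truncExp M (-a) := by
  rw [truncExp]
  simp only [mul_mul_truncExp_neg_pow ha]
  rw [truncExp.eq_1 M b]
  simp only [Finset.mul_sum, Finset.sum_mul, mul_smul_comm, smul_mul_assoc]

attribute [local instance] LieRing.ofAssociativeRing

variable {L : Type*} [LieRing L] [LieAlgebra ℝ L]

theorem mk_add_mem_prod {A : Type*} [Ring A] [Algebra ℝ A] {S : Submodule ℝ (A × L)} {a b : A}
    {x y : L} (hx : (a, x) ∈ S) (hy : (b, y) ∈ S) : (a + b, x + y) ∈ S :=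
  add_mem hx hy

theorem mk_neg_mem_prod {A : Type*} [Ring A] [Algebra ℝ A] {S : Submodule ℝ (A × L)} {a : A}
    {x : L} (hx : (a, x) ∈ S) : (-a, -x) ∈ S :=
  neg_mem hx

/-- The linear operators of `L[t] ⊕ ℝ`. -/
def LoopEnd (L : Type*) [LieRing L] [LieAlgebra ℝ L] : Type _ :=
  Module.End ℝ ((ℕ →₀ L) × ℝ)

instance : Ring (LoopEnd L) := inferInstanceAs (Ring (Module.End ℝ ((ℕ →₀ L) × ℝ)))

instance : Algebra ℝ (LoopEnd L) := inferInstanceAs (Algebra ℝ (Module.End ℝ ((ℕ →₀ L) × ℝ)))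

/-- The elements of `LoopEnd L` as linear maps. -/
def LoopEnd.toEnd (L : Type*) [LieRing L] [LieAlgebra ℝ L] :
    LoopEnd L ≃ₐ[ℝ] Module.End ℝ ((ℕ →₀ L) × ℝ) :=
  AlgEquiv.refl

/-- The action of `x tⁿ` on `L[t] ⊕ ℝ`, where `ℝ` is spanned by the derivation `-t d/dt`. -/
def loopAction (n : ℕ) (x : L) : LoopEnd L :=
  (LoopEnd.toEnd L).symm (LinearMap.inl ℝ _ _ ∘ₗ LinearMap.coprod
    (Finsupp.lmapDomain L ℝ (n + ·) ∘ₗ Finsupp.mapRange.linearMap (LieAlgebra.ad ℝ L x))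
    (LinearMap.toSpanSingleton ℝ _ (Finsupp.single n ((n : ℝ) • x))))

theorem loopAction_single (n k : ℕ) (x z : L) :
    LoopEnd.toEnd L (loopAction n x) (Finsupp.single k z, 0) =
      (Finsupp.single (n + k) ⁅x, z⁆, 0) := by
  simp [loopAction, Finsupp.mapDomain_single]

theorem loopAction_one (n : ℕ) (x : L) :
    LoopEnd.toEnd L (loopAction n x) (0, 1) = (Finsupp.single n ((n : ℝ) • x), 0) := by
  simp [loopAction]

theorem loopEnd_ext {a b : LoopEnd L}
    (h1 : ∀ k z, LoopEnd.toEnd L a (Finsupp.single k z, 0) =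
      LoopEnd.toEnd L b (Finsupp.single k z, 0))
    (h2 : LoopEnd.toEnd L a (0, 1) = LoopEnd.toEnd L b (0, 1)) : a = b :=
  (LoopEnd.toEnd L).injective (LinearMap.prod_ext (Finsupp.lhom_ext h1) (LinearMap.ext_ring h2))

/-- On L[t] this is the Jacobi identity. On the vector representing −t d/dt the factors n and m add
up, because t d/dt is a derivation. -/
theorem lie_loopAction (n m : ℕ) (x y : L) :
    ⁅loopAction n x, loopAction m y⁆ = loopAction (n + m) ⁅x, y⁆ := by
  refine loopEnd_ext (fun k z => ?_) ?_
  · simp only [LieRing.of_associative_ring_bracket, map_sub, map_mul, LinearMap.sub_apply,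
      Module.End.mul_apply, loopAction_single]
    rw [← add_assoc, ← add_assoc, add_comm m n, Prod.mk_sub_mk, ← Finsupp.single_sub, sub_zero,
      lie_lie]
  · simp only [LieRing.of_associative_ring_bracket, map_sub, map_mul, LinearMap.sub_apply,
      Module.End.mul_apply, loopAction_single, loopAction_one]
    rw [add_comm m n, Prod.mk_sub_mk, ← Finsupp.single_sub, sub_zero, lie_smul, lie_smul,
      ← lie_skew x y]
    push_cast
    congr 2
    module

theorem loopAction_zero (n : ℕ) : loopAction n (0 : L) = 0 := by
  refine loopEnd_ext (fun k z => ?_) ?_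
  · simp [loopAction_single]
  · simp [loopAction_one]

theorem commute_loopAction {x y : L} (hxy : ⁅x, y⁆ = 0) :
    Commute (loopAction 1 x) (loopAction 1 y) := by
  have h := lie_loopAction 1 1 x y
  rw [hxy, loopAction_zero, LieRing.of_associative_ring_bracket] at h
  exact sub_eq_zero.1 h

/-- The graph of the evaluation `t = 1` on `t L[t]`, acting faithfully on `L[t] ⊕ ℝ`. -/
def loopGraph (L : Type*) [LieRing L] [LieAlgebra ℝ L] :
    Submodule ℝ (LoopEnd L × L) :=
  Submodule.span ℝ {q | ∃ n : ℕ, ∃ x : L, n ≠ 0 ∧ q = (loopAction n x, x)}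

theorem loopAction_mem (x : L) : (loopAction 1 x, x) ∈ loopGraph L :=
  Submodule.subset_span ⟨1, x, one_ne_zero, rfl⟩

theorem lie_mem_loopGraph {p q : LoopEnd L × L} (hp : p ∈ loopGraph L)
    (hq : q ∈ loopGraph L) : (⁅p.1, q.1⁆, ⁅p.2, q.2⁆) ∈ loopGraph L := by
  refine Submodule.span_induction₂ (p := fun p q _ _ => (⁅p.1, q.1⁆, ⁅p.2, q.2⁆) ∈ loopGraph L)
    ?_ ?_ ?_ ?_ ?_ ?_ ?_ hp hq
  · rintro _ _ ⟨n, x, hn, rfl⟩ ⟨m, y, hm, rfl⟩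
    exact Submodule.subset_span ⟨n + m, ⁅x, y⁆, by omega, by rw [lie_loopAction]⟩
  · intro y _
    have := zero_mem (loopGraph L)
    rw [Prod.zero_eq_mk] at this
    simpa using this
  · intro x _
    have := zero_mem (loopGraph L)
    rw [Prod.zero_eq_mk] at this
    simpa using this
  · intro x y z _ _ _ h1 h2
    simpa using add_mem h1 h2
  · intro x y z _ _ _ h1 h2
    simpa using add_mem h1 h2
  · intro r x y _ _ h
    simpa using Submodule.smul_mem _ r h
  · intro r x y _ _ h
    simpa using Submodule.smul_mem _ r h

theorem dynkinSeries_mem_loopGraph (M : ℕ) {p q : LoopEnd L × L}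
    (hp : p ∈ loopGraph L) (hq : q ∈ loopGraph L) :
    (dynkinSeries M p.1 q.1, dynkinSeries M p.2 q.2) ∈ loopGraph L :=
  dynkinSeries_mem_prod (fun _ _ => lie_mem_loopGraph) M hp hq

/-- The evaluation `t = 1`, recovered from the action. -/
def loopEval (L : Type*) [LieRing L] [LieAlgebra ℝ L] :
    LoopEnd L →ₗ[ℝ] L :=
  Finsupp.lsum ℝ (fun n : ℕ => (n : ℝ)⁻¹ • (LinearMap.id : L →ₗ[ℝ] L)) ∘ₗ
    LinearMap.fst ℝ _ _ ∘ₗ LinearMap.applyₗ ((0, 1) : (ℕ →₀ L) × ℝ) ∘ₗ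
      (LoopEnd.toEnd L).toLinearMap

/-- Applied to the added derivation, x tⁿ yields n·x tⁿ, from which x is recovered by dividing by n.
Hence the restriction to n ≠ 0 in the graph, and hence faithfulness without any condition on the
centre of L. -/
theorem loopEval_eq {p : LoopEnd L × L} (hp : p ∈ loopGraph L) :
    loopEval L p.1 = p.2 := by
  have : loopGraph L ≤ LinearMap.ker (loopEval L ∘ₗ LinearMap.fst ℝ _ _ - LinearMap.snd ℝ _ _) := by
    refine Submodule.span_le.2 ?_
    rintro _ ⟨n, x, hn, rfl⟩
    have hn' : (n : ℝ) ≠ 0 := by exact_mod_cast hn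
    simp [loopEval, loopAction_one, smul_smul, hn']
  simpa [sub_eq_zero] using this hp

theorem eq_of_loopGraph {a : LoopEnd L} {x y : L} (hx : (a, x) ∈ loopGraph L)
    (hy : (a, y) ∈ loopGraph L) : x = y :=
  (loopEval_eq hx).symm.trans (loopEval_eq hy)

/-- The filtration of `L[t] ⊕ ℝ` induced by the lower central series. -/
def loopFiltration (L : Type*) [LieRing L] [LieAlgebra ℝ L] (k : ℕ) :
    Submodule ℝ ((ℕ →₀ L) × ℝ) where
  carrier := {f | f.2 = 0 ∧ ∀ n, f.1 n ∈ LieModule.lowerCentralSeries ℝ L L k}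
  add_mem' := by
    rintro a b ⟨ha, ha'⟩ ⟨hb, hb'⟩
    exact ⟨by simp [ha, hb], fun n => add_mem (ha' n) (hb' n)⟩
  zero_mem' := ⟨rfl, fun n => zero_mem _⟩
  smul_mem' := by
    rintro r a ⟨ha, ha'⟩
    exact ⟨by simp [ha], fun n => SMulMemClass.smul_mem r (ha' n)⟩

theorem lie_mem_lowerCentralSeries_succ {k : ℕ} (x : L) {y : L}
    (hy : y ∈ LieModule.lowerCentralSeries ℝ L L k) :
    ⁅x, y⁆ ∈ LieModule.lowerCentralSeries ℝ L L (k + 1) := by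
  rw [LieModule.lowerCentralSeries_succ]
  exact LieSubmodule.lie_mem_lie (LieSubmodule.mem_top x) hy

/-- The first operator only removes the ℝ-summand; each further one descends a step in the lower
central series. -/
theorem loopGraph_mapsTo {p : LoopEnd L × L} (hp : p ∈ loopGraph L) :
    (∀ f, LoopEnd.toEnd L p.1 f ∈ loopFiltration L 0) ∧
      ∀ k, ∀ f ∈ loopFiltration L k, LoopEnd.toEnd L p.1 f ∈ loopFiltration L (k + 1) := by
  induction hp using Submodule.span_induction with
  | mem q hq =>
    obtain ⟨n, x, -, rfl⟩ := hq
    refine ⟨fun f => ⟨by simp [loopAction], fun m => by simp⟩, ?_⟩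
    rintro k ⟨f, c⟩ ⟨hc, hf⟩
    obtain rfl : c = 0 := hc
    have h1 : ((f, 0) : (ℕ →₀ L) × ℝ) = f.sum fun n z => (Finsupp.single n z, 0) := by
      refine Prod.ext ?_ ?_
      · rw [Finsupp.sum, Prod.fst_sum]
        exact (Finsupp.sum_single f).symm
      · rw [Finsupp.sum, Prod.snd_sum]
        simp
    rw [h1, map_finsuppSum]
    refine Submodule.sum_mem _ fun m _ => ?_
    change LoopEnd.toEnd L (loopAction n x) (Finsupp.single m (f m), 0) ∈ _
    rw [loopAction_single]
    refine ⟨rfl, fun j => ?_⟩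
    change (Finsupp.single (n + m) ⁅x, f m⁆) j ∈ _
    rw [Finsupp.single_apply]
    split_ifs
    · exact lie_mem_lowerCentralSeries_succ x (hf m)
    · exact zero_mem _
  | zero => exact ⟨fun f => zero_mem _, fun k f _ => zero_mem _⟩
  | add p q _ _ hp hq =>
    exact ⟨fun f => add_mem (hp.1 f) (hq.1 f), fun k f hf => add_mem (hp.2 k f hf) (hq.2 k f hf)⟩
  | smul r p _ hp =>
    exact ⟨fun f => Submodule.smul_mem _ r (hp.1 f),
      fun k f hf => Submodule.smul_mem _ r (hp.2 k f hf)⟩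

/-- The first letter to act costs one step, so a word of length k lands in level k − 1; this is why
the bound is N < k. -/
theorem wordsVanish_loopGraph {N : ℕ} (hN : LieModule.lowerCentralSeries ℝ L L N = ⊥)
    {p q : LoopEnd L × L} (hp : p ∈ loopGraph L) (hq : q ∈ loopGraph L) :
    WordsVanish N p.1 q.1 := by
  have key : ∀ l : List Bool, l ≠ [] → ∀ f, LoopEnd.toEnd L (l.map fun b => cond b p.1 q.1).prod f ∈
      loopFiltration L (l.length - 1) := by
    intro l
    induction l with
    | nil => exact fun h => absurd rfl h
    | cons b l ih =>
      intro _ f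
      have hb : (cond b p q) ∈ loopGraph L := by cases b <;> assumption
      have e : cond b p.1 q.1 = (cond b p q).1 := by cases b <;> rfl
      rw [List.map_cons, List.prod_cons, map_mul, Module.End.mul_apply, e]
      rcases eq_or_ne l [] with rfl | hl
      · exact (loopGraph_mapsTo hb).1 _
      · have := (loopGraph_mapsTo hb).2 _ _ (ih hl f)
        rwa [Nat.sub_add_cancel (List.length_pos_iff.2 hl)] at this
  intro l hl
  refine (LoopEnd.toEnd L).injective (LinearMap.ext fun f => ?_)
  rw [map_zero]
  obtain ⟨h1, h2⟩ := key l (by rintro rfl; simp at hl) f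
  have hbot : LieModule.lowerCentralSeries ℝ L L (l.length - 1) = ⊥ :=
    le_bot_iff.1 (hN ▸ LieModule.antitone_lowerCentralSeries ℝ L L (by omega))
  refine Prod.ext (Finsupp.ext fun n => ?_) h1
  have := h2 n
  rwa [hbot, LieSubmodule.mem_bot] at this

section GroupLaw

variable {N K : ℕ} (hN : LieModule.lowerCentralSeries ℝ L L N = ⊥) (hK : 2 * N ≤ K)

include hN hK

theorem dynkinSeries_loopGraph {p q : LoopEnd L × L} (hp : p ∈ loopGraph L)
    (hq : q ∈ loopGraph L) :
    dynkinSeries (K + 1) p.1 q.1 = truncLog (K + 1) (truncExp (K + 1) p.1 * truncExp (K + 1) q.1) :=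
  (truncLog_eq_dynkinSeries hK (wordsVanish_loopGraph hN hp hq)).symm

theorem truncExp_dynkinSeries_loopGraph {p q : LoopEnd L × L}
    (hp : p ∈ loopGraph L) (hq : q ∈ loopGraph L) :
    truncExp (K + 1) (dynkinSeries (K + 1) p.1 q.1) =
      truncExp (K + 1) p.1 * truncExp (K + 1) q.1 := by
  rw [dynkinSeries_loopGraph hN hK hp hq, truncExp_truncLog]
  exact (wordsVanish_loopGraph hN hp hq).pow_truncExp_sub_one _ (by omega)

/-- Both bracketings are partners in the graph of the one operator log(eˣeʸeᶻ), so they agree by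
single-valuedness. -/
theorem dynkinSeries_assoc (x y z : L) :
    dynkinSeries (K + 1) (dynkinSeries (K + 1) x y) z =
      dynkinSeries (K + 1) x (dynkinSeries (K + 1) y z) := by
  have hx := loopAction_mem x
  have hy := loopAction_mem y
  have hz := loopAction_mem z
  have hxy := dynkinSeries_mem_loopGraph (K + 1) hx hy
  have hyz := dynkinSeries_mem_loopGraph (K + 1) hy hz
  have h1 := dynkinSeries_mem_loopGraph (K + 1) hxy hz
  have h2 := dynkinSeries_mem_loopGraph (K + 1) hx hyz
  refine eq_of_loopGraph h1 ?_
  convert h2 using 2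
  rw [dynkinSeries_loopGraph hN hK hxy hz, dynkinSeries_loopGraph hN hK hx hyz,
    truncExp_dynkinSeries_loopGraph hN hK hx hy, truncExp_dynkinSeries_loopGraph hN hK hy hz,
    mul_assoc]

theorem dynkinSeries_eq_add {x y : L} (hxy : ⁅x, y⁆ = 0) : dynkinSeries (K + 1) x y = x + y := by
  have hx := loopAction_mem x
  have hy := loopAction_mem y
  have hadd : (loopAction 1 x + loopAction 1 y, x + y) ∈ loopGraph L :=
    mk_add_mem_prod hx hy
  have hc := commute_loopAction hxy
  have h0 := wordsVanish_loopGraph hN hx hy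
  have h1 := wordsVanish_loopGraph hN hadd hadd
  have h2 : loopAction 1 x ^ (K + 1 + 1) = 0 := h0.pow_left (by omega)
  have h3 : loopAction 1 y ^ (K + 1 + 1) = 0 := h0.pow_right (by omega)
  have h4 : (loopAction 1 x + loopAction 1 y) ^ (K + 1 + 1) = 0 := h1.pow_left (by omega)
  have e : dynkinSeries (K + 1) (loopAction 1 x) (loopAction 1 y) =
      loopAction 1 x + loopAction 1 y := by
    exact (dynkinSeries_loopGraph hN hK hx hy).trans (truncLog_mul_of_commute hc h2 h3 h4)
  have h5 := dynkinSeries_mem_loopGraph (K + 1) hx hy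
  dsimp only at h5
  rw [e] at h5
  exact eq_of_loopGraph h5 hadd

/-- In the operator algebra, log(eˣ eʸ e⁻ˣ) = eˣ y e⁻ˣ = exp(ad x) y. The graph is closed under both
the series and the powers of `ad`, so the identity descends. -/
theorem dynkinSeries_conj (x y : L) :
    dynkinSeries (K + 1) (dynkinSeries (K + 1) x y) (-x) =
      truncExp (K + 1) (LieAlgebra.ad ℝ L x) y := by
  have hx := loopAction_mem x
  have hnx : (-loopAction 1 x, -x) ∈ loopGraph L :=
    mk_neg_mem_prod hx
  have hy := loopAction_mem y
  have hxy := dynkinSeries_mem_loopGraph (K + 1) hx hy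
  have hexp := truncExp_ad_mem_prod (fun _ _ => lie_mem_loopGraph) (K + 1) hx hy
  have h0 := wordsVanish_loopGraph hN hx hy
  have h1 : loopAction 1 x ^ (N + 1) = 0 := h0.pow_left (by omega)
  have h2 : loopAction 1 x ^ (K + 1 + 1) = 0 := h0.pow_left (by omega)
  have h3 : loopAction 1 y ^ (K + 2) = 0 := h0.pow_right (by omega)
  have e : dynkinSeries (K + 1) (dynkinSeries (K + 1) (loopAction 1 x) (loopAction 1 y))
      (-loopAction 1 x) = truncExp (K + 1) (LieAlgebra.ad ℝ _ (loopAction 1 x)) (loopAction 1 y) := by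
    have h4 := dynkinSeries_loopGraph hN hK hxy hnx
    have h5 := truncExp_dynkinSeries_loopGraph hN hK hx hy
    dsimp only at h4 h5
    rw [truncExp_ad_apply (N := N) (by omega) h1]
    refine h4.trans ?_
    rw [h5, ← truncExp_mul_mul_neg h2, truncLog_truncExp]
    rw [mul_mul_truncExp_neg_pow h2, h3, mul_zero, zero_mul]
  have h6 := dynkinSeries_mem_loopGraph (K + 1) hxy hnx
  dsimp only at h6 hexp
  rw [e] at h6
  exact eq_of_loopGraph h6 hexp

end GroupLaw

end NilpotentLie

end

noncomputable section

/-! ### Independence of the truncation order -/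

section Truncation

variable {L : Type*} [LieRing L] [LieAlgebra ℝ L]

theorem lieWord_mem_lowerCentralSeries {l : List L} (hl : l ≠ []) :
    lieWord l ∈ LieModule.lowerCentralSeries ℝ L L (l.length - 1) := by
  induction l with
  | nil => exact absurd rfl hl
  | cons a l ih =>
    cases l with
    | nil => simp
    | cons b l =>
      rw [lieWord_cons a (by simp)]
      exact lie_mem_lowerCentralSeries_succ a (ih (by simp))

theorem lieWord_eq_zero {N : ℕ} (hN : LieModule.lowerCentralSeries ℝ L L N = ⊥) {l : List L}
    (hl : N < l.length) : lieWord l = 0 := by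
  have h := lieWord_mem_lowerCentralSeries (l := l) (by rintro rfl; simp at hl)
  have hbot : LieModule.lowerCentralSeries ℝ L L (l.length - 1) = ⊥ :=
    le_bot_iff.1 (hN ▸ LieModule.antitone_lowerCentralSeries ℝ L L (by omega))
  rwa [hbot, LieSubmodule.mem_bot] at h

/-- Every added term is a bracket of more than N letters: one exponent exceeds N, or there are more
than N nonempty blocks. -/
theorem dynkinSeries_eq_of_le {N M : ℕ} (hN : LieModule.lowerCentralSeries ℝ L L N = ⊥)
    (hM : N ≤ M) (x y : L) : dynkinSeries N x y = dynkinSeries M x y := by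
  rw [dynkinSeries, dynkinSeries, ← Finset.sum_subset (Finset.Icc_subset_Icc_right hM)]
  · refine Finset.sum_congr rfl fun n _ => ?_
    let f : Fin (N + 1) × Fin (N + 1) → Fin (M + 1) × Fin (M + 1) :=
      Prod.map (Fin.castLE (by omega)) (Fin.castLE (by omega))
    have hf : Function.Injective f :=
      (Fin.castLE_injective _).prodMap (Fin.castLE_injective _)
    refine Finset.sum_of_injOn (fun e i => f (e i)) (fun e _ e' _ h => funext fun i =>
      hf (congrFun h i)) (fun _ _ => by simp) ?_ ?_
    · intro e _ he
      split_ifs with h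
      · rw [lieWord_eq_zero hN, smul_zero]
        rw [length_powerWord]
        by_contra! hlt
        refine he ⟨fun i => (⟨(e i).1, ?_⟩, ⟨(e i).2, ?_⟩), by simp, rfl⟩
        · have := Finset.single_le_sum (f := fun i => (((e i).1 : ℕ) + ((e i).2 : ℕ)))
            (fun i _ => Nat.zero_le _) (Finset.mem_univ i)
          omega
        · have := Finset.single_le_sum (f := fun i => (((e i).1 : ℕ) + ((e i).2 : ℕ)))
            (fun i _ => Nat.zero_le _) (Finset.mem_univ i)
          omega
      · rfl
    · intro e _
      rfl
  · intro n hn hn'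
    refine Finset.sum_eq_zero fun e _ => ?_
    split_ifs with h
    · rw [lieWord_eq_zero hN, smul_zero]
      rw [length_powerWord]
      calc N < n := by
            rw [Finset.mem_Icc] at hn hn'
            omega
        _ = ∑ i : Fin n, 1 := by simp
        _ ≤ _ := Finset.sum_le_sum fun i _ => h i
    · rfl

end Truncation

/-! ### Dynkin's series by degree in the second variable, and seminorm bounds -/

section Estimates

variable {L : Type*} [LieRing L] [LieAlgebra ℝ L]

/-- The terms of Dynkin's series `x ∗ y` whose degree in `y` satisfies `P`. -/
def dynkinPart (P : ℕ → Prop) [DecidablePred P] (M : ℕ) (x y : L) : L :=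
  ∑ n ∈ Finset.Icc 1 M, ∑ e : Fin n → Fin (M + 1) × Fin (M + 1),
    if P (∑ i, ((e i).2 : ℕ)) then
      if ∀ i, 0 < ((e i).1 : ℕ) + ((e i).2 : ℕ) then
        ((-1 : ℝ) ^ (n - 1) / (n : ℝ) /
          (((∑ i, (((e i).1 : ℕ) + ((e i).2 : ℕ)) : ℕ) : ℝ) * (factorialWeight e : ℝ))) •
          lieWord (powerWord x y e)
      else 0
    else 0

theorem dynkinSeries_eq_sum_dynkinPart (M : ℕ) (x y : L) :
    dynkinSeries M x y =
      dynkinPart (· = 0) M x y + dynkinPart (· = 1) M x y + dynkinPart (2 ≤ ·) M x y := by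
  simp only [dynkinSeries, dynkinPart, ← Finset.sum_add_distrib]
  refine Finset.sum_congr rfl fun n _ => Finset.sum_congr rfl fun e _ => ?_
  have key : ∀ (k : ℕ) (t : L),
      t = (if k = 0 then t else 0) + (if k = 1 then t else 0) + (if 2 ≤ k then t else 0) := by
    intro k t
    rcases k with _ | _ | k <;> simp
  exact key _ _

theorem count_powerWord {n N : ℕ} (e : Fin n → Fin N × Fin N) :
    (powerWord true false e).count false = ∑ i, ((e i).2 : ℕ) := by
  simp [powerWord, List.count_flatten, List.map_ofFn, List.sum_ofFn, Function.comp_def,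
    List.count_replicate]

theorem count_true_powerWord {n N : ℕ} (e : Fin n → Fin N × Fin N) :
    (powerWord true false e).count true = ∑ i, ((e i).1 : ℕ) := by
  simp [powerWord, List.count_flatten, List.map_ofFn, List.sum_ofFn, Function.comp_def,
    List.count_replicate]

theorem lieWord_eq_zero_of_mem {L : Type*} [LieRing L] {l : List L} (hl : (0 : L) ∈ l) : lieWord l = 0 := by
  induction l with
  | nil => simp at hl
  | cons a l ih =>
    cases l with
    | nil => simpa [lieWord, eq_comm] using hl
    | cons b l =>
      rw [lieWord_cons a (by simp)]
      rcases List.mem_cons.1 hl with h | h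
      · rw [← h, zero_lie]
      · rw [ih h, lie_zero]

theorem dynkinPart_zero (M : ℕ) (x y : L) :
    dynkinPart (· = 0) M x y = dynkinSeries M x 0 := by
  refine Finset.sum_congr rfl fun n _ => Finset.sum_congr rfl fun e _ => ?_
  split_ifs with h h' h'
  · congr 2
    have h0 : ∀ i, ((e i).2 : ℕ) = 0 := fun i => by
      simpa using (Finset.sum_eq_zero_iff.1 h) i (Finset.mem_univ i)
    simp [powerWord, h0]
  · rfl
  · rw [lieWord_eq_zero_of_mem, smul_zero]
    rw [powerWord_eq_map, List.mem_map]
    refine ⟨false, ?_, rfl⟩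
    rw [← List.count_pos_iff, count_powerWord]
    omega
  · rfl

/-- Linearity in y of the degree-one part is what makes the main increments of the walk martingale
differences. -/
theorem exists_linear_lieWord {x : L} {l : List Bool} (hl : l.count false = 1) :
    ∃ A : L →ₗ[ℝ] L, ∀ y, lieWord (l.map fun b => cond b x y) = A y := by
  induction l with
  | nil => simp at hl
  | cons a l ih =>
    cases l with
    | nil =>
      cases a
      · exact ⟨LinearMap.id, fun y => rfl⟩
      · simp at hl
    | cons b l =>
      cases a
      · have h0 : false ∉ b :: l := by
          rw [List.count_cons_self] at hl
          exact List.count_eq_zero.1 (by omega)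
        have h1 : ∀ y, ((b :: l).map fun b => cond b x y) = (b :: l).map fun _ => x := by
          intro y
          refine List.map_congr_left fun c hc => ?_
          cases c
          · exact absurd hc h0
          · rfl
        refine ⟨-LieAlgebra.ad ℝ L (lieWord ((b :: l).map fun _ => x)), fun y => ?_⟩
        rw [List.map_cons, lieWord_cons _ (by simp), h1]
        simp
      · obtain ⟨A, hA⟩ := ih (by simpa using hl)
        refine ⟨LieAlgebra.ad ℝ L x ∘ₗ A, fun y => ?_⟩
        rw [List.map_cons, lieWord_cons _ (by simp), hA]
        simp

theorem exists_linear_dynkinPart (M : ℕ) (x : L) :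
    ∃ A : L →ₗ[ℝ] L, ∀ y, dynkinPart (· = 1) M x y = A y := by
  have key : ∀ (n : ℕ) (e : Fin n → Fin (M + 1) × Fin (M + 1)), ∃ A : L →ₗ[ℝ] L, ∀ y,
      (if (∑ i, ((e i).2 : ℕ)) = 1 then
        if ∀ i, 0 < ((e i).1 : ℕ) + ((e i).2 : ℕ) then
        ((-1 : ℝ) ^ (n - 1) / (n : ℝ) /
          (((∑ i, (((e i).1 : ℕ) + ((e i).2 : ℕ)) : ℕ) : ℝ) * (factorialWeight e : ℝ))) •
          lieWord (powerWord x y e)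
        else 0 else 0) = A y := by
    intro n e
    split_ifs with h h'
    · obtain ⟨A, hA⟩ := exists_linear_lieWord (x := x) (l := powerWord true false e)
        (by rw [count_powerWord, h])
      refine ⟨((-1 : ℝ) ^ (n - 1) / (n : ℝ) / (((∑ i, (((e i).1 : ℕ) + ((e i).2 : ℕ)) : ℕ) : ℝ) *
        (factorialWeight e : ℝ))) • A, fun y => ?_⟩
      rw [LinearMap.smul_apply, ← hA, powerWord_eq_map]
    · exact ⟨0, fun y => rfl⟩
    · exact ⟨0, fun y => rfl⟩
  choose A hA using key
  refine ⟨∑ n ∈ Finset.Icc 1 M, ∑ e : Fin n → Fin (M + 1) × Fin (M + 1), A n e, fun y => ?_⟩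
  simp only [dynkinPart, LinearMap.sum_apply, hA]

theorem seminorm_sum_le {E ι : Type*} [AddCommGroup E] [Module ℝ E] (p : Seminorm ℝ E)
    (s : Finset ι) (f : ι → E) : p (∑ i ∈ s, f i) ≤ ∑ i ∈ s, p (f i) :=
  Finset.le_sum_of_subadditive p (map_zero p).le (map_add_le_add p) s f

variable (p : Seminorm ℝ L) {C : ℝ}

theorem seminorm_lieWord_le (hC : 1 ≤ C) (hp : ∀ x y, p ⁅x, y⁆ ≤ C * p x * p y) {x y : L} {a b : ℝ}
    (hx : p x ≤ a) (hy : p y ≤ b) {l : List Bool} (hl : l ≠ []) :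
    p (lieWord (l.map fun b => cond b x y)) ≤ C ^ l.length * a ^ l.count true * b ^ l.count false := by
  have ha : 0 ≤ a := (apply_nonneg p x).trans hx
  have hb : 0 ≤ b := (apply_nonneg p y).trans hy
  induction l with
  | nil => exact absurd rfl hl
  | cons c l ih =>
    cases l with
    | nil =>
      cases c
      · simpa [lieWord] using hy.trans (le_mul_of_one_le_left hb hC)
      · simpa [lieWord] using hx.trans (le_mul_of_one_le_left ha hC)
    | cons d l =>
      rw [List.map_cons, lieWord_cons _ (by simp)]
      have h := ih (by simp)
      set z := lieWord ((d :: l).map fun b => cond b x y)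
      set D := C ^ (d :: l).length * a ^ (d :: l).count true * b ^ (d :: l).count false with hD
      have hD0 : 0 ≤ D := by positivity
      cases c
      · calc p ⁅y, z⁆ ≤ C * p y * p z := hp _ _
          _ ≤ C * b * D := by gcongr
          _ = _ := by
            have e1 : (false :: d :: l).length = (d :: l).length + 1 := rfl
            have e2 : (false :: d :: l).count true = (d :: l).count true := by simp
            have e3 : (false :: d :: l).count false = (d :: l).count false + 1 := by simp
            rw [hD, e1, e2, e3]
            ring
      · calc p ⁅x, z⁆ ≤ C * p x * p z := hp _ _
          _ ≤ C * a * D := by gcongr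
          _ = _ := by
            have e1 : (true :: d :: l).length = (d :: l).length + 1 := rfl
            have e2 : (true :: d :: l).count true = (d :: l).count true + 1 := by simp
            have e3 : (true :: d :: l).count false = (d :: l).count false := by simp
            rw [hD, e1, e2, e3]
            ring

/-- A crude bound for the sum of the coefficients of Dynkin's series. -/
def dynkinBound (M : ℕ) (C : ℝ) : ℝ :=
  ∑ n ∈ Finset.Icc 1 M, ∑ e : Fin n → Fin (M + 1) × Fin (M + 1),
    C ^ ∑ i, (((e i).1 : ℕ) + ((e i).2 : ℕ))

theorem dynkinBound_nonneg (M : ℕ) (hC : 0 ≤ C) : 0 ≤ dynkinBound M C :=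
  Finset.sum_nonneg fun _ _ => Finset.sum_nonneg fun _ _ => by positivity

theorem abs_dynkinCoefficient_le {n N : ℕ} (e : Fin n → Fin N × Fin N) :
    |(-1 : ℝ) ^ (n - 1) / (n : ℝ) /
      (((∑ i, (((e i).1 : ℕ) + ((e i).2 : ℕ)) : ℕ) : ℝ) * (factorialWeight e : ℝ))| ≤ 1 := by
  have key : ∀ k : ℕ, ((k : ℝ))⁻¹ ≤ 1 := fun k => Nat.cast_inv_le_one k
  rw [← Nat.cast_mul, div_eq_mul_inv, div_eq_mul_inv, abs_mul, abs_mul, abs_pow, abs_neg, abs_one,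
    one_pow, one_mul, abs_of_nonneg (by positivity), abs_of_nonneg (by positivity)]
  exact mul_le_one₀ (key _) (by positivity) (key _)

/-- Used with m = 1 for the first-order part and m = 2 for the remainder. With p(x) ≤ 1 only the
letters y contribute smallness, and b ≤ 1 lets any degree ≥ m be bounded by bᵐ. -/
theorem seminorm_dynkinPart_le (P : ℕ → Prop) [DecidablePred P] {m : ℕ} (hP : ∀ k, P k → m ≤ k)
    (hC : 1 ≤ C) (hp : ∀ x y, p ⁅x, y⁆ ≤ C * p x * p y) (M : ℕ) {x y : L} {b : ℝ}
    (hx : p x ≤ 1) (hy : p y ≤ b) (hb : b ≤ 1) :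
    p (dynkinPart P M x y) ≤ dynkinBound M C * b ^ m := by
  have hb0 : 0 ≤ b := (apply_nonneg p y).trans hy
  rw [dynkinPart, dynkinBound, Finset.sum_mul]
  refine (seminorm_sum_le p _ _).trans (Finset.sum_le_sum fun n hn => ?_)
  rw [Finset.sum_mul]
  refine (seminorm_sum_le p _ _).trans (Finset.sum_le_sum fun e _ => ?_)
  have hn1 := (Finset.mem_Icc.1 hn).1
  split_ifs with h h'
  · rw [map_smul_eq_mul, Real.norm_eq_abs]
    have hne : powerWord true false e ≠ [] := by
      intro h0
      rw [← List.length_eq_zero_iff, length_powerWord, Finset.sum_eq_zero_iff] at h0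
      have h1 := h' ⟨0, hn1⟩
      have h2 := h0 ⟨0, hn1⟩ (Finset.mem_univ _)
      omega
    have hw := seminorm_lieWord_le p hC hp hx hy hne
    rw [← powerWord_eq_map, count_powerWord, length_powerWord, one_pow, mul_one] at hw
    refine (mul_le_mul (abs_dynkinCoefficient_le e) hw (apply_nonneg _ _) zero_le_one).trans ?_
    rw [one_mul]
    exact mul_le_mul_of_nonneg_left (pow_le_pow_of_le_one hb0 hb (hP _ h)) (by positivity)
  · rw [map_zero]; positivity
  · rw [map_zero]; positivity

theorem seminorm_dynkinSeries_le (hC : 1 ≤ C) (hp : ∀ x y, p ⁅x, y⁆ ≤ C * p x * p y) (M : ℕ)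
    {x y : L} {b : ℝ} (hx : p x ≤ b) (hy : p y ≤ b) :
    p (dynkinSeries M x y) ≤ dynkinBound M (C * b) := by
  have hb0 : 0 ≤ b := (apply_nonneg p y).trans hy
  rw [dynkinSeries, dynkinBound]
  refine (seminorm_sum_le p _ _).trans (Finset.sum_le_sum fun n hn => ?_)
  refine (seminorm_sum_le p _ _).trans (Finset.sum_le_sum fun e _ => ?_)
  have hn1 := (Finset.mem_Icc.1 hn).1
  split_ifs with h'
  · rw [map_smul_eq_mul, Real.norm_eq_abs]
    have hne : powerWord true false e ≠ [] := by
      intro h0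
      rw [← List.length_eq_zero_iff, length_powerWord, Finset.sum_eq_zero_iff] at h0
      have h1 := h' ⟨0, hn1⟩
      have h2 := h0 ⟨0, hn1⟩ (Finset.mem_univ _)
      omega
    have hw := seminorm_lieWord_le p hC hp hx hy hne
    rw [← powerWord_eq_map, count_powerWord, count_true_powerWord, length_powerWord, mul_assoc,
      ← pow_add, ← Finset.sum_add_distrib, ← mul_pow] at hw
    refine (mul_le_mul (abs_dynkinCoefficient_le e) hw (apply_nonneg _ _) zero_le_one).trans ?_
    rw [one_mul]
  · rw [map_zero]; positivity

theorem seminorm_truncExp_ad_le {x : L} {a : ℝ} (ha : 0 ≤ a) (hx : ∀ z, p ⁅x, z⁆ ≤ a * p z)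
    (M : ℕ) (y : L) :
    p (truncExp M (LieAlgebra.ad ℝ L x) y) ≤ (∑ k ∈ Finset.range (M + 1), a ^ k) * p y := by
  have hpow : ∀ k : ℕ, p ((LieAlgebra.ad ℝ L x ^ k) y) ≤ a ^ k * p y := by
    intro k
    induction k with
    | zero => simp
    | succ k ih =>
      rw [pow_succ', Module.End.mul_apply, LieAlgebra.ad_apply]
      refine (hx _).trans ?_
      rw [pow_succ', mul_assoc]
      exact mul_le_mul_of_nonneg_left ih ha
  rw [truncExp, LinearMap.sum_apply, Finset.sum_mul]
  refine (seminorm_sum_le p _ _).trans (Finset.sum_le_sum fun k _ => ?_)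
  rw [LinearMap.smul_apply, map_smul_eq_mul, Real.norm_eq_abs, abs_of_nonneg (by positivity)]
  refine (mul_le_of_le_one_left (apply_nonneg _ _) ?_).trans (hpow k)
  exact Nat.cast_inv_le_one _

end Estimates

end

noncomputable section

/-! ### The group law and its continuity -/

section LieProduct

variable {𝔫 : Type*} [NormedAddCommGroup 𝔫] [InnerProductSpace ℝ 𝔫] [EuclideanLieAlgebra 𝔫]

theorem nestedBracket_eq_lieWord (l : List 𝔫) : nestedBracket l = lieWord l := by
  induction l with
  | nil => rfl
  | cons a l ih =>
    cases l with
    | nil => rfl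
    | cons b l =>
      rw [lieWord_cons a (by simp), ← ih]
      rfl

theorem lowerCentralSeries_nilpotencyLength (L : Type*) [LieRing L] [LieAlgebra ℝ L]
    [LieRing.IsNilpotent L] :
    LieModule.lowerCentralSeries ℝ L L (LieModule.nilpotencyLength L L) = ⊥ := by
  cases h : LieModule.nilpotencyLength L L with
  | zero =>
    have := (LieModule.nilpotencyLength_eq_zero_iff L L).1 h
    exact Subsingleton.elim _ _
  | succ k => exact ((LieModule.nilpotencyLength_eq_succ_iff ℝ L L k).1 h).1

theorem lieProduct_eq_dynkinSeries_nilpotencyLength (x y : 𝔫) :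
    lieProduct x y = dynkinSeries (LieModule.nilpotencyLength 𝔫 𝔫) x y := by
  simp only [lieProduct, dynkinSeries, nestedBracket_eq_lieWord]
  rfl

/-- The truncation order used for the exponential of `ad x` and for Dynkin's series. -/
def truncOrder (s : ℕ) : ℕ := 2 * s + 1

variable [LieRing.IsNilpotent 𝔫]

theorem lieProduct_eq_dynkinSeries {s : ℕ} (hs : LieModule.nilpotencyLength 𝔫 𝔫 = s) (x y : 𝔫) :
    lieProduct x y = dynkinSeries (truncOrder s) x y := by
  rw [lieProduct_eq_dynkinSeries_nilpotencyLength]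
  exact dynkinSeries_eq_of_le (lowerCentralSeries_nilpotencyLength 𝔫)
    (by rw [hs, truncOrder]; omega) x y

theorem lieProduct_assoc (x y z : 𝔫) :
    lieProduct (lieProduct x y) z = lieProduct x (lieProduct y z) := by
  simp only [lieProduct_eq_dynkinSeries rfl]
  exact dynkinSeries_assoc (lowerCentralSeries_nilpotencyLength 𝔫) le_rfl x y z

theorem lieProduct_of_lie_eq_zero {x y : 𝔫} (h : ⁅x, y⁆ = 0) : lieProduct x y = x + y := by
  rw [lieProduct_eq_dynkinSeries rfl]
  exact dynkinSeries_eq_add (lowerCentralSeries_nilpotencyLength 𝔫) le_rfl h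

theorem lieProduct_zero (x : 𝔫) : lieProduct x 0 = x := by
  rw [lieProduct_of_lie_eq_zero (lie_zero x), add_zero]

theorem zero_lieProduct (x : 𝔫) : lieProduct 0 x = x := by
  rw [lieProduct_of_lie_eq_zero (zero_lie x), zero_add]

theorem lieProduct_neg (x : 𝔫) : lieProduct x (-x) = 0 := by
  rw [lieProduct_of_lie_eq_zero (by simp), add_neg_cancel]

theorem neg_lieProduct (x : 𝔫) : lieProduct (-x) x = 0 := by
  rw [lieProduct_of_lie_eq_zero (by simp), neg_add_cancel]

/-- The automorphism `exp (ad x)`. -/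
def expAd (s : ℕ) (x : 𝔫) : 𝔫 →ₗ[ℝ] 𝔫 := truncExp (truncOrder s) (LieAlgebra.ad ℝ 𝔫 x)

theorem lieProduct_conj {s : ℕ} (hs : LieModule.nilpotencyLength 𝔫 𝔫 = s) (x y : 𝔫) :
    lieProduct (lieProduct x y) (-x) = expAd s x y := by
  subst hs
  simp only [lieProduct_eq_dynkinSeries rfl]
  exact dynkinSeries_conj (lowerCentralSeries_nilpotencyLength 𝔫) le_rfl x y

theorem map_lieProduct (f : 𝔫 →ₗ⁅ℝ⁆ 𝔫) (x y : 𝔫) :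
    f (lieProduct x y) = lieProduct (f x) (f y) := by
  simp only [lieProduct_eq_dynkinSeries rfl]
  exact map_dynkinSeries f _ x y

end LieProduct

section Continuity

variable {𝔫 : Type*} [NormedAddCommGroup 𝔫] [InnerProductSpace ℝ 𝔫] [EuclideanLieAlgebra 𝔫]
  [FiniteDimensional ℝ 𝔫]

theorem continuous_lie : Continuous fun q : 𝔫 × 𝔫 => ⁅q.1, q.2⁆ := by
  let f : 𝔫 →ₗ[ℝ] 𝔫 →L[ℝ] 𝔫 :=
    LinearMap.toContinuousLinearMap.toLinearMap ∘ₗ (LieAlgebra.ad ℝ 𝔫 : 𝔫 →ₗ[ℝ] Module.End ℝ 𝔫)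
  exact (f.continuous_of_finiteDimensional.comp continuous_fst).clm_apply continuous_snd

theorem continuous_lieWord (l : List Bool) :
    Continuous fun q : 𝔫 × 𝔫 => lieWord (l.map fun b => cond b q.1 q.2) := by
  induction l with
  | nil => exact continuous_const
  | cons a l ih =>
    have ha : Continuous fun q : 𝔫 × 𝔫 => cond a q.1 q.2 := by
      cases a
      · exact continuous_snd
      · exact continuous_fst
    cases l with
    | nil => exact ha
    | cons b l => exact continuous_lie.comp (ha.prodMk ih)

theorem continuous_dynkinPart (P : ℕ → Prop) [DecidablePred P] (M : ℕ) :
    Continuous fun q : 𝔫 × 𝔫 => dynkinPart P M q.1 q.2 := by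
  refine continuous_finsetSum _ fun n _ => continuous_finsetSum _ fun e _ => ?_
  split_ifs
  · have h := continuous_lieWord (𝔫 := 𝔫) (powerWord true false e)
    simp only [← powerWord_eq_map] at h
    exact h.const_smul _
  · exact continuous_const
  · exact continuous_const

theorem continuous_lieProduct [LieRing.IsNilpotent 𝔫] :
    Continuous fun q : 𝔫 × 𝔫 => lieProduct q.1 q.2 := by
  simp only [lieProduct_eq_dynkinSeries rfl, dynkinSeries_eq_sum_dynkinPart]
  exact ((continuous_dynkinPart _ _).add (continuous_dynkinPart _ _)).add (continuous_dynkinPart _ _)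

end Continuity

/-! ### The weight filtration and its orthogonal components -/

section Filtration

variable {𝔫 : Type*} [NormedAddCommGroup 𝔫] [InnerProductSpace ℝ 𝔫] [EuclideanLieAlgebra 𝔫]
  (v : 𝔫)

theorem lie_mem_weightFiltration_add_two {i : ℕ} (x : 𝔫) {y : 𝔫}
    (hy : y ∈ weightFiltration v (i + 1)) : ⁅x, y⁆ ∈ weightFiltration v (i + 2) :=
  Submodule.mem_sup_left (Submodule.subset_span ⟨x, y, hy, rfl⟩)

theorem base_lie_mem_weightFiltration {i : ℕ} {y : 𝔫} (hy : y ∈ weightFiltration v i) :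
    ⁅v, y⁆ ∈ weightFiltration v (i + 2) :=
  Submodule.mem_sup_right (Submodule.subset_span ⟨y, hy, rfl⟩)

theorem weightFiltration_add_two_le {i : ℕ} {S : Submodule ℝ 𝔫}
    (h1 : ∀ x y : 𝔫, y ∈ weightFiltration v (i + 1) → ⁅x, y⁆ ∈ S)
    (h2 : ∀ y : 𝔫, y ∈ weightFiltration v i → ⁅v, y⁆ ∈ S) : weightFiltration v (i + 2) ≤ S := by
  refine sup_le (Submodule.span_le.2 ?_) (Submodule.span_le.2 ?_)
  · rintro _ ⟨x, y, hy, rfl⟩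
    exact h1 x y hy
  · rintro _ ⟨y, hy, rfl⟩
    exact h2 y hy

theorem weightFiltration_succ_le (i : ℕ) : weightFiltration v (i + 1) ≤ weightFiltration v i := by
  induction i using Nat.strong_induction_on with
  | _ i ih =>
    match i with
    | 0 => exact le_top
    | 1 => exact le_top
    | i + 2 =>
      exact weightFiltration_add_two_le v
        (fun x y hy => lie_mem_weightFiltration_add_two v x (ih (i + 1) (by omega) hy))
        (fun y hy => base_lie_mem_weightFiltration v (ih i (by omega) hy))

theorem weightFiltration_antitone : Antitone (weightFiltration v) :=
  antitone_nat_of_succ_le (weightFiltration_succ_le v)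

/-- Induction on i: a generator of 𝔫⁽ⁱ⁺²⁾ is itself a bracket, and the Jacobi identity moves its
factors onto y one at a time. -/
theorem lie_mem_weightFiltration {i j : ℕ} {x y : 𝔫} (hx : x ∈ weightFiltration v i)
    (hy : y ∈ weightFiltration v j) : ⁅x, y⁆ ∈ weightFiltration v (i + j) := by
  induction i using Nat.strong_induction_on generalizing x y j with
  | _ i ih =>
    have hone : ∀ (j : ℕ) (a b : 𝔫), b ∈ weightFiltration v j →
        ⁅a, b⁆ ∈ weightFiltration v (j + 1) := by
      intro j a b hb
      cases j with
      | zero => exact Submodule.mem_top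
      | succ j => exact lie_mem_weightFiltration_add_two v a hb
    match i with
    | 0 =>
      rw [zero_add]
      exact weightFiltration_succ_le v j (hone j x y hy)
    | 1 =>
      rw [add_comm]
      exact hone j x y hy
    | i + 2 =>
      let S : Submodule ℝ 𝔫 := (weightFiltration v (i + 2 + j)).comap
        (-(LieAlgebra.ad ℝ 𝔫 y : 𝔫 →ₗ[ℝ] 𝔫))
      have hS : ∀ z, z ∈ S ↔ ⁅z, y⁆ ∈ weightFiltration v (i + 2 + j) := by
        intro z
        simp only [S, Submodule.mem_comap, LinearMap.neg_apply]
        rw [← lie_skew z y]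
        rfl
      refine (hS x).1 (weightFiltration_add_two_le v (S := S) ?_ ?_ hx)
      · intro a b hb
        rw [hS, lie_lie]
        refine sub_mem ?_ ?_
        · have := hone _ a _ (ih (i + 1) (by omega) hb hy)
          rwa [show i + 1 + j + 1 = i + 2 + j by omega] at this
        · have := ih (i + 1) (by omega) hb (hone j a y hy)
          rwa [show i + 1 + (j + 1) = i + 2 + j by omega] at this
      · intro b hb
        rw [hS, lie_lie]
        refine sub_mem ?_ ?_
        · have := base_lie_mem_weightFiltration v (ih i (by omega) hb hy)
          rwa [show i + j + 2 = i + 2 + j by omega] at this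
        · have := ih i (by omega) hb (base_lie_mem_weightFiltration v hy)
          rwa [show i + (j + 2) = i + 2 + j by omega] at this

/-- A bracket raises the weight by at most two. The lower central series is indexed from 0 here, so
𝔫⁽²ˢ⁾ = 0 follows. -/
theorem weightFiltration_le_lowerCentralSeries (i : ℕ) {x : 𝔫} (hx : x ∈ weightFiltration v i) :
    x ∈ LieModule.lowerCentralSeries ℝ 𝔫 𝔫 (i / 2) := by
  induction i using Nat.strong_induction_on generalizing x with
  | _ i ih =>
    match i with
    | 0 => simp
    | 1 => simp
    | i + 2 =>
      let S : Submodule ℝ 𝔫 := (LieModule.lowerCentralSeries ℝ 𝔫 𝔫 ((i + 2) / 2)).toSubmodule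
      refine weightFiltration_add_two_le v (S := S) ?_ ?_ hx
      · intro a b hb
        exact LieModule.antitone_lowerCentralSeries ℝ 𝔫 𝔫 (by omega)
          (lie_mem_lowerCentralSeries_succ a (ih (i + 1) (by omega) hb))
      · intro b hb
        exact LieModule.antitone_lowerCentralSeries ℝ 𝔫 𝔫 (by omega)
          (lie_mem_lowerCentralSeries_succ v (ih i (by omega) hb))

theorem weightFiltration_eq_bot [LieRing.IsNilpotent 𝔫] {s i : ℕ}
    (hs : LieModule.nilpotencyLength 𝔫 𝔫 = s) (hi : 2 * s ≤ i) : weightFiltration v i = ⊥ := by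
  refine (Submodule.eq_bot_iff _).2 fun x hx => ?_
  have h := weightFiltration_le_lowerCentralSeries v i hx
  have hbot : LieModule.lowerCentralSeries ℝ 𝔫 𝔫 (i / 2) = ⊥ :=
    le_bot_iff.1 (lowerCentralSeries_nilpotencyLength 𝔫 ▸
      LieModule.antitone_lowerCentralSeries ℝ 𝔫 𝔫 (by omega))
  rwa [hbot, LieSubmodule.mem_bot] at h

theorem weightFiltration_two :
    weightFiltration v 2 = Submodule.span ℝ {z : 𝔫 | ∃ x y : 𝔫, ⁅x, y⁆ = z} := by
  refine le_antisymm (weightFiltration_add_two_le v ?_ ?_) (Submodule.span_le.2 ?_)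
  · exact fun x y _ => Submodule.subset_span ⟨x, y, rfl⟩
  · exact fun y _ => Submodule.subset_span ⟨v, y, rfl⟩
  · rintro _ ⟨x, y, rfl⟩
    exact lie_mem_weightFiltration_add_two v x Submodule.mem_top

variable [FiniteDimensional ℝ 𝔫]

/-- As a difference of projections onto nested subspaces, the components telescope to u in
`sum_weightComponent`. -/
theorem weightComponent_eq_sub (i : ℕ) (u : 𝔫) : weightComponent v i u =
    (weightFiltration v i).starProjection u - (weightFiltration v (i + 1)).starProjection u := by
  have hle := weightFiltration_succ_le v i
  refine Submodule.eq_starProjection_of_mem_orthogonal ⟨?_, ?_⟩ ?_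
  · exact sub_mem (Submodule.starProjection_apply_mem _ _)
      (hle (Submodule.starProjection_apply_mem _ _))
  · have h1 := Submodule.orthogonal_le hle
      (Submodule.sub_starProjection_mem_orthogonal (K := weightFiltration v i) u)
    have h2 := Submodule.sub_starProjection_mem_orthogonal (K := weightFiltration v (i + 1)) u
    have := sub_mem h2 h1
    rwa [sub_sub_sub_cancel_left] at this
  · have h1 := Submodule.orthogonal_le (inf_le_left : weightLayer v i ≤ weightFiltration v i)
      (Submodule.sub_starProjection_mem_orthogonal (K := weightFiltration v i) u)
    have h2 : (weightFiltration v (i + 1)).starProjection u ∈ (weightLayer v i)ᗮ :=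
      Submodule.orthogonal_le (inf_le_right : weightLayer v i ≤ (weightFiltration v (i + 1))ᗮ)
        (Submodule.le_orthogonal_orthogonal _ (Submodule.starProjection_apply_mem _ _))
    have := add_mem h1 h2
    rwa [sub_add] at this

theorem weightComponent_mem (i : ℕ) (u : 𝔫) : weightComponent v i u ∈ weightFiltration v i :=
  (Submodule.starProjection_apply_mem (weightLayer v i) u).1

theorem weightComponent_eq_zero {i k : ℕ} (hik : i < k) {u : 𝔫} (hu : u ∈ weightFiltration v k) :
    weightComponent v i u = 0 := by
  rw [weightComponent_eq_sub, Submodule.starProjection_eq_self_iff.2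
    (weightFiltration_antitone v (show i ≤ k by omega) hu), Submodule.starProjection_eq_self_iff.2
    (weightFiltration_antitone v (show i + 1 ≤ k by omega) hu), sub_self]

theorem sum_weightComponent [LieRing.IsNilpotent 𝔫] {s : ℕ}
    (hs : LieModule.nilpotencyLength 𝔫 𝔫 = s) (u : 𝔫) :
    ∑ i ∈ Finset.range (2 * s), weightComponent v (i + 1) u = u := by
  simp only [weightComponent_eq_sub]
  rw [Finset.sum_range_sub' fun i => (weightFiltration v (i + 1)).starProjection u]
  rw [weightFiltration_eq_bot v hs (i := 2 * s + 1) (by omega), Submodule.starProjection_bot]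
  change (⊤ : Submodule ℝ 𝔫).starProjection u - 0 = u
  rw [Submodule.starProjection_top', sub_zero]
  rfl

theorem weightComponent_one (u : 𝔫) :
    weightComponent v 1 u = (abelianPart 𝔫).starProjection u := by
  have : weightLayer v 1 = abelianPart 𝔫 := by
    rw [weightLayer, weightFiltration_two]
    exact top_inf_eq _
  simp only [weightComponent, this]

theorem mem_weightFiltration_two {u : 𝔫} (hu : (abelianPart 𝔫).starProjection u = 0) :
    u ∈ weightFiltration v 2 := by
  rw [← weightComponent_one v, weightComponent_eq_sub] at hu
  change (⊤ : Submodule ℝ 𝔫).starProjection u - _ = 0 at hu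
  rw [Submodule.starProjection_eq_self_iff.2 Submodule.mem_top, sub_eq_zero] at hu
  rw [hu]
  exact Submodule.starProjection_apply_mem _ _

end Filtration

end

noncomputable section

/-! ### Equivalence of norms; existence of admissible norms -/

section SeminormComparison

variable {E : Type*} [NormedAddCommGroup E] [InnerProductSpace ℝ E] [FiniteDimensional ℝ E]

theorem exists_seminorm_le_norm (p : Seminorm ℝ E) : ∃ b : ℝ, 0 < b ∧ ∀ u, p u ≤ b * ‖u‖ := by
  let e := stdOrthonormalBasis ℝ E
  refine ⟨∑ i, p (e i) + 1, by positivity, fun u => ?_⟩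
  have h : p u ≤ ∑ i, p (e i) * ‖u‖ := by
    conv_lhs => rw [← e.sum_repr u]
    refine (seminorm_sum_le p _ _).trans (Finset.sum_le_sum fun i _ => ?_)
    rw [map_smul_eq_mul, mul_comm]
    refine mul_le_mul_of_nonneg_left ?_ (apply_nonneg p _)
    exact (PiLp.norm_apply_le (e.repr u) i).trans_eq (e.repr.norm_map u)
  rw [← Finset.sum_mul] at h
  nlinarith [norm_nonneg u]

theorem continuous_seminorm (p : Seminorm ℝ E) : Continuous p := by
  obtain ⟨b, hb, h⟩ := exists_seminorm_le_norm p
  have : Continuous (b.toNNReal • normSeminorm ℝ E : Seminorm ℝ E) := by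
    have : ((b.toNNReal • normSeminorm ℝ E : Seminorm ℝ E) : E → ℝ) =
      fun u => b.toNNReal * ‖u‖ := rfl
    rw [this]
    fun_prop
  refine Seminorm.continuous_of_le this fun u => ?_
  change p u ≤ b.toNNReal * ‖u‖
  rw [Real.coe_toNNReal _ hb.le]
  exact h u

theorem exists_norm_le_seminorm (p : Seminorm ℝ E) (hp : ∀ u, p u = 0 → u = 0) :
    ∃ a : ℝ, 0 < a ∧ ∀ u, a * ‖u‖ ≤ p u := by
  rcases (Metric.sphere (0 : E) 1).eq_empty_or_nonempty with h | h
  · refine ⟨1, one_pos, fun u => ?_⟩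
    by_cases hu : u = 0
    · simp [hu]
    · have : ‖u‖⁻¹ • u ∈ Metric.sphere (0 : E) 1 := by
        simp [norm_smul, inv_mul_cancel₀ (norm_ne_zero_iff.2 hu)]
      rw [h] at this
      exact this.elim
  · obtain ⟨x, hx, hmin⟩ := (isCompact_sphere (0 : E) 1).exists_isMinOn h
      (continuous_seminorm p).continuousOn
    have hx1 : ‖x‖ = 1 := by simpa using hx
    refine ⟨p x, lt_of_le_of_ne (apply_nonneg p x) fun h0 => ?_, fun u => ?_⟩
    · rw [hp x h0.symm] at hx1
      simp at hx1
    · by_cases hu : u = 0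
      · simp [hu]
      · have hu' : 0 < ‖u‖ := norm_pos_iff.2 hu
        have h1 : p x ≤ p (‖u‖⁻¹ • u) := hmin (by
          simp [norm_smul, inv_mul_cancel₀ hu'.ne'])
        rw [map_smul_eq_mul, norm_inv, norm_norm, inv_mul_eq_div, le_div_iff₀ hu'] at h1
        exact h1

end SeminormComparison

section Bilinearity

variable {𝔫 : Type*} [NormedAddCommGroup 𝔫] [InnerProductSpace ℝ 𝔫] [EuclideanLieAlgebra 𝔫]
  [FiniteDimensional ℝ 𝔫]

theorem exists_norm_lie_le (𝔫 : Type*) [NormedAddCommGroup 𝔫] [InnerProductSpace ℝ 𝔫]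
    [EuclideanLieAlgebra 𝔫] [FiniteDimensional ℝ 𝔫] :
    ∃ c : ℝ, 0 ≤ c ∧ ∀ x y : 𝔫, ‖⁅x, y⁆‖ ≤ c * ‖x‖ * ‖y‖ := by
  let f : 𝔫 →ₗ[ℝ] 𝔫 →L[ℝ] 𝔫 :=
    LinearMap.toContinuousLinearMap.toLinearMap ∘ₗ (LieAlgebra.ad ℝ 𝔫 : 𝔫 →ₗ[ℝ] Module.End ℝ 𝔫)
  exact ⟨‖LinearMap.toContinuousLinearMap f‖, ContinuousLinearMap.opNorm_nonneg _, fun x y =>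
    ContinuousLinearMap.le_opNorm₂ (LinearMap.toContinuousLinearMap f) x y⟩

/-- Scaling, once the set defining C_φ is known to be bounded; an unbounded set would have the
default supremum 0. -/
theorem seminorm_lie_le {φ : Seminorm ℝ 𝔫} (hφ : ∀ u, φ u = 0 → u = 0) (x y : 𝔫) :
    φ ⁅x, y⁆ ≤ bilinearityConstant φ * φ x * φ y := by
  obtain ⟨a, ha, hle⟩ := exists_norm_le_seminorm φ hφ
  obtain ⟨b, hb, hge⟩ := exists_seminorm_le_norm φ
  obtain ⟨c, hc, hlie⟩ := exists_norm_lie_le 𝔫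
  have hbdd : BddAbove {r | ∃ u v : 𝔫, φ u ≤ 1 ∧ φ v ≤ 1 ∧ φ ⁅u, v⁆ = r} := by
    refine ⟨b * (c * a⁻¹ * a⁻¹), ?_⟩
    rintro _ ⟨u, v, hu, hv, rfl⟩
    refine (hge _).trans (mul_le_mul_of_nonneg_left ((hlie u v).trans ?_) hb.le)
    have hn : ∀ u, φ u ≤ 1 → ‖u‖ ≤ a⁻¹ := fun u hu => by
      rw [← one_div, le_div_iff₀ ha, mul_comm]
      exact (hle u).trans hu
    have := hn u hu
    have := hn v hv
    gcongr
  by_cases hx : φ x = 0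
  · rw [hφ x hx]
    simp
  by_cases hy : φ y = 0
  · rw [hφ y hy]
    simp
  have hx' : 0 < φ x := lt_of_le_of_ne (apply_nonneg φ x) (Ne.symm hx)
  have hy' : 0 < φ y := lt_of_le_of_ne (apply_nonneg φ y) (Ne.symm hy)
  have h := le_csSup hbdd (a := φ ⁅(φ x)⁻¹ • x, (φ y)⁻¹ • y⁆)
    ⟨(φ x)⁻¹ • x, (φ y)⁻¹ • y, ?_, ?_, rfl⟩
  · change _ ≤ bilinearityConstant φ at h
    rw [smul_lie, lie_smul, map_smul_eq_mul, map_smul_eq_mul, norm_inv, norm_inv,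
      Real.norm_of_nonneg hx'.le, Real.norm_of_nonneg hy'.le, ← mul_assoc, ← mul_inv,
      inv_mul_eq_div, div_le_iff₀ (mul_pos hx' hy'), ← mul_assoc] at h
    exact h
  · rw [map_smul_eq_mul, norm_inv, Real.norm_of_nonneg hx'.le, inv_mul_cancel₀ hx]
  · rw [map_smul_eq_mul, norm_inv, Real.norm_of_nonneg hy'.le, inv_mul_cancel₀ hy]

theorem norm_weightComponent_le (v : 𝔫) (i : ℕ) (u : 𝔫) : ‖weightComponent v i u‖ ≤ ‖u‖ :=
  Submodule.norm_starProjection_apply_le _ _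

/-- Orthogonal projections contract the Euclidean norm for every v, so the ratio of the comparison
constants serves all v at once. -/
theorem exists_projectionsBoundedBy {φ : Seminorm ℝ 𝔫} (hφ : ∀ u, φ u = 0 → u = 0) :
    ∃ K : ℝ, ∀ v : 𝔫, ProjectionsBoundedBy φ v K := by
  obtain ⟨a, ha, hle⟩ := exists_norm_le_seminorm φ hφ
  obtain ⟨b, hb, hge⟩ := exists_seminorm_le_norm φ
  refine ⟨b / a, fun v i u => (hge _).trans ?_⟩
  rw [div_mul_eq_mul_div, le_div_iff₀ ha]
  calc b * ‖weightComponent v i u‖ * a ≤ b * ‖u‖ * a := by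
        gcongr
        exact norm_weightComponent_le v i u
    _ = b * (a * ‖u‖) := by ring
    _ ≤ b * φ u := by gcongr; exact hle u

variable {Q : Type*} [Group Q] [DistribMulAction Q 𝔫]

theorem IsAdmissibleNorm.lie_le {φ : Seminorm ℝ 𝔫} (hφ : IsAdmissibleNorm Q φ) (x y : 𝔫) :
    φ ⁅x, y⁆ ≤ φ x * φ y := by
  refine (seminorm_lie_le hφ.eq_zero x y).trans ?_
  rw [mul_assoc]
  exact mul_le_of_le_one_left (mul_nonneg (apply_nonneg _ _) (apply_nonneg _ _)) hφ.bilinearity_le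

/-- Multiplying a norm by r divides its bilinearity constant by r, so r = max(1, C) applied to the
Euclidean norm itself is enough. -/
theorem exists_admissibleNorm_of_isEuclideanLieAction (hQ : IsEuclideanLieAction Q 𝔫) :
    ∃ φ : Seminorm ℝ 𝔫, IsAdmissibleNorm Q φ ∧ (∀ u, ‖u‖ ≤ φ u) ∧
      (∃ r : ℝ, 1 ≤ r ∧ r ≤ max 1 (bilinearityConstant (normSeminorm ℝ 𝔫)) ∧
        ∀ u ∈ abelianPart 𝔫, φ u = r * ‖u‖) ∧
      ∀ v : 𝔫, ProjectionsBoundedBy φ v 1 := by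
  set C := bilinearityConstant (normSeminorm ℝ 𝔫) with hC
  have hr : 1 ≤ max 1 C := le_max_left _ _
  have hr0 : 0 < max 1 C := one_pos.trans_le hr
  let φ : Seminorm ℝ 𝔫 := (max 1 C).toNNReal • normSeminorm ℝ 𝔫
  have hφ : ∀ u, φ u = max 1 C * ‖u‖ := fun u => by
    change ((max 1 C).toNNReal : ℝ) * ‖u‖ = _
    rw [Real.coe_toNNReal _ hr0.le]
  have hlie : ∀ x y : 𝔫, ‖⁅x, y⁆‖ ≤ C * ‖x‖ * ‖y‖ :=
    seminorm_lie_le (φ := normSeminorm ℝ 𝔫) fun u hu => norm_eq_zero.1 hu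
  refine ⟨φ, ⟨fun u hu => ?_, fun q u => ?_, ?_⟩, fun u => ?_, ⟨max 1 C, hr, le_rfl, fun u _ => hφ u⟩,
    fun v i u => ?_⟩
  · rw [hφ] at hu
    exact norm_eq_zero.1 ((mul_eq_zero.1 hu).resolve_left hr0.ne')
  · rw [hφ, hφ, hQ.norm_smul]
  · refine csSup_le ⟨_, 0, 0, by simp, by simp, rfl⟩ ?_
    rintro _ ⟨x, y, hx, hy, rfl⟩
    rw [hφ] at hx hy ⊢
    calc max 1 C * ‖⁅x, y⁆‖ ≤ max 1 C * (max 1 C * ‖x‖ * ‖y‖) := by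
          refine mul_le_mul_of_nonneg_left ((hlie x y).trans ?_) hr0.le
          gcongr
          exact le_max_right _ _
      _ = (max 1 C * ‖x‖) * (max 1 C * ‖y‖) := by ring
      _ ≤ 1 * 1 := by gcongr
      _ = 1 := one_mul 1
  · rw [hφ]
    exact le_mul_of_one_le_left (norm_nonneg u) hr
  · rw [hφ, hφ, one_mul]
    exact mul_le_mul_of_nonneg_left (norm_weightComponent_le v i u) hr0.le

end Bilinearity

end

noncomputable section

/-! ### The averaged action on the abelian part and its spectral constant -/

section EuclideanAction

variable {𝔫 : Type*} [NormedAddCommGroup 𝔫] [InnerProductSpace ℝ 𝔫] [EuclideanLieAlgebra 𝔫]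
  {Q : Type*} [Group Q] [DistribMulAction Q 𝔫] (hQ : IsEuclideanLieAction Q 𝔫)

namespace IsEuclideanLieAction

/-- The automorphism by which an element of `Q` acts. -/
def toLieHom (q : Q) : 𝔫 →ₗ⁅ℝ⁆ 𝔫 where
  toFun x := q • x
  map_add' := smul_add q
  map_smul' := hQ.smul_smul_comm q
  map_lie' := hQ.smul_lie q _ _

/-- The isometry by which an element of `Q` acts. -/
def toLinearIsometry (q : Q) : 𝔫 →ₗᵢ[ℝ] 𝔫 where
  toLinearMap := (hQ.toLieHom q : 𝔫 →ₗ[ℝ] 𝔫)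
  norm_map' := hQ.norm_smul q

include hQ

theorem inner_smul_smul (q : Q) (x y : 𝔫) : inner ℝ (q • x) (q • y) = inner ℝ x y :=
  (hQ.toLinearIsometry q).inner_map_map x y

theorem smul_lieProduct [LieRing.IsNilpotent 𝔫] (q : Q) (x y : 𝔫) :
    q • lieProduct x y = lieProduct (q • x) (q • y) :=
  map_lieProduct (hQ.toLieHom q) x y

theorem smul_mem_span_lie (q : Q) {x : 𝔫}
    (hx : x ∈ Submodule.span ℝ {z : 𝔫 | ∃ x y : 𝔫, ⁅x, y⁆ = z}) :
    q • x ∈ Submodule.span ℝ {z : 𝔫 | ∃ x y : 𝔫, ⁅x, y⁆ = z} := by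
  have : Submodule.span ℝ {z : 𝔫 | ∃ x y : 𝔫, ⁅x, y⁆ = z} ≤
      (Submodule.span ℝ {z : 𝔫 | ∃ x y : 𝔫, ⁅x, y⁆ = z}).comap (hQ.toLieHom q : 𝔫 →ₗ[ℝ] 𝔫) := by
    refine Submodule.span_le.2 ?_
    rintro _ ⟨x, y, rfl⟩
    exact Submodule.subset_span ⟨q • x, q • y, (hQ.smul_lie q x y).symm⟩
  exact this hx

theorem smul_mem_abelianPart (q : Q) {x : 𝔫} (hx : x ∈ abelianPart 𝔫) : q • x ∈ abelianPart 𝔫 := by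
  refine (Submodule.mem_orthogonal' _ _).2 fun y hy => ?_
  have := (Submodule.mem_orthogonal' _ _).1 hx _ (hQ.smul_mem_span_lie q⁻¹ hy)
  rwa [← hQ.inner_smul_smul q, smul_inv_smul] at this

theorem abelianPart_starProjection_smul [FiniteDimensional ℝ 𝔫] (q : Q) (x : 𝔫) :
    (abelianPart 𝔫).starProjection (q • x) = q • (abelianPart 𝔫).starProjection x := by
  refine Submodule.eq_starProjection_of_mem_orthogonal
    (hQ.smul_mem_abelianPart q (Submodule.starProjection_apply_mem _ _)) ?_
  rw [← smul_sub]
  refine (Submodule.mem_orthogonal' _ _).2 fun y hy => ?_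
  have := (Submodule.mem_orthogonal' _ _).1
    (Submodule.sub_starProjection_mem_orthogonal (K := abelianPart 𝔫) x) _
    (hQ.smul_mem_abelianPart q⁻¹ hy)
  rwa [← hQ.inner_smul_smul q, smul_inv_smul] at this

end IsEuclideanLieAction

end EuclideanAction

section AveragedAction

variable {𝔫 : Type*} [NormedAddCommGroup 𝔫] [InnerProductSpace ℝ 𝔫] [EuclideanLieAlgebra 𝔫]
  [FiniteDimensional ℝ 𝔫] [MeasurableSpace 𝔫] [BorelSpace 𝔫]
  {Q : Type*} [Group Q] [TopologicalSpace Q] [MeasurableSpace Q] [BorelSpace Q]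
  [DistribMulAction Q 𝔫] [ContinuousSMul Q 𝔫] (hQ : IsEuclideanLieAction Q 𝔫)
  (μ : Measure (𝔫 × Q)) [IsProbabilityMeasure μ]

omit [FiniteDimensional ℝ 𝔫] in
theorem measurable_snd_smul (u : 𝔫) : Measurable fun g : 𝔫 × Q => g.2 • u :=
  (show Continuous fun q : Q => q • u by fun_prop).measurable.comp measurable_snd

include hQ

theorem integrable_snd_smul (u : 𝔫) : Integrable (fun g : 𝔫 × Q => g.2 • u) μ :=
  Integrable.of_bound (measurable_snd_smul u).aestronglyMeasurable ‖u‖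
    (Filter.Eventually.of_forall fun g => (hQ.norm_smul g.2 u).le)

omit hQ in
/-- `Ad(μ_Q)` as a linear map. -/
def averagedMap (hQ : IsEuclideanLieAction Q 𝔫) (μ : Measure (𝔫 × Q)) [IsProbabilityMeasure μ] :
    𝔫 →ₗ[ℝ] 𝔫 where
  toFun := averagedAction μ
  map_add' x y := by
    simp only [averagedAction, smul_add]
    exact integral_add (integrable_snd_smul hQ μ x) (integrable_snd_smul hQ μ y)
  map_smul' r x := by
    simp only [averagedAction, hQ.smul_smul_comm]
    exact integral_smul r _

theorem inner_averagedAction (x y : 𝔫) :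
    inner ℝ x (averagedAction μ y) = ∫ g, inner ℝ x (g.2 • y) ∂μ :=
  (integral_inner (𝕜 := ℝ) (integrable_snd_smul hQ μ y) x).symm

/-- Almost every κ is an isometry which preserves 𝔪₁ and fixes V pointwise, so it preserves
orthogonality to V. -/
theorem averagedAction_mem_movedPart {w : 𝔫} (hw : w ∈ movedPart hQ μ) :
    averagedAction μ w ∈ movedPart hQ μ := by
  refine ⟨?_, (Submodule.mem_orthogonal _ _).2 fun u hu => ?_⟩
  · refine (Submodule.mem_orthogonal _ _).2 fun u hu => ?_
    rw [inner_averagedAction hQ]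
    refine integral_eq_zero_of_ae (Filter.Eventually.of_forall fun g => ?_)
    exact (Submodule.mem_orthogonal _ _).1 (hQ.smul_mem_abelianPart g.2 hw.1) u hu
  · rw [inner_averagedAction hQ]
    refine integral_eq_zero_of_ae ?_
    filter_upwards [hu.2] with g hg
    have := (Submodule.mem_orthogonal _ _).1 hw.2 u hu
    rw [← hQ.inner_smul_smul g.2, hg] at this
    exact this

/-- Equality case of convexity: ‖κw − w‖² = 2‖w‖² − 2⟨w, κw⟩ has integral zero. -/
theorem smul_ae_eq_of_averagedAction_eq {w : 𝔫} (hw : averagedAction μ w = w) :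
    ∀ᵐ g ∂μ, g.2 • w = w := by
  have hint : Integrable (fun g : 𝔫 × Q => inner ℝ w (g.2 • w)) μ :=
    (integrable_snd_smul hQ μ w).const_inner w
  have hsq : ∀ g : 𝔫 × Q, ‖g.2 • w - w‖ ^ 2 = 2 * ‖w‖ ^ 2 - 2 * inner ℝ w (g.2 • w) := fun g => by
    rw [norm_sub_sq_real, hQ.norm_smul, real_inner_comm]
    ring
  have h0 : ∫ g : 𝔫 × Q, ‖g.2 • w - w‖ ^ 2 ∂μ = 0 := by
    simp only [hsq]
    rw [integral_sub (integrable_const _) (hint.const_mul 2), integral_const, integral_const_mul,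
      ← inner_averagedAction hQ, hw, real_inner_self_eq_norm_sq]
    simp
  have hint2 : Integrable (fun g : 𝔫 × Q => ‖g.2 • w - w‖ ^ 2) μ := by
    simp only [hsq]
    exact (integrable_const _).sub (hint.const_mul 2)
  have := (integral_eq_zero_iff_of_nonneg (fun g => sq_nonneg _) hint2).1 h0
  filter_upwards [this] with g hg
  exact sub_eq_zero.1 (norm_eq_zero.1 (pow_eq_zero_iff two_ne_zero |>.1 hg))

theorem eq_zero_of_mem_movedPart {w : 𝔫} (hw : w ∈ movedPart hQ μ)
    (h : w - averagedAction μ w = 0) : w = 0 := by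
  have hfix : w ∈ fixedPart hQ μ :=
    ⟨hw.1, smul_ae_eq_of_averagedAction_eq hQ μ (sub_eq_zero.1 h).symm⟩
  exact inner_self_eq_zero.1 ((Submodule.mem_orthogonal _ _).1 hw.2 w hfix)

/-- By injectivity of id − Ad(μ_Q) on W, the pullback of φ is a norm on W; compare it with the
Euclidean one. -/
theorem exists_isSpectralConstant {φ : Seminorm ℝ 𝔫} (hφ : ∀ u, φ u = 0 → u = 0) :
    ∃ κ : ℝ, IsSpectralConstant hQ φ μ κ := by
  let f : movedPart hQ μ →ₗ[ℝ] 𝔫 :=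
    (LinearMap.id - averagedMap hQ μ) ∘ₗ (movedPart hQ μ).subtype
  have hf : ∀ w : movedPart hQ μ, f w = w - averagedAction μ (w : 𝔫) := fun w => rfl
  obtain ⟨a, ha, hle⟩ := exists_norm_le_seminorm (φ.comp f) fun w hw =>
    Subtype.ext (eq_zero_of_mem_movedPart hQ μ w.2 ((hf w) ▸ hφ _ hw))
  obtain ⟨b, hb, hge⟩ := exists_seminorm_le_norm φ
  refine ⟨a / b, div_pos ha hb, fun w hw => (hge w).trans ?_⟩
  have := hle ⟨w, hw⟩
  rw [Seminorm.comp_apply, hf] at this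
  rw [le_div_iff₀ (div_pos ha hb)]
  calc b * ‖w‖ * (a / b) = a * ‖w‖ := by field_simp
    _ ≤ _ := this

theorem exists_mem_movedPart_sub_averagedAction {b : 𝔫} (hb : b ∈ movedPart hQ μ) :
    ∃ h ∈ movedPart hQ μ, h - averagedAction μ h = b := by
  let f : movedPart hQ μ →ₗ[ℝ] movedPart hQ μ :=
    (LinearMap.id - averagedMap hQ μ).restrict fun w hw =>
      sub_mem hw (averagedAction_mem_movedPart hQ μ hw)
  have hf : ∀ w : movedPart hQ μ, ((f w : movedPart hQ μ) : 𝔫) = w - averagedAction μ (w : 𝔫) :=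
    fun w => rfl
  have hinj : Function.Injective f := by
    refine (injective_iff_map_eq_zero f).2 fun w hw => Subtype.ext ?_
    exact eq_zero_of_mem_movedPart hQ μ w.2 (by rw [← hf, hw]; rfl)
  obtain ⟨h, hh⟩ := (LinearMap.injective_iff_surjective.1 hinj) ⟨b, hb⟩
  exact ⟨h, h.2, by rw [← hf, hh]⟩

end AveragedAction

end

noncomputable section

/-! ### Support radius, essential average and corrector -/

section SupportRadius

variable {𝔫 : Type*} [NormedAddCommGroup 𝔫] [InnerProductSpace ℝ 𝔫] [EuclideanLieAlgebra 𝔫]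
  [FiniteDimensional ℝ 𝔫] [MeasurableSpace 𝔫] {Q : Type*} [Group Q] [TopologicalSpace Q]
  [T2Space Q] [MeasurableSpace Q] [DistribMulAction Q 𝔫] {μ : Measure (𝔫 × Q)}

theorem IsCompactlySupported.isCompact_support (hμ : IsCompactlySupported μ) :
    IsCompact μ.support := by
  obtain ⟨S, hS, hS0⟩ := hμ
  exact hS.of_isClosed_subset Measure.isClosed_support
    (Measure.support_subset_of_isClosed hS.isClosed (mem_ae_iff.2 hS0))

/-- Q need not be second countable, so full measure of the support is not used. Instead, the points
of the compact carrier where φ exceeds the radius form a countable union of compact sets disjoint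
from the support, each of which is null. -/
theorem ae_le_supportRadius (hμ : IsCompactlySupported μ) (φ : Seminorm ℝ 𝔫) :
    ∀ᵐ g ∂μ, φ g.1 ≤ supportRadius φ μ := by
  have hcont : Continuous fun g : 𝔫 × Q => φ g.1 := (continuous_seminorm φ).comp continuous_fst
  have hle : ∀ g ∈ μ.support, φ g.1 ≤ supportRadius φ μ := fun g hg =>
    le_csSup (hμ.isCompact_support.image hcont).bddAbove ⟨g, hg, rfl⟩
  obtain ⟨S, hS, hS0⟩ := hμ
  have hnull : ∀ k : ℕ, μ (S ∩ {g | supportRadius φ μ + 1 / ((k : ℝ) + 1) ≤ φ g.1}) = 0 := by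
    intro k
    refine Measure.measure_eq_zero_of_isCompact_subset_compl_support
      (hS.inter_right (isClosed_le continuous_const hcont)) ?_
    rintro g ⟨_, hg⟩ hg'
    have h1 := hle g hg'
    have h2 : (0 : ℝ) < 1 / ((k : ℝ) + 1) := Nat.one_div_pos_of_nat
    simp only [Set.mem_ofPred_eq] at hg
    linarith
  filter_upwards [mem_ae_iff.2 hS0, (ae_all_iff.2 fun k => measure_eq_zero_iff_ae_notMem.1 (hnull k))]
    with g hg hg'
  by_contra! hlt
  obtain ⟨k, hk⟩ := exists_nat_one_div_lt (sub_pos.2 hlt)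
  exact hg' k ⟨hg, by simp only [Set.mem_ofPred_eq]; linarith⟩

end SupportRadius

theorem Seminorm.integral_le {E α : Type*} [NormedAddCommGroup E] [InnerProductSpace ℝ E]
    [FiniteDimensional ℝ E] [MeasurableSpace α] {μ : Measure α} [IsProbabilityMeasure μ]
    (φ : Seminorm ℝ E) {f : α → E} (hf : Integrable f μ) {c : ℝ} (h : ∀ᵐ x ∂μ, φ (f x) ≤ c) :
    φ (∫ x, f x ∂μ) ≤ c := by
  have hconv : Convex ℝ {x : E | φ x ≤ c} := by
    have := φ.convex_closedBall 0 c
    simpa [Seminorm.closedBall] using this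
  exact hconv.integral_mem (isClosed_le (continuous_seminorm φ) continuous_const) h hf

section EssentialAverage

variable {𝔫 : Type*} [NormedAddCommGroup 𝔫] [InnerProductSpace ℝ 𝔫] [EuclideanLieAlgebra 𝔫]
  [FiniteDimensional ℝ 𝔫] [MeasurableSpace 𝔫] [BorelSpace 𝔫]
  {Q : Type*} [Group Q] [TopologicalSpace Q] [MeasurableSpace Q] [BorelSpace Q]
  [DistribMulAction Q 𝔫] [ContinuousSMul Q 𝔫] (hQ : IsEuclideanLieAction Q 𝔫)
  (μ : Measure (𝔫 × Q)) [IsProbabilityMeasure μ]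

/-- The mean of the projection of `μ` to the abelian part. -/
def abelianMean (μ : Measure (𝔫 × Q)) : 𝔫 := ∫ g, (abelianPart 𝔫).starProjection g.1 ∂μ

variable {μ} in
theorem integrable_abelianPart {φ : Seminorm ℝ 𝔫} (hφ : ∀ u, φ u = 0 → u = 0) {R : ℝ}
    (hR : ∀ᵐ g ∂μ, φ g.1 ≤ R) :
    Integrable (fun g : 𝔫 × Q => (abelianPart 𝔫).starProjection g.1) μ := by
  obtain ⟨a, ha, hle⟩ := exists_norm_le_seminorm φ hφ
  refine Integrable.of_bound
    ((abelianPart 𝔫).starProjection.continuous.measurable.comp measurable_fst).aestronglyMeasurable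
    (R / a) ?_
  filter_upwards [hR] with g hg
  refine (Submodule.norm_starProjection_apply_le _ _).trans ?_
  rw [le_div_iff₀ ha, mul_comm]
  exact (hle _).trans hg

theorem essentialAverage_mem_fixedPart : essentialAverage hQ μ ∈ fixedPart hQ μ :=
  Submodule.starProjection_apply_mem _ _

theorem averagedAction_essentialAverage :
    averagedAction μ (essentialAverage hQ μ) = essentialAverage hQ μ := by
  rw [averagedAction, integral_congr_ae (essentialAverage_mem_fixedPart hQ μ).2]
  simp

variable {μ} in
theorem abelianMean_sub_essentialAverage_mem {φ : Seminorm ℝ 𝔫} (hφ : ∀ u, φ u = 0 → u = 0) {R : ℝ}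
    (hR : ∀ᵐ g ∂μ, φ g.1 ≤ R) : abelianMean μ - essentialAverage hQ μ ∈ movedPart hQ μ := by
  refine ⟨sub_mem ?_ (essentialAverage_mem_fixedPart hQ μ).1,
    Submodule.sub_starProjection_mem_orthogonal _⟩
  exact (abelianPart 𝔫).convex.integral_mem (Submodule.closed_of_finiteDimensional _)
    (Filter.Eventually.of_forall fun g => Submodule.starProjection_apply_mem _ _)
    (integrable_abelianPart hφ hR)

variable {μ} {φ : Seminorm ℝ 𝔫} (hφ : IsAdmissibleNorm Q φ) {R K κ : ℝ}
  (hR : ∀ᵐ g ∂μ, φ g.1 ≤ R) (hK0 : 0 ≤ K)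
  (hK : ∀ u, φ ((abelianPart 𝔫).starProjection u) ≤ K * φ u) (hκ : IsSpectralConstant hQ φ μ κ)

include hφ hR hK0 hK

theorem seminorm_abelianMean_le : φ (abelianMean μ) ≤ K * R := by
  refine φ.integral_le (integrable_abelianPart hφ.eq_zero hR) ?_
  filter_upwards [hR] with g hg
  exact (hK _).trans (mul_le_mul_of_nonneg_left hg hK0)

include hκ

/-- The W-part of the mean is estimated through its image under id − Ad(μ_Q). Since v_μ is fixed,
this image is also that of the whole mean, and the triangle inequality applies. -/
theorem seminorm_abelianMean_sub_essentialAverage_le :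
    φ (abelianMean μ - essentialAverage hQ μ) ≤ 2 * (K * R) / κ := by
  refine (hκ.2 _ (abelianMean_sub_essentialAverage_mem hQ hφ.eq_zero hR)).trans ?_
  refine div_le_div_of_nonneg_right ?_ hκ.1.le
  have hb := seminorm_abelianMean_le hφ hR hK0 hK
  have hT : φ (averagedAction μ (abelianMean μ)) ≤ K * R :=
    φ.integral_le (integrable_snd_smul hQ μ _)
      (Filter.Eventually.of_forall fun g => (hφ.map_smul g.2 _).trans_le hb)
  have heq : abelianMean μ - essentialAverage hQ μ -
      averagedAction μ (abelianMean μ - essentialAverage hQ μ) =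
      abelianMean μ - averagedAction μ (abelianMean μ) := by
    have := map_sub (averagedMap hQ μ) (abelianMean μ) (essentialAverage hQ μ)
    change averagedAction μ _ = averagedAction μ _ - averagedAction μ _ at this
    rw [this, averagedAction_essentialAverage]
    abel
  rw [heq]
  exact (map_sub_le_add φ _ _).trans (by linarith)

theorem seminorm_essentialAverage_le : φ (essentialAverage hQ μ) ≤ K * R + 2 * (K * R) / κ := by
  have h1 := seminorm_abelianMean_le hφ hR hK0 hK
  have h2 := seminorm_abelianMean_sub_essentialAverage_le hQ hφ hR hK0 hK hκ
  have h3 := map_sub_le_add φ (abelianMean μ) (abelianMean μ - essentialAverage hQ μ)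
  rw [sub_sub_cancel] at h3
  linarith

/-- The corrector `h` solves `h - Ad(μ_Q) h = ∫ ξ₁ dμ - v_μ`. -/
theorem exists_corrector : ∃ h ∈ abelianPart 𝔫,
    h - averagedAction μ h = abelianMean μ - essentialAverage hQ μ ∧
      φ h ≤ 2 * (K * R) / κ / κ := by
  obtain ⟨h, hh, heq⟩ := exists_mem_movedPart_sub_averagedAction hQ μ
    (abelianMean_sub_essentialAverage_mem hQ hφ.eq_zero hR)
  refine ⟨h, hh.1, heq, (hκ.2 h hh).trans (div_le_div_of_nonneg_right ?_ hκ.1.le)⟩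
  rw [heq]
  exact seminorm_abelianMean_sub_essentialAverage_le hQ hφ hR hK0 hK hκ

end EssentialAverage

end

noncomputable section

/-! ### Seminorms controlled by finitely many functionals -/

section Functionals

/-- A seminorm on a `d`-dimensional space is controlled by `d` linear functionals. -/
theorem exists_dual_seminorm_le_sum (d : ℕ) : ∀ (E : Type*) [AddCommGroup E] [Module ℝ E]
    [FiniteDimensional ℝ E] (p : Seminorm ℝ E), Module.finrank ℝ E = d →
    ∃ f : Fin d → Module.Dual ℝ E, (∀ i u, |f i u| ≤ 2 ^ d * p u) ∧ ∀ u, p u ≤ ∑ i, |f i u| := by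
  induction d with
  | zero =>
    intro E _ _ _ p hE
    have : Subsingleton E := Module.finrank_zero_iff.1 hE
    exact ⟨fun i => i.elim0, fun i => i.elim0, fun u => by simp [Subsingleton.elim u 0]⟩
  | succ d ih =>
    intro E _ _ _ p hE
    by_cases hp : ∀ u, p u = 0
    · exact ⟨fun _ => 0, by simp [hp], by simp [hp]⟩
    push Not at hp
    obtain ⟨e, he⟩ := hp
    have he0 : e ≠ 0 := fun h => he (by rw [h, map_zero])
    have hpe : 0 < p e := lt_of_le_of_ne (apply_nonneg p e) (Ne.symm he)
    -- Hahn–Banach gives a functional g with |g| ≤ p and g(e) = p(e).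
    obtain ⟨g, hge, hg⟩ := Module.Dual.exists_extension_of_le_seminorm_real
      (Submodule.span ℝ {e}) ((p e) • (LinearEquiv.toSpanNonzeroSingleton ℝ E e he0).symm.toLinearMap)
      (p := p) (by
        intro x
        obtain ⟨c, rfl⟩ := (LinearEquiv.toSpanNonzeroSingleton ℝ E e he0).surjective x
        change p e * (LinearEquiv.toSpanNonzeroSingleton ℝ E e he0).symm
          (LinearEquiv.toSpanNonzeroSingleton ℝ E e he0 c) ≤ p (c • e)
        rw [LinearEquiv.symm_apply_apply, map_smul_eq_mul, mul_comm]
        exact mul_le_mul_of_nonneg_right (le_abs_self c) hpe.le)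
    have hgee : g e = p e := by
      have h : g ((1 : ℝ) • e) = p e * (LinearEquiv.toSpanNonzeroSingleton ℝ E e he0).symm
          (LinearEquiv.toSpanNonzeroSingleton ℝ E e he0 1) :=
        hge ((LinearEquiv.toSpanNonzeroSingleton ℝ E e he0) 1)
      rwa [LinearEquiv.symm_apply_apply, one_smul, mul_one] at h
    have hker : Module.finrank ℝ (LinearMap.ker g) = d := by
      have hrange : LinearMap.range g = ⊤ := by
        refine LinearMap.range_eq_top.2 fun r => ⟨(r / p e) • e, ?_⟩
        rw [map_smul, hgee, smul_eq_mul, div_mul_cancel₀ _ hpe.ne']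
      have := LinearMap.finrank_range_add_finrank_ker g
      rw [hrange, finrank_top, Module.finrank_self, hE] at this
      omega
    -- The projection to ker g along e at most doubles p; this is the source of the factor 2^d.
    let π : E →ₗ[ℝ] E := LinearMap.id - (p e)⁻¹ • g.smulRight e
    have hπ : ∀ u, π u = u - (p e)⁻¹ • g u • e := fun u => rfl
    have hπker : ∀ u, π u ∈ LinearMap.ker g := fun u => by
      rw [LinearMap.mem_ker, hπ, map_sub, map_smul, map_smul, hgee, smul_eq_mul, smul_eq_mul,
        mul_comm (g u), inv_mul_cancel_left₀ hpe.ne', sub_self]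
    have hpr : ∀ u, p ((p e)⁻¹ • g u • e) = |g u| := fun u => by
      rw [map_smul_eq_mul, map_smul_eq_mul, norm_inv, Real.norm_of_nonneg hpe.le, Real.norm_eq_abs,
        mul_comm |g u|, inv_mul_cancel_left₀ hpe.ne']
    have hπp : ∀ u, p (π u) ≤ 2 * p u := fun u => by
      rw [hπ]
      refine (map_sub_le_add p _ _).trans ?_
      rw [hpr]
      linarith [hg u]
    obtain ⟨f, hf1, hf2⟩ := ih (LinearMap.ker g) (p.comp (LinearMap.ker g).subtype) hker
    refine ⟨Fin.cons g fun i => (f i) ∘ₗ (π.codRestrict (LinearMap.ker g) hπker), ?_, ?_⟩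
    · intro i u
      refine Fin.cases ?_ (fun i => ?_) i
      · refine (hg u).trans (le_mul_of_one_le_left (apply_nonneg p u) (one_le_pow₀ one_le_two))
      · refine (hf1 i _).trans ?_
        rw [pow_succ, mul_assoc]
        exact mul_le_mul_of_nonneg_left (hπp u) (by positivity)
    · intro u
      rw [Fin.sum_univ_succ]
      have h1 := hf2 (π.codRestrict (LinearMap.ker g) hπker u)
      have h2 : p u ≤ |g u| + p (π u) := by
        have := map_add_le_add p ((p e)⁻¹ • g u • e) (π u)
        rwa [hπ, add_sub_cancel, hpr, ← hπ] at this
      exact h2.trans (add_le_add le_rfl h1)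

end Functionals

/-! ### Seminorms weighted by powers of the scale -/

section WeightedSeminorm

variable {𝔫 : Type*} [NormedAddCommGroup 𝔫] [InnerProductSpace ℝ 𝔫] [EuclideanLieAlgebra 𝔫]
  [FiniteDimensional ℝ 𝔫]

/-- The seminorm `∑ εⁱ φ(uᵢ)`, the sum being over `1 ≤ i ≤ m`. -/
def weightedSeminorm (φ : Seminorm ℝ 𝔫) (v : 𝔫) (ε : ℝ) (m : ℕ) : Seminorm ℝ 𝔫 :=
  ∑ i ∈ Finset.range m,
    (ε.toNNReal ^ (i + 1)) • φ.comp ((weightLayer v (i + 1)).starProjection : 𝔫 →ₗ[ℝ] 𝔫)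

theorem weightedSeminorm_apply (φ : Seminorm ℝ 𝔫) (v : 𝔫) {ε : ℝ} (hε : 0 ≤ ε) (m : ℕ) (u : 𝔫) :
    weightedSeminorm φ v ε m u =
      ∑ i ∈ Finset.range m, ε ^ (i + 1) * φ (weightComponent v (i + 1) u) := by
  change FunLike.coeAddMonoidHom (Seminorm ℝ 𝔫) 𝔫 ℝ (weightedSeminorm φ v ε m) u = _
  rw [weightedSeminorm, map_sum, Finset.sum_apply]
  refine Finset.sum_congr rfl fun i _ => ?_
  change ((ε.toNNReal ^ (i + 1) : NNReal) : ℝ) * _ = _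
  rw [NNReal.coe_pow, Real.coe_toNNReal _ hε]
  rfl

variable {φ : Seminorm ℝ 𝔫} {v : 𝔫} {ε K : ℝ} {m : ℕ}

theorem le_weightedSeminorm (hε : 0 ≤ ε) {i : ℕ} (hi : i < m) (u : 𝔫) :
    ε ^ (i + 1) * φ (weightComponent v (i + 1) u) ≤ weightedSeminorm φ v ε m u := by
  rw [weightedSeminorm_apply φ v hε]
  exact Finset.single_le_sum (f := fun i => ε ^ (i + 1) * φ (weightComponent v (i + 1) u))
    (fun i _ => mul_nonneg (pow_nonneg hε _) (apply_nonneg φ _)) (Finset.mem_range.2 hi)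

/-- Only components of index at least k survive, and these carry a factor of at most εᵏ. -/
theorem weightedSeminorm_le_of_mem (hε : 0 ≤ ε) (hε1 : ε ≤ 1) (hK0 : 0 ≤ K)
    (hK : ProjectionsBoundedBy φ v K) {k : ℕ} {u : 𝔫} (hu : u ∈ weightFiltration v k) :
    weightedSeminorm φ v ε m u ≤ m * K * ε ^ k * φ u := by
  rw [weightedSeminorm_apply φ v hε]
  have h : ∀ i ∈ Finset.range m, ε ^ (i + 1) * φ (weightComponent v (i + 1) u) ≤
      K * ε ^ k * φ u := by
    intro i _
    by_cases hik : i + 1 < k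
    · rw [weightComponent_eq_zero v hik hu, map_zero, mul_zero]
      have := apply_nonneg φ u
      positivity
    · have h1 : ε ^ (i + 1) ≤ ε ^ k := pow_le_pow_of_le_one hε hε1 (not_lt.1 hik)
      calc ε ^ (i + 1) * φ (weightComponent v (i + 1) u) ≤ ε ^ k * (K * φ u) := by
            refine mul_le_mul h1 (hK _ _) (apply_nonneg φ _) (by positivity)
        _ = K * ε ^ k * φ u := by ring
  refine (Finset.sum_le_sum h).trans ?_
  rw [Finset.sum_const, Finset.card_range, nsmul_eq_mul]
  exact le_of_eq (by ring)

variable [LieRing.IsNilpotent 𝔫] {s : ℕ} (hs : LieModule.nilpotencyLength 𝔫 𝔫 = s)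
  (hε : 0 ≤ ε) (hε1 : ε ≤ 1) (hK0 : 0 ≤ K) (hK : ProjectionsBoundedBy φ v K)
  (hlie : ∀ x y, φ ⁅x, y⁆ ≤ φ x * φ y)

include hs hε hε1 hK0 hK hlie

/-- Split both arguments into components: the bracket of components of weights i and j lies in
𝔫⁽ⁱ⁺ʲ⁾, so the powers of ε match and the constant is free of ε. -/
theorem weightedSeminorm_lie_le (x y : 𝔫) :
    weightedSeminorm φ v ε (2 * s) ⁅x, y⁆ ≤
      (2 * s : ℕ) * K * weightedSeminorm φ v ε (2 * s) x * weightedSeminorm φ v ε (2 * s) y := by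
  have hsum : ⁅x, y⁆ = ∑ i ∈ Finset.range (2 * s), ∑ j ∈ Finset.range (2 * s),
      ⁅weightComponent v (i + 1) x, weightComponent v (j + 1) y⁆ := by
    conv_lhs => rw [← sum_weightComponent v hs x, ← sum_weightComponent v hs y]
    rw [sum_lie]
    simp only [lie_sum]
  rw [hsum, mul_assoc, weightedSeminorm_apply φ v hε _ x, weightedSeminorm_apply φ v hε _ y,
    Finset.sum_mul_sum, Finset.mul_sum]
  refine (seminorm_sum_le _ _ _).trans (Finset.sum_le_sum fun i _ => ?_)
  rw [Finset.mul_sum]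
  refine (seminorm_sum_le _ _ _).trans (Finset.sum_le_sum fun j _ => ?_)
  refine (weightedSeminorm_le_of_mem hε hε1 hK0 hK (lie_mem_weightFiltration v
    (weightComponent_mem v (i + 1) x) (weightComponent_mem v (j + 1) y))).trans ?_
  calc ((2 * s : ℕ) : ℝ) * K * ε ^ (i + 1 + (j + 1)) *
        φ ⁅weightComponent v (i + 1) x, weightComponent v (j + 1) y⁆
      ≤ ((2 * s : ℕ) : ℝ) * K * ε ^ (i + 1 + (j + 1)) *
        (φ (weightComponent v (i + 1) x) * φ (weightComponent v (j + 1) y)) :=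
        mul_le_mul_of_nonneg_left (hlie _ _) (by positivity)
    _ = _ := by rw [pow_add]; ring

/-- The filtration 𝔉_v gives bracketing with v weight two. The gain ε² is what keeps exp(k ad v)
bounded up to time ε⁻². -/
theorem weightedSeminorm_base_lie_le (y : 𝔫) :
    weightedSeminorm φ v ε (2 * s) ⁅v, y⁆ ≤
      (2 * s : ℕ) * K * φ v * ε ^ 2 * weightedSeminorm φ v ε (2 * s) y := by
  have hsum : ⁅v, y⁆ = ∑ j ∈ Finset.range (2 * s), ⁅v, weightComponent v (j + 1) y⁆ := by
    conv_lhs => rw [← sum_weightComponent v hs y]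
    rw [lie_sum]
  rw [hsum, weightedSeminorm_apply φ v hε _ y, Finset.mul_sum]
  refine (seminorm_sum_le _ _ _).trans (Finset.sum_le_sum fun j _ => ?_)
  refine (weightedSeminorm_le_of_mem hε hε1 hK0 hK (base_lie_mem_weightFiltration v
    (weightComponent_mem v (j + 1) y))).trans ?_
  calc ((2 * s : ℕ) : ℝ) * K * ε ^ (j + 1 + 2) * φ ⁅v, weightComponent v (j + 1) y⁆
      ≤ ((2 * s : ℕ) : ℝ) * K * ε ^ (j + 1 + 2) * (φ v * φ (weightComponent v (j + 1) y)) :=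
        mul_le_mul_of_nonneg_left (hlie _ _) (by positivity)
    _ = _ := by rw [pow_add]; ring

end WeightedSeminorm

end

noncomputable section

/-! ### Azuma's inequality for functions of independent variables -/

section Azuma

variable {Z : Type*} [MeasurableSpace Z] {μ : Measure Z} [IsProbabilityMeasure μ]

theorem lintegral_exp_mul_le {Y : Z → ℝ} {c : ℝ} (hc : 0 ≤ c) (hY : Measurable Y)
    (hb : ∀ᵐ z ∂μ, |Y z| ≤ c) (h0 : ∫ z, Y z ∂μ = 0) (l : ℝ) :
    ∫⁻ z, ENNReal.ofReal (Real.exp (l * Y z)) ∂μ ≤ ENNReal.ofReal (Real.exp (c ^ 2 * l ^ 2 / 2)) := by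
  have h := hasSubgaussianMGF_of_mem_Icc_of_integral_eq_zero (μ := μ) (a := -c) (b := c)
    hY.aemeasurable (by filter_upwards [hb] with z hz using abs_le.1 hz) h0
  rw [← ofReal_integral_eq_lintegral_ofReal (h.integrable_exp_mul l)
    (Filter.Eventually.of_forall fun z => (Real.exp_pos _).le)]
  refine ENNReal.ofReal_le_ofReal ((h.mgf_le l).trans (Real.exp_le_exp.2 (le_of_eq ?_)))
  have : ‖c - -c‖ = 2 * c := by rw [Real.norm_of_nonneg (by linarith)]; ring
  rw [NNReal.coe_pow, NNReal.coe_div, coe_nnnorm, this]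
  simp

variable {Ω : Type*} [MeasurableSpace Ω] {P : Measure Ω} [IsProbabilityMeasure P] {G : ℕ → Ω → Z}
  (hG : ∀ j, Measurable (G j)) (hlaw : ∀ j, P.map (G j) = μ) (hind : iIndepFun G P)

include hG hind in
-- Padding the past with a constant keeps it a point of the sequence space, on which the increments
-- are defined.
theorem indepFun_past (z₀ : Z) (k : ℕ) :
    IndepFun (fun ω j => if j < k then G j ω else z₀) (G k) P := by
  have h := hind.indepFun_finset (Finset.range k) {k} (by simp) hG
  let ψ : (Finset.range k → Z) → ℕ → Z := fun w j =>
    if hj : j ∈ Finset.range k then w ⟨j, hj⟩ else z₀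
  have hψ : Measurable ψ := by
    refine measurable_pi_lambda _ fun j => ?_
    by_cases hj : j ∈ Finset.range k
    · simp only [ψ, hj, dif_pos]
      exact measurable_pi_apply _
    · simp only [ψ, hj, dif_neg, not_false_iff]
      exact measurable_const
  have h' := h.comp hψ
    (measurable_pi_apply (⟨k, Finset.mem_singleton_self k⟩ : ({k} : Finset ℕ)))
  convert h' using 1
  · funext ω j
    simp [ψ]
  · rfl

variable {d : ℕ → (ℕ → Z) → ℝ} (hd : ∀ k, Measurable (d k))
  (hdep : ∀ k g g', (∀ j ≤ k, g j = g' j) → d k g = d k g') {c : ℝ} (hc : 0 < c)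
  (hbound : ∀ k g, ∀ᵐ z ∂μ, |d k (Function.update g k z)| ≤ c)
  (hmean : ∀ k g, ∫ z, d k (Function.update g k z) ∂μ = 0)

include hG hlaw hind hd hdep hc hbound hmean

/-- Conditioning is done by Fubini: with the past frozen, the n-th term is a bounded centred
function of one fresh variable, and Hoeffding's lemma bounds its exponential moment. Thus `hbound`
and `hmean` are required for every frozen past. -/
theorem lintegral_exp_sum_le (l : ℝ) (n : ℕ) :
    ∫⁻ ω, ENNReal.ofReal (Real.exp (l * ∑ k ∈ Finset.range n, d k fun j => G j ω)) ∂P ≤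
      ENNReal.ofReal (Real.exp (n * (c ^ 2 * l ^ 2 / 2))) := by
  obtain ⟨z₀⟩ : Nonempty Z := μ.nonempty_of_neZero
  induction n with
  | zero => simp
  | succ n ih =>
    let past : Ω → ℕ → Z := fun ω j => if j < n then G j ω else z₀
    have hpast : Measurable past := by
      refine measurable_pi_lambda _ fun j => ?_
      by_cases hj : j < n
      · simpa only [past, hj, if_true] using hG j
      · simp only [past, hj, if_false, measurable_const]
    let S : (ℕ → Z) → ℝ := fun g => ∑ k ∈ Finset.range n, d k g
    have hS : Measurable S := Finset.measurable_sum _ fun k _ => hd k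
    have hSpast : ∀ ω, S (past ω) = S fun j => G j ω := fun ω =>
      Finset.sum_congr rfl fun k hk => hdep k _ _ fun j hj => by
        simp only [past, if_pos (hj.trans_lt (Finset.mem_range.1 hk))]
    have hnpast : ∀ ω, d n (Function.update (past ω) n (G n ω)) = d n fun j => G j ω := fun ω =>
      hdep n _ _ fun j hj => by
        rcases hj.eq_or_lt with rfl | hj
        · simp
        · rw [Function.update_of_ne hj.ne]
          simp only [past, if_pos hj]
    let H : (ℕ → Z) × Z → ENNReal := fun q =>
      ENNReal.ofReal (Real.exp (l * (S q.1 + d n (Function.update q.1 n q.2))))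
    have hdn : Measurable fun q : (ℕ → Z) × Z => d n (Function.update q.1 n q.2) :=
      (hd n).comp (measurable_update' (a := n))
    have hH : Measurable H :=
      ((((hS.comp measurable_fst).add hdn).const_mul l).exp).ennreal_ofReal
    have hprod := (indepFun_iff_map_prod_eq_prod_map_map hpast.aemeasurable
      (hG n).aemeasurable).1 (indepFun_past hG hind z₀ n)
    have : SFinite μ := inferInstance
    calc ∫⁻ ω, ENNReal.ofReal (Real.exp (l * ∑ k ∈ Finset.range (n + 1), d k fun j => G j ω)) ∂P
        = ∫⁻ ω, H (past ω, G n ω) ∂P := by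
          refine lintegral_congr fun ω => ?_
          simp only [H]
          rw [hSpast, hnpast, Finset.sum_range_succ]
      _ = ∫⁻ q, H q ∂((P.map past).prod μ) := by
          rw [← lintegral_map hH (hpast.prodMk (hG n)), hprod, hlaw]
      _ = ∫⁻ p, ∫⁻ z, H (p, z) ∂μ ∂(P.map past) := lintegral_prod _ hH.aemeasurable
      _ ≤ ∫⁻ p, ENNReal.ofReal (Real.exp (l * S p)) *
            ENNReal.ofReal (Real.exp (c ^ 2 * l ^ 2 / 2)) ∂(P.map past) := by
          refine lintegral_mono fun p => ?_
          have hm : Measurable fun z => d n (Function.update p n z) :=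
            hdn.comp measurable_prodMk_left
          simp only [H, mul_add, Real.exp_add, ENNReal.ofReal_mul (Real.exp_pos _).le]
          rw [lintegral_const_mul _ (hm.const_mul l).exp.ennreal_ofReal]
          gcongr
          exact lintegral_exp_mul_le hc.le hm (hbound n p) (hmean n p) l
      _ = (∫⁻ ω, ENNReal.ofReal (Real.exp (l * S (past ω))) ∂P) *
            ENNReal.ofReal (Real.exp (c ^ 2 * l ^ 2 / 2)) := by
          rw [lintegral_mul_const _ (hS.const_mul l).exp.ennreal_ofReal,
            lintegral_map (hS.const_mul l).exp.ennreal_ofReal hpast]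
      _ ≤ ENNReal.ofReal (Real.exp (n * (c ^ 2 * l ^ 2 / 2))) *
            ENNReal.ofReal (Real.exp (c ^ 2 * l ^ 2 / 2)) := by
          gcongr
          simpa only [hSpast] using ih
      _ = ENNReal.ofReal (Real.exp ((n + 1 : ℕ) * (c ^ 2 * l ^ 2 / 2))) := by
          rw [← ENNReal.ofReal_mul (Real.exp_pos _).le, ← Real.exp_add]
          congr 2
          push_cast
          ring

theorem measure_sum_ge_le {n : ℕ} (hn : 1 ≤ n) {a : ℝ} (ha : 0 ≤ a) :
    P {ω | a ≤ ∑ k ∈ Finset.range n, d k fun j => G j ω} ≤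
      ENNReal.ofReal (Real.exp (-(a ^ 2 / (2 * (n * c ^ 2))))) := by
  have hn0 : (0 : ℝ) < n := by exact_mod_cast hn
  have hS : Measurable fun ω => ∑ k ∈ Finset.range n, d k fun j => G j ω :=
    Finset.measurable_sum _ fun k _ => (hd k).comp (measurable_pi_lambda _ hG)
  -- The minimiser of −la + nc²l²/2 in Chernoff's bound.
  set l := a / (n * c ^ 2) with hl
  have hl0 : 0 ≤ l := by positivity
  have hmarkov := mul_meas_ge_le_lintegral (μ := P) (hS.const_mul l).exp.ennreal_ofReal
    (ENNReal.ofReal (Real.exp (l * a)))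
  have hsub : {ω | a ≤ ∑ k ∈ Finset.range n, d k fun j => G j ω} ⊆
      {ω | ENNReal.ofReal (Real.exp (l * a)) ≤
        ENNReal.ofReal (Real.exp (l * ∑ k ∈ Finset.range n, d k fun j => G j ω))} := fun ω hω =>
    ENNReal.ofReal_le_ofReal (Real.exp_le_exp.2 (mul_le_mul_of_nonneg_left hω hl0))
  have h := (mul_le_mul_right (measure_mono (μ := P) hsub) (ENNReal.ofReal (Real.exp (l * a)))).trans
    (hmarkov.trans (lintegral_exp_sum_le hG hlaw hind hd hdep hc hbound hmean l n))
  have hcancel : ENNReal.ofReal (Real.exp (-(l * a))) * ENNReal.ofReal (Real.exp (l * a)) = 1 := by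
    rw [← ENNReal.ofReal_mul (Real.exp_pos _).le, ← Real.exp_add, neg_add_cancel, Real.exp_zero,
      ENNReal.ofReal_one]
  calc P {ω | a ≤ ∑ k ∈ Finset.range n, d k fun j => G j ω}
      = ENNReal.ofReal (Real.exp (-(l * a))) * (ENNReal.ofReal (Real.exp (l * a)) *
          P {ω | a ≤ ∑ k ∈ Finset.range n, d k fun j => G j ω}) := by
        rw [← mul_assoc, hcancel, one_mul]
    _ ≤ ENNReal.ofReal (Real.exp (-(l * a))) *
          ENNReal.ofReal (Real.exp (n * (c ^ 2 * l ^ 2 / 2))) := by gcongr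
    _ = _ := by
        rw [← ENNReal.ofReal_mul (Real.exp_pos _).le, ← Real.exp_add]
        congr 2
        rw [hl]
        field_simp
        ring

theorem measureReal_abs_sum_ge_le {n : ℕ} (hn : 1 ≤ n) {a : ℝ} (ha : 0 ≤ a) :
    P.real {ω | a ≤ |∑ k ∈ Finset.range n, d k fun j => G j ω|} ≤
      2 * Real.exp (-(a ^ 2 / (2 * (n * c ^ 2)))) := by
  have h1 := measure_sum_ge_le hG hlaw hind hd hdep hc hbound hmean hn ha
  have h2 := measure_sum_ge_le (d := fun k g => -d k g) hG hlaw hind (fun k => (hd k).neg)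
    (fun k g g' h => by rw [hdep k g g' h]) hc (by simpa only [abs_neg] using hbound)
    (fun k g => by rw [integral_neg, hmean, neg_zero]) hn ha
  have hsub : {ω | a ≤ |∑ k ∈ Finset.range n, d k fun j => G j ω|} ⊆
      {ω | a ≤ ∑ k ∈ Finset.range n, d k fun j => G j ω} ∪
        {ω | a ≤ ∑ k ∈ Finset.range n, -d k fun j => G j ω} := fun ω hω => by
    simp only [Set.mem_union, Set.mem_ofPred_eq, Finset.sum_neg_distrib] at hω ⊢
    exact le_abs.1 hω
  refine ENNReal.toReal_le_of_le_ofReal (by positivity) ?_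
  refine (measure_mono hsub).trans ((measure_union_le _ _).trans ?_)
  rw [two_mul, ENNReal.ofReal_add (by positivity) (by positivity)]
  exact add_le_add h1 h2

end Azuma

end

noncomputable section

/-! ### Group identities for the corrected walk -/

section GroupIdentities

variable {𝔫 : Type*} [NormedAddCommGroup 𝔫] [InnerProductSpace ℝ 𝔫] [EuclideanLieAlgebra 𝔫]
  [LieRing.IsNilpotent 𝔫]

theorem neg_lieProduct_cancel_left (x y : 𝔫) : lieProduct (-x) (lieProduct x y) = y := by
  rw [← lieProduct_assoc, neg_lieProduct, zero_lieProduct]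

theorem lieProduct_neg_cancel_left (x y : 𝔫) : lieProduct x (lieProduct (-x) y) = y := by
  rw [← lieProduct_assoc, lieProduct_neg, zero_lieProduct]

attribute [local instance] LieRing.ofAssociativeRing in
/-- A linear functional which vanishes on `[𝔫, 𝔫]` is a homomorphism of the group. -/
theorem map_lieProduct_of_lie_eq_zero (l : 𝔫 →ₗ[ℝ] ℝ) (hl : ∀ x y : 𝔫, l ⁅x, y⁆ = 0) (x y : 𝔫) :
    l (lieProduct x y) = l x + l y := by
  let f : 𝔫 →ₗ⁅ℝ⁆ ℝ := { l with
    map_lie' := fun {x y} => (hl x y).trans (by rw [LieRing.of_associative_ring_bracket]; simp [mul_comm]) }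
  have hbot : LieModule.lowerCentralSeries ℝ ℝ ℝ 1 = ⊥ := by
    have : LieModule.IsTrivial ℝ ℝ :=
      ⟨fun x y => by rw [LieRing.of_associative_ring_bracket]; ring⟩
    rw [LieModule.lowerCentralSeries_succ]
    exact LieSubmodule.trivial_lie_oper_zero _ _
  set s := LieModule.nilpotencyLength 𝔫 𝔫
  rw [lieProduct_eq_dynkinSeries_nilpotencyLength,
    -- The order must be at least s for 𝔫 and have the form K + 1 with K ≥ 2 for the abelian target
    -- ℝ, whose series vanishes at index 1.
    dynkinSeries_eq_of_le (lowerCentralSeries_nilpotencyLength 𝔫) (show s ≤ s + 2 + 1 by omega)]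
  refine (map_dynkinSeries f _ x y).trans ?_
  exact dynkinSeries_eq_add hbot (by omega) (by rw [LieRing.of_associative_ring_bracket]; ring)

theorem abelianPart_starProjection_lie [FiniteDimensional ℝ 𝔫] (x y : 𝔫) :
    (abelianPart 𝔫).starProjection ⁅x, y⁆ = 0 :=
  (Submodule.starProjection_apply_eq_zero_iff _).2
    (Submodule.le_orthogonal_orthogonal _ (Submodule.subset_span ⟨x, y, rfl⟩))

theorem abelianPart_starProjection_lieProduct [FiniteDimensional ℝ 𝔫] (x y : 𝔫) :
    (abelianPart 𝔫).starProjection (lieProduct x y) =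
      (abelianPart 𝔫).starProjection x + (abelianPart 𝔫).starProjection y := by
  refine ext_inner_left ℝ fun z => ?_
  rw [inner_add_right]
  exact map_lieProduct_of_lie_eq_zero
    ((innerₛₗ ℝ z) ∘ₗ ((abelianPart 𝔫).starProjection : 𝔫 →ₗ[ℝ] 𝔫)) (fun x y => by
      simp [abelianPart_starProjection_lie]) x y

variable {Q : Type*} [Group Q] [DistribMulAction Q 𝔫]

/-- The increment `(-h) ∗ ξ ∗ κh ∗ (-v)` of the walk recentred with the corrector `h`. -/
def correctedIncrement (h v : 𝔫) (g : 𝔫 × Q) : 𝔫 :=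
  lieProduct (lieProduct (lieProduct (-h) g.1) (g.2 • h)) (-v)

/-- The recentred walk with corrector `h`. -/
def correctedWalk (h v : 𝔫) (g : ℕ → 𝔫 × Q) (k : ℕ) : 𝔫 :=
  lieProduct (lieProduct (walk g k).1 ((walk g k).2 • h)) (-((k : ℝ) • v))

theorem correctedWalk_zero (h v : 𝔫) (g : ℕ → 𝔫 × Q) : correctedWalk h v g 0 = h := by
  simp [correctedWalk, walk, lieProduct_zero, zero_lieProduct]

theorem walk_snd_smul_eq {v : 𝔫} {g : ℕ → 𝔫 × Q} (hfix : ∀ j, (g j).2 • v = v) (k : ℕ) :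
    (walk g k).2 • v = v := by
  induction k with
  | zero => simp [walk]
  | succ k ih => rw [walk, semidirectMul, mul_smul, hfix, ih]

theorem walk_congr {g g' : ℕ → 𝔫 × Q} {k : ℕ} (h : ∀ j < k, g j = g' j) : walk g k = walk g' k := by
  induction k with
  | zero => rfl
  | succ k ih =>
    rw [walk, walk, ih fun j hj => h j (by omega), h k (by omega)]

variable (hQ : IsEuclideanLieAction Q 𝔫) {s : ℕ} (hs : LieModule.nilpotencyLength 𝔫 𝔫 = s)

include hQ hs in
-- The factor h ∗ (−kv) of the old position is inserted together with its inverse. What remains on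
-- the right is the new increment conjugated by exp(kv); here the Q-part of the walk has to fix v.
theorem correctedWalk_succ {h v : 𝔫} {g : ℕ → 𝔫 × Q} (hfix : ∀ j, (g j).2 • v = v) (k : ℕ) :
    correctedWalk h v g (k + 1) = lieProduct (correctedWalk h v g k)
      (expAd s ((k : ℝ) • v) ((walk g k).2 • correctedIncrement h v (g k))) := by
  have hv := walk_snd_smul_eq hfix k
  have hlast : -(((k + 1 : ℕ) : ℝ) • v) = lieProduct (-v) (-((k : ℝ) • v)) := by
    rw [lieProduct_of_lie_eq_zero (by simp)]
    push_cast
    module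
  rw [← lieProduct_conj hs]
  simp only [correctedWalk, correctedIncrement, hQ.smul_lieProduct, smul_neg, hv, lieProduct_assoc,
    neg_lieProduct_cancel_left, lieProduct_neg_cancel_left, walk, semidirectMul, mul_smul, hlast]

include hs in
theorem semidirectMul_walk_neg {h v : 𝔫} {g : ℕ → 𝔫 × Q} (hfix : ∀ j, (g j).2 • v = v)
    (hQ : IsEuclideanLieAction Q 𝔫) (k : ℕ) :
    (semidirectMul (walk g k) (-((k : ℝ) • v), 1)).1 = lieProduct (correctedWalk h v g k)
      (expAd s ((k : ℝ) • v) (-((walk g k).2 • h))) := by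
  have hv := walk_snd_smul_eq hfix k
  rw [← lieProduct_conj hs]
  simp only [correctedWalk, smul_neg, hQ.smul_smul_comm, hv, lieProduct_assoc,
    neg_lieProduct_cancel_left, lieProduct_neg_cancel_left, semidirectMul]

end GroupIdentities

/-! ### One-step estimates, the stopping argument and the homogeneous norm -/

section Estimates

variable {𝔫 : Type*} [NormedAddCommGroup 𝔫] [InnerProductSpace ℝ 𝔫] [EuclideanLieAlgebra 𝔫]
  [LieRing.IsNilpotent 𝔫] {s : ℕ} (hs : LieModule.nilpotencyLength 𝔫 𝔫 = s)

theorem lieProduct_eq_add_dynkinPart {s : ℕ} (hs : LieModule.nilpotencyLength 𝔫 𝔫 = s) (x y : 𝔫) :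
    lieProduct x y =
      x + dynkinPart (· = 1) (truncOrder s) x y + dynkinPart (2 ≤ ·) (truncOrder s) x y := by
  rw [lieProduct_eq_dynkinSeries hs, dynkinSeries_eq_sum_dynkinPart, dynkinPart_zero,
    ← lieProduct_eq_dynkinSeries hs, lieProduct_zero]

variable {p : Seminorm ℝ 𝔫} {C b : ℝ} (hC : 1 ≤ C) (hp : ∀ x y, p ⁅x, y⁆ ≤ C * p x * p y)

include hs hC hp

theorem seminorm_lieProduct_le {x y : 𝔫} (hx : p x ≤ 1) (hy : p y ≤ b) (hb : b ≤ 1) :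
    p (lieProduct x y) ≤ p x + 2 * dynkinBound (truncOrder s) C * b := by
  have h1 := seminorm_dynkinPart_le p (· = 1) (m := 1) (fun k hk => hk.ge) hC hp (truncOrder s) hx hy hb
  have h2 := seminorm_dynkinPart_le p (2 ≤ ·) (m := 1) (fun k hk => by omega) hC hp (truncOrder s)
    hx hy hb
  rw [pow_one] at h1 h2
  rw [lieProduct_eq_add_dynkinPart hs]
  refine (map_add_le_add p _ _).trans ?_
  have := map_add_le_add p x (dynkinPart (· = 1) (truncOrder s) x y)
  linarith

/-- First-order expansion of x ∗ y in which z replaces y in the linear term. In the application z is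
the transported abelian part of the increment, and both c and b² have order ε². -/
theorem seminorm_lieProduct_sub_le {x y z : 𝔫} {c : ℝ} (hx : p x ≤ 1) (hy : p y ≤ b) (hb : b ≤ 1)
    (hyz : p (y - z) ≤ c) (hc : c ≤ 1) :
    p (lieProduct x y - x - dynkinPart (· = 1) (truncOrder s) x z) ≤
      dynkinBound (truncOrder s) C * (c + b ^ 2) := by
  obtain ⟨A, hA⟩ := exists_linear_dynkinPart (truncOrder s) x
  have h1 := seminorm_dynkinPart_le p (· = 1) (m := 1) (fun k hk => hk.ge) hC hp (truncOrder s)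
    hx hyz hc
  have h2 := seminorm_dynkinPart_le p (2 ≤ ·) (m := 2) (fun k hk => hk) hC hp (truncOrder s)
    hx hy hb
  have heq : lieProduct x y - x - dynkinPart (· = 1) (truncOrder s) x z =
      dynkinPart (· = 1) (truncOrder s) x (y - z) + dynkinPart (2 ≤ ·) (truncOrder s) x y := by
    rw [lieProduct_eq_add_dynkinPart hs, hA, hA, hA, map_sub]
    abel
  rw [heq]
  refine (map_add_le_add p _ _).trans ?_
  rw [pow_one] at h1
  linarith

end Estimates

/-- A sequence which leaves the ball of radius `1/2` has a large stopped sum of main increments. -/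
theorem le_seminorm_stopped_sum {E : Type*} [AddCommGroup E] [Module ℝ E] (p : Seminorm ℝ E)
    {Y D : ℕ → E} {n : ℕ} {δ : ℝ} (hδ : n * δ ≤ 1 / 8) (hδ0 : 0 ≤ δ) (h0 : p (Y 0) ≤ 1 / 8)
    (hstep : ∀ k < n, p (Y k) < 1 / 2 → p (Y (k + 1) - Y k - D k) ≤ δ)
    (hexit : ∃ k ≤ n, 1 / 2 ≤ p (Y k)) :
    1 / 4 ≤ p (∑ k ∈ Finset.range n,
      ({k | ∀ j ≤ k, p (Y j) < 1 / 2} : Set ℕ).indicator D k) := by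
  classical
  have hex : ∃ k, 1 / 2 ≤ p (Y k) := hexit.imp fun k hk => hk.2
  set τ := Nat.find hex with hτ
  have hτ1 : 1 / 2 ≤ p (Y τ) := Nat.find_spec hex
  have hτn : τ ≤ n := by
    obtain ⟨k, hk, hk'⟩ := hexit
    exact (Nat.find_min' hex hk').trans hk
  have hlt : ∀ j < τ, p (Y j) < 1 / 2 := fun j hj => not_le.1 (Nat.find_min hex hj)
  -- The condition includes j = k, so it first fails at the exit time τ and exactly the terms k < τ
  -- remain.
  have hsum : ∑ k ∈ Finset.range n, ({k | ∀ j ≤ k, p (Y j) < 1 / 2} : Set ℕ).indicator D k =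
      ∑ k ∈ Finset.range τ, D k := by
    rw [← Finset.sum_subset (Finset.range_subset_range.2 hτn)]
    · refine Finset.sum_congr rfl fun k hk => Set.indicator_of_mem ?_ D
      exact fun j hj => hlt j (hj.trans_lt (Finset.mem_range.1 hk))
    · intro k _ hk
      refine Set.indicator_of_notMem (fun hk' => ?_) D
      exact (hk' τ (not_lt.1 fun h => hk (Finset.mem_range.2 h))).not_ge hτ1
  rw [hsum]
  have htel : Y τ = Y 0 + ∑ k ∈ Finset.range τ, D k +
      ∑ k ∈ Finset.range τ, (Y (k + 1) - Y k - D k) := by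
    rw [Finset.sum_sub_distrib, Finset.sum_range_sub]
    abel
  have hr : p (∑ k ∈ Finset.range τ, (Y (k + 1) - Y k - D k)) ≤ 1 / 8 := by
    refine (seminorm_sum_le p _ _).trans ?_
    refine (Finset.sum_le_sum (g := fun _ => δ) fun k hk => hstep k
      ((Finset.mem_range.1 hk).trans_le hτn) (hlt k (Finset.mem_range.1 hk))).trans ?_
    rw [Finset.sum_const, Finset.card_range, nsmul_eq_mul]
    exact (mul_le_mul_of_nonneg_right (by exact_mod_cast hτn) hδ0).trans hδ
  have h1 := map_add_le_add p (Y 0 + ∑ k ∈ Finset.range τ, D k)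
    (∑ k ∈ Finset.range τ, (Y (k + 1) - Y k - D k))
  have h2 := map_add_le_add p (Y 0) (∑ k ∈ Finset.range τ, D k)
  rw [← htel] at h1
  linarith

section HomogeneousNorm

variable {𝔫 : Type*} [NormedAddCommGroup 𝔫] [InnerProductSpace ℝ 𝔫] [EuclideanLieAlgebra 𝔫]
  [FiniteDimensional ℝ 𝔫]

/-- A component attaining the supremum has φ(uᵢ) ≥ ε⁻ⁱ, and its weight is εⁱ. -/
theorem one_le_weightedSeminorm {φ : Seminorm ℝ 𝔫} {v u : 𝔫} {ε : ℝ} (hε : 0 < ε) {s : ℕ}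
    (hs : LieModule.nilpotencyLength 𝔫 𝔫 = s) (h : ε⁻¹ ≤ homogeneousNorm φ v u) :
    1 ≤ weightedSeminorm φ v ε (2 * s) u := by
  subst hs
  rw [homogeneousNorm] at h
  rcases isEmpty_or_nonempty (Fin (2 * LieModule.nilpotencyLength 𝔫 𝔫)) with h0 | h0
  · rw [Real.iSup_of_isEmpty] at h
    exact absurd h (not_le.2 (inv_pos.2 hε))
  · obtain ⟨i, hi⟩ := exists_eq_ciSup_of_finite
      (f := fun i : Fin (2 * LieModule.nilpotencyLength 𝔫 𝔫) =>
        φ (weightComponent v (i + 1) u) ^ (1 / ((i : ℝ) + 1)))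
    rw [← hi] at h
    refine le_trans ?_ (le_weightedSeminorm hε.le i.2 u)
    have h1 := pow_le_pow_left₀ (inv_pos.2 hε).le h (i + 1)
    have h2 : (φ (weightComponent v (i + 1) u) ^ (1 / ((i : ℝ) + 1))) ^ ((i : ℕ) + 1) =
        φ (weightComponent v (i + 1) u) := by
      have := Real.rpow_inv_natCast_pow (apply_nonneg φ (weightComponent v (i + 1) u))
        (Nat.succ_ne_zero (i : ℕ))
      rw [one_div]
      exact_mod_cast this
    rw [h2, inv_pow, inv_le_iff_one_le_mul₀' (pow_pos hε _)] at h1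
    exact h1

end HomogeneousNorm

end

noncomputable section

/-! ### Explicit constants and weighted estimates for the increments -/

section Constants

/-- The constant of bilinearity of the weighted seminorms. -/
def weightedConstant (s : ℕ) (K b : ℝ) : ℝ := (2 * s : ℕ) * K * (b + 1) + 1

/-- A bound for `exp (ad (kv))` on the weighted seminorms. -/
def expConstant (s : ℕ) (K b : ℝ) : ℝ :=
  ∑ i ∈ Finset.range (truncOrder s + 1), weightedConstant s K b ^ i

/-- A bound for a product of four elements of norm at most `b`. -/
def incrementBound (s : ℕ) (b : ℝ) : ℝ :=
  let c := b + dynkinBound (truncOrder s) b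
  b + dynkinBound (truncOrder s) (b + dynkinBound (truncOrder s) c)

/-- A bound for the increments of the corrected walk, up to the weight. -/
def stepConstant (s : ℕ) (K b : ℝ) : ℝ :=
  expConstant s K b * weightedConstant s K b * (1 + K) * incrementBound s b

variable {s : ℕ} {K b : ℝ} (hK1 : 1 ≤ K) (hb : 1 ≤ b)
include hK1 hb

theorem one_le_weightedConstant : 1 ≤ weightedConstant s K b := by
  rw [weightedConstant]
  have : 0 ≤ ((2 * s : ℕ) : ℝ) * K * (b + 1) := by positivity
  linarith

theorem one_le_expConstant : 1 ≤ expConstant s K b := by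
  have hC := one_le_weightedConstant (s := s) hK1 hb
  refine le_trans (by simp) (Finset.single_le_sum (f := fun i => weightedConstant s K b ^ i)
    (fun i _ => by positivity) (Finset.mem_range.2 (Nat.succ_pos _)))

omit hK1 in
theorem le_incrementBound : b ≤ incrementBound s b := by
  have h1 := dynkinBound_nonneg (truncOrder s) (zero_le_one.trans hb)
  have h2 := dynkinBound_nonneg (truncOrder s) (add_nonneg (zero_le_one.trans hb) h1)
  have h3 : 0 ≤ b + dynkinBound (truncOrder s) (b + dynkinBound (truncOrder s) b) := by positivity
  have := dynkinBound_nonneg (truncOrder s) h3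
  simp only [incrementBound]
  linarith

theorem stepConstant_nonneg : 0 ≤ stepConstant s K b := by
  have h1 := one_le_weightedConstant (s := s) hK1 hb
  have h2 := one_le_expConstant (s := s) hK1 hb
  have h3 := le_incrementBound (s := s) hb
  have : 0 ≤ incrementBound s b := by linarith
  rw [stepConstant]
  positivity

end Constants

section WeightedEstimates

variable {𝔫 : Type*} [NormedAddCommGroup 𝔫] [InnerProductSpace ℝ 𝔫] [EuclideanLieAlgebra 𝔫]
  [FiniteDimensional ℝ 𝔫] [LieRing.IsNilpotent 𝔫] {s : ℕ}
  (hs : LieModule.nilpotencyLength 𝔫 𝔫 = s) {φ : Seminorm ℝ 𝔫}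
  (hlie : ∀ x y, φ ⁅x, y⁆ ≤ φ x * φ y) {b : ℝ} (hb : 1 ≤ b)

section

include hs hlie hb

theorem seminorm_correctedIncrement_le {Q : Type*} [Group Q] [DistribMulAction Q 𝔫]
    (hφQ : ∀ (q : Q) u, φ (q • u) = φ u) {h v : 𝔫} {g : 𝔫 × Q} (hh : φ h ≤ b) (hv : φ v ≤ b)
    (hg : φ g.1 ≤ b) : φ (correctedIncrement h v g) ≤ incrementBound s b := by
  have hp : ∀ x y, φ ⁅x, y⁆ ≤ 1 * φ x * φ y := fun x y => by rw [one_mul]; exact hlie x y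
  have key : ∀ {c : ℝ} {x y : 𝔫}, φ x ≤ c → φ y ≤ c →
      φ (lieProduct x y) ≤ dynkinBound (truncOrder s) c := fun {c x y} hx hy => by
    rw [lieProduct_eq_dynkinSeries hs]
    simpa only [one_mul] using seminorm_dynkinSeries_le φ le_rfl hp (truncOrder s) hx hy
  have hb0 : 0 ≤ b := zero_le_one.trans hb
  have h1 := dynkinBound_nonneg (truncOrder s) hb0
  have h2 := dynkinBound_nonneg (truncOrder s) (add_nonneg hb0 h1)
  have hneg : ∀ x, φ (-x) = φ x := fun x => map_neg_eq_map φ x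
  have e1 := key (c := b) (x := -h) (y := g.1) (by rwa [hneg]) hg
  have e2 := key (c := b + dynkinBound (truncOrder s) b) (x := lieProduct (-h) g.1) (y := g.2 • h)
    (by linarith) (by rw [hφQ]; linarith)
  have e3 := key (c := b + dynkinBound (truncOrder s) (b + dynkinBound (truncOrder s) b))
    (y := -v) (by linarith) (by rw [hneg]; linarith)
  simp only [incrementBound]
  rw [correctedIncrement]
  linarith

end

variable {v : 𝔫} {ε K : ℝ} (hε : 0 ≤ ε) (hε1 : ε ≤ 1) (hK1 : 1 ≤ K)
  (hK : ProjectionsBoundedBy φ v K) (hv : φ v ≤ b)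

include hs hlie hb hε hε1 hK1 hK

theorem weightedSeminorm_lie_le_weightedConstant (x y : 𝔫) :
    weightedSeminorm φ v ε (2 * s) ⁅x, y⁆ ≤ weightedConstant s K b *
      weightedSeminorm φ v ε (2 * s) x * weightedSeminorm φ v ε (2 * s) y := by
  refine (weightedSeminorm_lie_le hs hε hε1 (by linarith) hK hlie x y).trans ?_
  have hc : ((2 * s : ℕ) : ℝ) * K ≤ weightedConstant s K b := by
    rw [weightedConstant]
    have : 0 ≤ ((2 * s : ℕ) : ℝ) * K := by positivity
    nlinarith
  have h1 := apply_nonneg (weightedSeminorm φ v ε (2 * s)) x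
  have h2 := apply_nonneg (weightedSeminorm φ v ε (2 * s)) y
  gcongr

omit hs hlie [LieRing.IsNilpotent 𝔫] in
theorem weightedSeminorm_le_of_mem_weightFiltration {k : ℕ} {u : 𝔫}
    (hu : u ∈ weightFiltration v k) :
    weightedSeminorm φ v ε (2 * s) u ≤ weightedConstant s K b * ε ^ k * φ u := by
  refine (weightedSeminorm_le_of_mem hε hε1 (by linarith) hK hu).trans ?_
  have hc : ((2 * s : ℕ) : ℝ) * K ≤ weightedConstant s K b := by
    rw [weightedConstant]
    have : 0 ≤ ((2 * s : ℕ) : ℝ) * K := by positivity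
    nlinarith
  have h1 := apply_nonneg φ u
  gcongr

include hv

theorem weightedSeminorm_expAd_le {k : ℕ} (hk : k * ε ^ 2 ≤ 1) (y : 𝔫) :
    weightedSeminorm φ v ε (2 * s) (expAd s ((k : ℝ) • v) y) ≤
      expConstant s K b * weightedSeminorm φ v ε (2 * s) y := by
  have hC := one_le_weightedConstant (s := s) hK1 hb
  refine seminorm_truncExp_ad_le _ (by linarith) (fun z => ?_) (truncOrder s) y
  have h0 := apply_nonneg (weightedSeminorm φ v ε (2 * s)) z
  rw [smul_lie, map_smul_eq_mul, Real.norm_of_nonneg (Nat.cast_nonneg k)]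
  have hm : ((2 * s : ℕ) : ℝ) * K * φ v ≤ weightedConstant s K b := by
    rw [weightedConstant]
    have : 0 ≤ ((2 * s : ℕ) : ℝ) * K := by positivity
    nlinarith
  calc (k : ℝ) * weightedSeminorm φ v ε (2 * s) ⁅v, z⁆
      ≤ k * ((2 * s : ℕ) * K * φ v * ε ^ 2 * weightedSeminorm φ v ε (2 * s) z) :=
        mul_le_mul_of_nonneg_left
          (weightedSeminorm_base_lie_le hs hε hε1 (by linarith) hK hlie z) (Nat.cast_nonneg k)
    _ = ((2 * s : ℕ) * K * φ v) * (k * ε ^ 2) * weightedSeminorm φ v ε (2 * s) z := by ring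
    _ ≤ weightedConstant s K b * 1 * weightedSeminorm φ v ε (2 * s) z := by gcongr
    _ = _ := by rw [mul_one]

/-- Transported increments have weight at least `1`. -/
theorem weightedSeminorm_expAd_le_stepConstant {k : ℕ} (hk : k * ε ^ 2 ≤ 1) {y : 𝔫}
    (hy : φ y ≤ K * incrementBound s b) :
    weightedSeminorm φ v ε (2 * s) (expAd s ((k : ℝ) • v) y) ≤ stepConstant s K b * ε := by
  have hC := one_le_weightedConstant (s := s) hK1 hb
  have hE := one_le_expConstant (s := s) hK1 hb
  have hI := le_incrementBound (s := s) hb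
  have h1 := weightedSeminorm_le_of_mem_weightFiltration (s := s) (b := b) hb hε hε1 hK1 hK
    (k := 1) (u := y) Submodule.mem_top
  refine (weightedSeminorm_expAd_le hs hlie hb hε hε1 hK1 hK hv hk y).trans ?_
  have hKI : K * incrementBound s b ≤ (1 + K) * incrementBound s b := by
    have : 0 ≤ incrementBound s b := by linarith
    nlinarith
  calc expConstant s K b * weightedSeminorm φ v ε (2 * s) y
      ≤ expConstant s K b * (weightedConstant s K b * ε ^ 1 * ((1 + K) * incrementBound s b)) := by
        refine mul_le_mul_of_nonneg_left (h1.trans ?_) (by linarith)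
        gcongr
        exact hy.trans hKI
    _ = stepConstant s K b * ε := by rw [stepConstant]; ring

/-- Transported increments in `[𝔫, 𝔫]` have weight at least `2`. -/
theorem weightedSeminorm_expAd_le_stepConstant_sq {k : ℕ} (hk : k * ε ^ 2 ≤ 1) {y : 𝔫}
    (hy0 : (abelianPart 𝔫).starProjection y = 0) (hy : φ y ≤ (1 + K) * incrementBound s b) :
    weightedSeminorm φ v ε (2 * s) (expAd s ((k : ℝ) • v) y) ≤ stepConstant s K b * ε ^ 2 := by
  have hC := one_le_weightedConstant (s := s) hK1 hb
  have hE := one_le_expConstant (s := s) hK1 hb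
  have h1 := weightedSeminorm_le_of_mem_weightFiltration (s := s) (b := b) hb hε hε1 hK1 hK
    (k := 2) (mem_weightFiltration_two v hy0)
  refine (weightedSeminorm_expAd_le hs hlie hb hε hε1 hK1 hK hv hk y).trans ?_
  calc expConstant s K b * weightedSeminorm φ v ε (2 * s) y
      ≤ expConstant s K b * (weightedConstant s K b * ε ^ 2 * ((1 + K) * incrementBound s b)) := by
        refine mul_le_mul_of_nonneg_left (h1.trans ?_) (by linarith)
        gcongr
    _ = stepConstant s K b * ε ^ 2 := by rw [stepConstant]; ring

end WeightedEstimates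

/-! ### Measurability, and the mean of the abelian increment -/

section Measurability

theorem measurable_comp₂_of_continuous {E α : Type*} [NormedAddCommGroup E] [InnerProductSpace ℝ E]
    [FiniteDimensional ℝ E] [MeasurableSpace E] [BorelSpace E] [MeasurableSpace α] (F : E → E → E)
    (hF : Continuous fun q : E × E => F q.1 q.2) {f g : α → E} (hf : Measurable f)
    (hg : Measurable g) : Measurable fun a => F (f a) (g a) := by
  have : ProperSpace E := FiniteDimensional.proper_real E
  have h : Measurable fun q : E × E => F q.1 q.2 := hF.measurable
  exact h.comp (hf.prodMk hg)

variable {𝔫 : Type*} [NormedAddCommGroup 𝔫] [InnerProductSpace ℝ 𝔫] [EuclideanLieAlgebra 𝔫]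
  [FiniteDimensional ℝ 𝔫] [LieRing.IsNilpotent 𝔫] [MeasurableSpace 𝔫] [BorelSpace 𝔫]
  {Q : Type*} [Group Q] [TopologicalSpace Q] [MeasurableSpace Q] [BorelSpace Q]
  [DistribMulAction Q 𝔫] [ContinuousSMul Q 𝔫]

theorem measurable_smul_of_continuousSMul : Measurable fun q : Q × 𝔫 => q.1 • q.2 := by
  have : ProperSpace 𝔫 := FiniteDimensional.proper_real 𝔫
  exact continuous_smul.measurable

theorem Measurable.lieProduct {α : Type*} [MeasurableSpace α] {f g : α → 𝔫} (hf : Measurable f)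
    (hg : Measurable g) : Measurable fun a => lieProduct (f a) (g a) :=
  measurable_comp₂_of_continuous _root_.lieProduct continuous_lieProduct hf hg

/-- Letting the factors act on a vector one by one avoids measurability of the multiplication of Q,
which may fail for the product σ-algebra when Q is not second countable. -/
theorem measurable_walk_snd_smul (k : ℕ) {u : (ℕ → 𝔫 × Q) → 𝔫} (hu : Measurable u) :
    Measurable fun g => (walk g k).2 • u g := by
  induction k generalizing u with
  | zero => simpa [walk] using hu
  | succ k ih =>
    simp only [walk, semidirectMul, mul_smul]
    exact ih (measurable_smul_of_continuousSMul.comp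
      ((measurable_snd.comp (measurable_pi_apply k)).prodMk hu))

theorem measurable_walk_fst (k : ℕ) : Measurable fun g : ℕ → 𝔫 × Q => (walk g k).1 := by
  induction k with
  | zero => exact measurable_const
  | succ k ih =>
    simp only [walk, semidirectMul]
    exact ih.lieProduct (measurable_walk_snd_smul k (measurable_fst.comp (measurable_pi_apply k)))

theorem measurable_correctedWalk (h v : 𝔫) (k : ℕ) :
    Measurable fun g : ℕ → 𝔫 × Q => correctedWalk h v g k :=
  ((measurable_walk_fst k).lieProduct
    (measurable_walk_snd_smul k measurable_const)).lieProduct measurable_const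

theorem measurable_correctedIncrement (h v : 𝔫) :
    Measurable fun g : 𝔫 × Q => correctedIncrement h v g :=
  ((measurable_const.lieProduct measurable_fst).lieProduct
    (measurable_snd_smul h)).lieProduct measurable_const

/-- The part of the `k`-th increment of the corrected walk which is linear in the abelian part of
the increment of the walk. -/
def mainIncrement (s : ℕ) (h v : 𝔫) (g : ℕ → 𝔫 × Q) (k : ℕ) : 𝔫 :=
  dynkinPart (· = 1) (truncOrder s) (correctedWalk h v g k) (expAd s ((k : ℝ) • v)
    ((walk g k).2 • (abelianPart 𝔫).starProjection (correctedIncrement h v (g k))))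

theorem measurable_mainIncrement (s : ℕ) (h v : 𝔫) (k : ℕ) :
    Measurable fun g : ℕ → 𝔫 × Q => mainIncrement s h v g k := by
  have h1 : Measurable fun g : ℕ → 𝔫 × Q =>
      (abelianPart 𝔫).starProjection (correctedIncrement h v (g k)) :=
    (abelianPart 𝔫).starProjection.continuous.measurable.comp
      ((measurable_correctedIncrement h v).comp (measurable_pi_apply k))
  have h2 : Measurable fun g : ℕ → 𝔫 × Q => expAd s ((k : ℝ) • v)
      ((walk g k).2 • (abelianPart 𝔫).starProjection (correctedIncrement h v (g k))) :=
    (LinearMap.continuous_of_finiteDimensional (expAd s ((k : ℝ) • v))).measurable.comp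
      (measurable_walk_snd_smul k h1)
  exact measurable_comp₂_of_continuous (dynkinPart (· = 1) (truncOrder s))
    (continuous_dynkinPart _ _) (measurable_correctedWalk h v k) h2

variable (hQ : IsEuclideanLieAction Q 𝔫) {μ : Measure (𝔫 × Q)} [IsProbabilityMeasure μ]
  {φ : Seminorm ℝ 𝔫} (hφ : IsAdmissibleNorm Q φ) {R : ℝ} (hR : ∀ᵐ g ∂μ, φ g.1 ≤ R)

include hQ in
theorem abelianPart_correctedIncrement {h v : 𝔫} (hh : h ∈ abelianPart 𝔫)
    (hv : v ∈ abelianPart 𝔫) (g : 𝔫 × Q) :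
    (abelianPart 𝔫).starProjection (correctedIncrement h v g) =
      (abelianPart 𝔫).starProjection g.1 + (g.2 • h - h - v) := by
  simp only [correctedIncrement, abelianPart_starProjection_lieProduct, map_neg,
    hQ.abelianPart_starProjection_smul, Submodule.starProjection_eq_self_iff.2 hh,
    Submodule.starProjection_eq_self_iff.2 hv]
  abel

include hQ hφ hR in
theorem integrable_abelianPart_correctedIncrement {h v : 𝔫} (hh : h ∈ abelianPart 𝔫)
    (hv : v ∈ abelianPart 𝔫) :
    Integrable (fun g => (abelianPart 𝔫).starProjection (correctedIncrement h v g)) μ := by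
  simp only [abelianPart_correctedIncrement hQ hh hv]
  exact (integrable_abelianPart hφ.eq_zero hR).add
    (((integrable_snd_smul hQ μ h).sub (integrable_const h)).sub (integrable_const v))

include hQ hφ hR in
-- The purpose of the corrector: the abelian part is additive, so its mean is ∫ξ₁ + Ad(μ_Q)h − h −
-- v.
theorem integral_abelianPart_correctedIncrement {h v : 𝔫} (hh : h ∈ abelianPart 𝔫)
    (hv : v ∈ abelianPart 𝔫) (heq : h - averagedAction μ h = abelianMean μ - v) :
    ∫ g, (abelianPart 𝔫).starProjection (correctedIncrement h v g) ∂μ = 0 := by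
  simp only [abelianPart_correctedIncrement hQ hh hv]
  have h1 := integrable_snd_smul hQ μ h
  have h2 : Integrable (fun g : 𝔫 × Q => g.2 • h - h) μ := h1.sub (integrable_const h)
  have h3 : Integrable (fun g : 𝔫 × Q => g.2 • h - h - v) μ := h2.sub (integrable_const v)
  rw [integral_add (integrable_abelianPart hφ.eq_zero hR) h3, integral_sub h2 (integrable_const v),
    integral_sub h1 (integrable_const h)]
  simp only [integral_const, probReal_univ, one_smul]
  change abelianMean μ + (averagedAction μ h - h - v) = 0
  have : averagedAction μ h - h - v = -(h - averagedAction μ h) - v := by abel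
  rw [this, heq]
  abel

end Measurability

end

noncomputable section

/-! ### Pathwise linearisation of the corrected walk -/

section Pathwise

variable {𝔫 : Type*} [NormedAddCommGroup 𝔫] [InnerProductSpace ℝ 𝔫] [EuclideanLieAlgebra 𝔫]
  [FiniteDimensional ℝ 𝔫] [LieRing.IsNilpotent 𝔫] {Q : Type*} [Group Q] [DistribMulAction Q 𝔫]
  (hQ : IsEuclideanLieAction Q 𝔫) {s : ℕ} (hs : LieModule.nilpotencyLength 𝔫 𝔫 = s)
  {φ : Seminorm ℝ 𝔫} (hφ : IsAdmissibleNorm Q φ) {v h : 𝔫} {ε K b : ℝ} (hb : 1 ≤ b)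
  (hε : 0 ≤ ε) (hε1 : ε ≤ 1) (hK1 : 1 ≤ K) (hK : ProjectionsBoundedBy φ v K) (hv : φ v ≤ b)
  (hJ : stepConstant s K b * ε ≤ 1)

/-- The constant of the Dynkin series for the weighted seminorms. -/
def productConstant (s : ℕ) (K b : ℝ) : ℝ := dynkinBound (truncOrder s) (weightedConstant s K b)

theorem productConstant_nonneg {s : ℕ} {K b : ℝ} (hK1 : 1 ≤ K) (hb : 1 ≤ b) :
    0 ≤ productConstant s K b :=
  dynkinBound_nonneg _ (zero_le_one.trans (one_le_weightedConstant hK1 hb))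

include hK in
theorem ProjectionsBoundedBy.abelianPart_le (u : 𝔫) :
    φ ((abelianPart 𝔫).starProjection u) ≤ K * φ u := by
  rw [← weightComponent_one v]
  exact hK 1 u

include hs hφ hb hε hε1 hK1 hK hv hJ

theorem weightedSeminorm_mainIncrement_le {g : ℕ → 𝔫 × Q} {k : ℕ} (hk : k * ε ^ 2 ≤ 1)
    (hg : φ (correctedIncrement h v (g k)) ≤ incrementBound s b)
    (hY : weightedSeminorm φ v ε (2 * s) (correctedWalk h v g k) ≤ 1) :
    weightedSeminorm φ v ε (2 * s) (mainIncrement s h v g k) ≤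
      productConstant s K b * (stepConstant s K b * ε) := by
  have hlie := hφ.lie_le
  have h1 := weightedSeminorm_expAd_le_stepConstant hs hlie hb hε hε1 hK1 hK hv hk
    (y := (walk g k).2 • (abelianPart 𝔫).starProjection (correctedIncrement h v (g k))) (by
      rw [hφ.map_smul]
      exact (hK.abelianPart_le _).trans (mul_le_mul_of_nonneg_left hg (by linarith)))
  have h2 := seminorm_dynkinPart_le (weightedSeminorm φ v ε (2 * s)) (· = 1) (m := 1)
    (fun k hk => hk.ge) (one_le_weightedConstant (s := s) hK1 hb)
    (weightedSeminorm_lie_le_weightedConstant hs hlie hb hε hε1 hK1 hK) (truncOrder s) hY h1 hJ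
  rwa [pow_one] at h2

include hQ

/-- Two errors of order ε²: the non-abelian part of the increment, which has weight two, and the
terms of the product quadratic in the increment. -/
theorem weightedSeminorm_correctedWalk_succ_le {g : ℕ → 𝔫 × Q} (hfix : ∀ j, (g j).2 • v = v) {k : ℕ}
    (hk : k * ε ^ 2 ≤ 1) (hg : φ (correctedIncrement h v (g k)) ≤ incrementBound s b)
    (hY : weightedSeminorm φ v ε (2 * s) (correctedWalk h v g k) ≤ 1) :
    weightedSeminorm φ v ε (2 * s) (correctedWalk h v g (k + 1) - correctedWalk h v g k -
      mainIncrement s h v g k) ≤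
      productConstant s K b * (stepConstant s K b * ε ^ 2 + (stepConstant s K b * ε) ^ 2) := by
  have hlie := hφ.lie_le
  have hI : 0 ≤ incrementBound s b := by linarith [le_incrementBound (s := s) hb]
  set w := correctedIncrement h v (g k) with hw
  have hy := weightedSeminorm_expAd_le_stepConstant hs hlie hb hε hε1 hK1 hK hv hk
    (y := (walk g k).2 • w) (by rw [hφ.map_smul]; nlinarith)
  have hP : φ ((abelianPart 𝔫).starProjection w) ≤ K * incrementBound s b :=
    (hK.abelianPart_le _).trans (mul_le_mul_of_nonneg_left hg (by linarith))
  have hyz := weightedSeminorm_expAd_le_stepConstant_sq hs hlie hb hε hε1 hK1 hK hv hk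
    (y := (walk g k).2 • w - (walk g k).2 • (abelianPart 𝔫).starProjection w) (by
      rw [← smul_sub, hQ.abelianPart_starProjection_smul, map_sub,
        Submodule.starProjection_eq_self_iff.2 (Submodule.starProjection_apply_mem _ w), sub_self,
        smul_zero]) (by
      rw [← smul_sub, hφ.map_smul]
      refine (map_sub_le_add φ _ _).trans ?_
      linarith)
  rw [map_sub] at hyz
  have hc : stepConstant s K b * ε ^ 2 ≤ 1 := by
    have h0 := stepConstant_nonneg (s := s) hK1 hb
    have : 0 ≤ stepConstant s K b * ε := by positivity
    nlinarith
  have := seminorm_lieProduct_sub_le hs (one_le_weightedConstant (s := s) hK1 hb)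
    (weightedSeminorm_lie_le_weightedConstant hs hlie hb hε hε1 hK1 hK) hY hy hJ hyz hc
  rw [correctedWalk_succ hQ hs hfix]
  exact this

/-- Removing the corrector raises the seminorm by at most 1/2, so a recentred walk at level 1 forces
the corrected one to level 1/2. -/
theorem le_weightedSeminorm_correctedWalk {g : ℕ → 𝔫 × Q} (hfix : ∀ j, (g j).2 • v = v) {k : ℕ}
    (hk : k * ε ^ 2 ≤ 1) (hh : φ h ≤ b)
    (hB : 4 * (productConstant s K b * (stepConstant s K b * ε)) ≤ 1)
    (h1 : 1 ≤ weightedSeminorm φ v ε (2 * s) (semidirectMul (walk g k) (-((k : ℝ) • v), 1)).1) :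
    1 / 2 ≤ weightedSeminorm φ v ε (2 * s) (correctedWalk h v g k) := by
  by_contra! hlt
  have hlie := hφ.lie_le
  have hI := le_incrementBound (s := s) hb
  have hy := weightedSeminorm_expAd_le_stepConstant hs hlie hb hε hε1 hK1 hK hv hk
    (y := -((walk g k).2 • h)) (by rw [map_neg_eq_map, hφ.map_smul]; nlinarith)
  have := seminorm_lieProduct_le hs (one_le_weightedConstant (s := s) hK1 hb)
    (weightedSeminorm_lie_le_weightedConstant hs hlie hb hε hε1 hK1 hK)
    (hlt.le.trans (by norm_num)) hy hJ
  rw [semidirectMul_walk_neg (h := h) hs hfix hQ] at h1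
  change _ ≤ _ + 2 * productConstant s K b * _ at this
  linarith

omit hε in
/-- If the recentred walk becomes large, then so does the stopped sum of main increments. -/
theorem le_weightedSeminorm_sum_mainIncrement {g : ℕ → 𝔫 × Q} (hε : 0 < ε)
    (hfix : ∀ j, (g j).2 • v = v)
    (hg : ∀ j, φ (correctedIncrement h v (g j)) ≤ incrementBound s b) (hh : φ h ≤ b) {n : ℕ}
    (hn : n * ε ^ 2 ≤ 1) (hJ8 : 8 * (stepConstant s K b * ε) ≤ 1)
    (hB : 4 * (productConstant s K b * (stepConstant s K b * ε)) ≤ 1)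
    (hn8 : n * (productConstant s K b * (stepConstant s K b * ε ^ 2 +
      (stepConstant s K b * ε) ^ 2)) ≤ 1 / 8)
    (hexit : ∃ k ≤ n, ε⁻¹ ≤ recentredNorm φ v g k) :
    1 / 4 ≤ weightedSeminorm φ v ε (2 * s) (∑ k ∈ Finset.range n,
      ({k | ∀ j ≤ k, weightedSeminorm φ v ε (2 * s) (correctedWalk h v g j) < 1 / 2} :
        Set ℕ).indicator (mainIncrement s h v g) k) := by
  have hkn : ∀ k ≤ n, k * ε ^ 2 ≤ 1 := fun k hk =>
    (mul_le_mul_of_nonneg_right (by exact_mod_cast hk) (sq_nonneg ε)).trans hn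
  have hJ0 := stepConstant_nonneg (s := s) hK1 hb
  have hB0 := productConstant_nonneg (s := s) hK1 hb
  refine le_seminorm_stopped_sum _ hn8 (by positivity) ?_ ?_ ?_
  · have hI := le_incrementBound (s := s) hb
    have h0 := weightedSeminorm_expAd_le_stepConstant hs hφ.lie_le hb hε.le hε1 hK1 hK hv
      (k := 0) (by simp) (y := h) (by nlinarith)
    rw [correctedWalk_zero]
    have : expAd s (((0 : ℕ) : ℝ) • v) h = h := by
      rw [Nat.cast_zero, zero_smul, expAd, map_zero, truncExp_zero]
      rfl
    rw [this] at h0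
    linarith
  · intro k hk hY
    exact weightedSeminorm_correctedWalk_succ_le hQ hs hφ hb hε.le hε1 hK1 hK hv hJ hfix
      (hkn k hk.le) (hg k) (hY.le.trans (by norm_num))
  · obtain ⟨k, hk, hk'⟩ := hexit
    exact ⟨k, hk, le_weightedSeminorm_correctedWalk hQ hs hφ hb hε.le hε1 hK1 hK hv hJ hfix
      (hkn k hk) hh hB (one_le_weightedSeminorm hε hs hk')⟩

end Pathwise

theorem correctedWalk_congr {𝔫 : Type*} [NormedAddCommGroup 𝔫] [InnerProductSpace ℝ 𝔫]
    [EuclideanLieAlgebra 𝔫] [LieRing.IsNilpotent 𝔫] {Q : Type*} [Group Q] [DistribMulAction Q 𝔫]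
    (h v : 𝔫) {g g' : ℕ → 𝔫 × Q} {k : ℕ} (hg : ∀ j < k, g j = g' j) :
    correctedWalk h v g k = correctedWalk h v g' k := by
  rw [correctedWalk, correctedWalk, walk_congr hg]

/-! ### Stopped martingale differences -/

section StoppedIncrement

variable {𝔫 : Type*} [NormedAddCommGroup 𝔫] [InnerProductSpace ℝ 𝔫] [EuclideanLieAlgebra 𝔫]
  [FiniteDimensional ℝ 𝔫] [LieRing.IsNilpotent 𝔫] {Q : Type*} [Group Q] [DistribMulAction Q 𝔫]

theorem mainIncrement_congr (s : ℕ) (h v : 𝔫) {g g' : ℕ → 𝔫 × Q} {k : ℕ}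
    (hg : ∀ j ≤ k, g j = g' j) : mainIncrement s h v g k = mainIncrement s h v g' k := by
  rw [mainIncrement, mainIncrement, correctedWalk_congr h v fun j hj => hg j hj.le,
    walk_congr fun j hj => hg j hj.le, hg k le_rfl]

open Classical in
/-- A coordinate of the `k`-th main increment, stopped at time `n` or when `p` exceeds `1/2`. -/
def stoppedIncrement (s : ℕ) (h v : 𝔫) (p : Seminorm ℝ 𝔫) (f : Module.Dual ℝ 𝔫) (n k : ℕ)
    (g : ℕ → 𝔫 × Q) : ℝ :=
  if k < n ∧ ∀ j ≤ k, p (correctedWalk h v g j) < 1 / 2 then f (mainIncrement s h v g k) else 0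

variable (s : ℕ) (h v : 𝔫) (p : Seminorm ℝ 𝔫) (f : Module.Dual ℝ 𝔫) (n : ℕ)

theorem stoppedIncrement_congr {k : ℕ} {g g' : ℕ → 𝔫 × Q} (hg : ∀ j ≤ k, g j = g' j) :
    stoppedIncrement s h v p f n k g = stoppedIncrement s h v p f n k g' := by
  have : (∀ j ≤ k, p (correctedWalk h v g j) < 1 / 2) ↔
      ∀ j ≤ k, p (correctedWalk h v g' j) < 1 / 2 :=
    forall₂_congr fun j hj => by
      rw [correctedWalk_congr h v fun i hi => hg i (hi.le.trans hj)]
  rw [stoppedIncrement, stoppedIncrement, mainIncrement_congr s h v hg]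
  simp only [this]

theorem sum_stoppedIncrement (g : ℕ → 𝔫 × Q) :
    ∑ k ∈ Finset.range n, stoppedIncrement s h v p f n k g =
      f (∑ k ∈ Finset.range n, ({k | ∀ j ≤ k, p (correctedWalk h v g j) < 1 / 2} :
        Set ℕ).indicator (mainIncrement s h v g) k) := by
  classical
  rw [map_sum]
  refine Finset.sum_congr rfl fun k hk => ?_
  rw [stoppedIncrement, Set.indicator_apply, apply_ite f, map_zero]
  simp only [Finset.mem_range.1 hk, true_and]
  rfl

variable [MeasurableSpace 𝔫] [BorelSpace 𝔫] [TopologicalSpace Q] [MeasurableSpace Q] [BorelSpace Q]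
  [ContinuousSMul Q 𝔫]

theorem measurable_stoppedIncrement (k : ℕ) :
    Measurable fun g : ℕ → 𝔫 × Q => stoppedIncrement s h v p f n k g := by
  have hset : MeasurableSet {g : ℕ → 𝔫 × Q |
      k < n ∧ ∀ j ≤ k, p (correctedWalk h v g j) < 1 / 2} := by
    have hj : ∀ j, MeasurableSet {g : ℕ → 𝔫 × Q | p (correctedWalk h v g j) < 1 / 2} := fun j =>
      measurableSet_lt ((continuous_seminorm p).measurable.comp (measurable_correctedWalk h v j))
        measurable_const
    have : {g : ℕ → 𝔫 × Q | k < n ∧ ∀ j ≤ k, p (correctedWalk h v g j) < 1 / 2} =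
        {_g : ℕ → 𝔫 × Q | k < n} ∩
          ⋂ j ∈ Set.Iic k, {g : ℕ → 𝔫 × Q | p (correctedWalk h v g j) < 1 / 2} := by
      ext g
      simp
    rw [this]
    exact (MeasurableSet.const _).inter
      (MeasurableSet.biInter (Set.to_countable _) fun j _ => hj j)
  exact Measurable.ite hset ((LinearMap.continuous_of_finiteDimensional f).measurable.comp
    (measurable_mainIncrement s h v k)) measurable_const

variable (hQ : IsEuclideanLieAction Q 𝔫) {μ : Measure (𝔫 × Q)} [IsProbabilityMeasure μ]
  {φ : Seminorm ℝ 𝔫} (hφ : IsAdmissibleNorm Q φ) {R : ℝ} (hR : ∀ᵐ g ∂μ, φ g.1 ≤ R)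

include hQ hφ hR in
-- The position at time k and the stopping condition do not involve the k-th increment. What is
-- integrated is therefore a fixed linear functional of the abelian part of that increment, which
-- has mean zero.
theorem integral_stoppedIncrement (hh : h ∈ abelianPart 𝔫) (hv : v ∈ abelianPart 𝔫)
    (heq : h - averagedAction μ h = abelianMean μ - v) (k : ℕ) (g : ℕ → 𝔫 × Q) :
    ∫ z, stoppedIncrement s h v p f n k (Function.update g k z) ∂μ = 0 := by
  have hcw : ∀ z, ∀ j ≤ k, correctedWalk h v (Function.update g k z) j = correctedWalk h v g j :=
    fun z j hj => correctedWalk_congr h v fun i hi =>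
      Function.update_of_ne (hi.trans_le hj).ne _ _
  have halive : ∀ z, (k < n ∧ ∀ j ≤ k, p (correctedWalk h v (Function.update g k z) j) < 1 / 2) ↔
      (k < n ∧ ∀ j ≤ k, p (correctedWalk h v g j) < 1 / 2) := fun z =>
    and_congr_right fun _ => forall₂_congr fun j hj => by rw [hcw z j hj]
  simp only [stoppedIncrement, halive]
  split_ifs with hk
  · obtain ⟨A, hA⟩ := exists_linear_dynkinPart (truncOrder s) (correctedWalk h v g k)
    let L : 𝔫 →ₗ[ℝ] ℝ := f ∘ₗ A ∘ₗ expAd s ((k : ℝ) • v) ∘ₗ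
      (hQ.toLieHom (walk g k).2 : 𝔫 →ₗ[ℝ] 𝔫)
    have hL : ∀ z, f (mainIncrement s h v (Function.update g k z) k) =
        LinearMap.toContinuousLinearMap L
          ((abelianPart 𝔫).starProjection (correctedIncrement h v z)) := fun z => by
      rw [mainIncrement, hcw z k le_rfl, hA, Function.update_self,
        walk_congr (g := Function.update g k z) (g' := g) fun j hj =>
          Function.update_of_ne hj.ne _ _]
      rfl
    simp only [hL]
    rw [ContinuousLinearMap.integral_comp_comm _
      (integrable_abelianPart_correctedIncrement hQ hφ hR hh hv),
      integral_abelianPart_correctedIncrement hQ hφ hR hh hv heq, map_zero]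
  · exact integral_zero _ _

end StoppedIncrement

end

noncomputable section

/-- The threshold beyond which the concentration estimate is proved with a martingale. -/
def deviationThreshold (s : ℕ) (K b : ℝ) : ℝ :=
  1 + 8 * stepConstant s K b + 8 * (productConstant s K b * stepConstant s K b) +
    8 * (productConstant s K b * (stepConstant s K b + stepConstant s K b ^ 2))

/-- The exponent of the concentration estimate. -/
def deviationRate (d s : ℕ) (K b : ℝ) : ℝ :=
  (32 * ((d : ℝ) + 1) ^ 2 * (2 ^ d) ^ 2 * (productConstant s K b * stepConstant s K b + 1) ^ 2)⁻¹

/-! ### Concentration beyond the threshold -/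

section Concentration

variable {𝔫 : Type*} [NormedAddCommGroup 𝔫] [InnerProductSpace ℝ 𝔫] [EuclideanLieAlgebra 𝔫]
  [FiniteDimensional ℝ 𝔫] [LieRing.IsNilpotent 𝔫] [MeasurableSpace 𝔫] [BorelSpace 𝔫]
  {Q : Type*} [Group Q] [TopologicalSpace Q] [MeasurableSpace Q] [BorelSpace Q]
  [DistribMulAction Q 𝔫] [ContinuousSMul Q 𝔫]

theorem exists_le_recentredNorm {φ : Seminorm ℝ 𝔫} {v : 𝔫} {g : ℕ → 𝔫 × Q} {n : ℕ} (hn : 1 ≤ n)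
    {t : ℝ} (h : t ≤ maximalDeviation φ v g n) :
    ∃ k ≤ n, t * Real.sqrt n ≤ recentredNorm φ v g k := by
  have hn0 : 0 < Real.sqrt n := Real.sqrt_pos.2 (by exact_mod_cast hn)
  rw [maximalDeviation, one_div, inv_mul_eq_div, le_div_iff₀ hn0, Finset.le_sup'_iff] at h
  obtain ⟨k, hk, hk'⟩ := h
  exact ⟨k, Nat.lt_succ_iff.1 (Finset.mem_range.1 hk), hk'⟩

variable (hQ : IsEuclideanLieAction Q 𝔫) {s : ℕ} (hs : LieModule.nilpotencyLength 𝔫 𝔫 = s)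
  {φ : Seminorm ℝ 𝔫} (hφ : IsAdmissibleNorm Q φ) {v h : 𝔫} {K b : ℝ} (hb : 1 ≤ b) (hK1 : 1 ≤ K)
  (hK : ProjectionsBoundedBy φ v K) (hv : φ v ≤ b) (hh : φ h ≤ b) (hha : h ∈ abelianPart 𝔫)
  (hva : v ∈ abelianPart 𝔫) {μ : Measure (𝔫 × Q)} [IsProbabilityMeasure μ]
  (hR : ∀ᵐ g ∂μ, φ g.1 ≤ b) (hfix : ∀ᵐ g ∂μ, g.2 • v = v)
  (heq : h - averagedAction μ h = abelianMean μ - v) {d : ℕ} (hd : Module.finrank ℝ 𝔫 = d)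
  {Ω : Type*} [MeasurableSpace Ω] {P : Measure Ω} [IsProbabilityMeasure P] {G : ℕ → Ω → 𝔫 × Q}
  (hG : ∀ j, Measurable (G j)) (hlaw : ∀ j, P.map (G j) = μ) (hind : iIndepFun G P)

include hs hφ hb hK1 hK hv hh hR in
theorem ae_abs_stoppedIncrement_le {ε : ℝ} (hε : 0 ≤ ε) (hε1 : ε ≤ 1) {n : ℕ}
    (hn : n * ε ^ 2 ≤ 1) (hJ : stepConstant s K b * ε ≤ 1) {f : Module.Dual ℝ 𝔫} {c : ℝ}
    (hc : 0 ≤ c) (hf : ∀ u, |f u| ≤ c * weightedSeminorm φ v ε (2 * s) u) (k : ℕ)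
    (g : ℕ → 𝔫 × Q) :
    ∀ᵐ z ∂μ, |stoppedIncrement s h v (weightedSeminorm φ v ε (2 * s)) f n k
      (Function.update g k z)| ≤ c * ((productConstant s K b * stepConstant s K b + 1) * ε) := by
  filter_upwards [hR] with z hz
  have hJ0 := stepConstant_nonneg (s := s) hK1 hb
  have hB0 := productConstant_nonneg (s := s) hK1 hb
  rw [stoppedIncrement]
  split_ifs with hk
  · have hk' : k * ε ^ 2 ≤ 1 :=
      (mul_le_mul_of_nonneg_right (by exact_mod_cast hk.1.le) (sq_nonneg ε)).trans hn
    refine (hf _).trans (mul_le_mul_of_nonneg_left ?_ hc)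
    refine (weightedSeminorm_mainIncrement_le hs hφ hb hε hε1 hK1 hK hv hJ hk' ?_
      ((hk.2 k le_rfl).le.trans (by norm_num))).trans (by nlinarith)
    rw [Function.update_self]
    exact seminorm_correctedIncrement_le hs hφ.lie_le hb hφ.map_smul hh hv hz
  · rw [abs_zero]
    positivity

include hQ hs hφ hb hK1 hK hv hh hha hva hR hfix heq hd hG hlaw hind in
/-- Concentration beyond the threshold. -/
theorem measureReal_maximalDeviation_ge_le {n : ℕ} (hn : 1 ≤ n) {t : ℝ}
    (ht : deviationThreshold s K b ≤ t) :
    P.real {ω | t ≤ maximalDeviation φ v (fun j => G j ω) n} ≤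
      2 * d * Real.exp (-deviationRate d s K b * t ^ 2) := by
  have hJ0 := stepConstant_nonneg (s := s) hK1 hb
  have hB0 := productConstant_nonneg (s := s) hK1 hb
  set J := stepConstant s K b with hJdef
  set B := productConstant s K b with hBdef
  have hn0 : (0 : ℝ) < n := by exact_mod_cast hn
  have hn1 : (1 : ℝ) ≤ Real.sqrt n := Real.one_le_sqrt.2 (by exact_mod_cast hn)
  have hBJ : 0 ≤ B * J := mul_nonneg hB0 hJ0
  have hBJ2 : 0 ≤ B * (J + J ^ 2) := by positivity
  have ht' : 1 + 8 * J + 8 * (B * J) + 8 * (B * (J + J ^ 2)) ≤ t := ht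
  have ht1 : 1 ≤ t := by linarith
  have ht0 : 0 < t := by linarith
  -- At this scale the event is a recentred norm of at least ε⁻¹, and nε² = t⁻².
  set ε := (t * Real.sqrt n)⁻¹ with hεdef
  have hε : 0 < ε := by positivity
  have htε : t * ε ≤ 1 := by
    rw [hεdef, mul_inv, ← mul_assoc, mul_inv_cancel₀ ht0.ne', one_mul]
    exact inv_le_one_of_one_le₀ hn1
  have hε1 : ε ≤ 1 := by nlinarith
  have hnε : n * ε ^ 2 = (t ^ 2)⁻¹ := by
    rw [hεdef, inv_pow, mul_pow, Real.sq_sqrt hn0.le]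
    field_simp
  have hnε1 : n * ε ^ 2 ≤ 1 := by
    rw [hnε]
    exact inv_le_one_of_one_le₀ (one_le_pow₀ ht1)
  have hJε : 8 * (J * ε) ≤ 1 := by nlinarith
  have hBJε : 4 * (B * (J * ε)) ≤ 1 := by nlinarith
  have hstep : n * (B * (J * ε ^ 2 + (J * ε) ^ 2)) ≤ 1 / 8 := by
    have h1 : n * (B * (J * ε ^ 2 + (J * ε) ^ 2)) = B * (J + J ^ 2) * (t ^ 2)⁻¹ := by
      rw [← hnε]
      ring
    rw [h1, ← div_eq_mul_inv, div_le_iff₀ (by positivity)]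
    -- Since t ≥ 1, t² ≥ t, and the last summand of the threshold suffices.
    nlinarith
  obtain ⟨f, hf1, hf2⟩ := exists_dual_seminorm_le_sum d 𝔫 (weightedSeminorm φ v ε (2 * s)) hd
  -- The summand 1 keeps c positive even if the increments vanish.
  set c : ℝ := 2 ^ d * ((B * J + 1) * ε) with hcdef
  have hc : 0 < c := by positivity
  -- With d + 1 in place of d, d terms of size a stay strictly below 1/4, and d = 0 is allowed.
  set a : ℝ := (4 * ((d : ℝ) + 1))⁻¹ with hadef
  have hAzuma : ∀ i, P.real {ω | a ≤ |∑ k ∈ Finset.range n,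
      stoppedIncrement s h v (weightedSeminorm φ v ε (2 * s)) (f i) n k fun j => G j ω|} ≤
      2 * Real.exp (-(a ^ 2 / (2 * (n * c ^ 2)))) := fun i =>
    measureReal_abs_sum_ge_le hG hlaw hind
      (fun k => measurable_stoppedIncrement s h v _ (f i) n k)
      (fun k g g' hgg => stoppedIncrement_congr s h v _ (f i) n hgg) hc
      (ae_abs_stoppedIncrement_le hs hφ hb hK1 hK hv hh hR hε.le hε1 hnε1 (by linarith)
        (by positivity) (hf1 i))
      (fun k g => integral_stoppedIncrement s h v _ (f i) n hQ hφ hR hha hva heq k g) hn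
      (by positivity)
  have hexp : a ^ 2 / (2 * (n * c ^ 2)) = deviationRate d s K b * t ^ 2 := by
    have : n * c ^ 2 = (2 ^ d) ^ 2 * (B * J + 1) ^ 2 * (t ^ 2)⁻¹ := by
      rw [← hnε, hcdef]
      ring
    rw [this, hadef, deviationRate, ← hJdef, ← hBdef]
    field_simp
    norm_num
  have hgood : ∀ᵐ ω ∂P, ∀ j, (G j ω).2 • v = v ∧ φ (G j ω).1 ≤ b := by
    refine ae_all_iff.2 fun j => ?_
    have : ∀ᵐ z ∂(P.map (G j)), z.2 • v = v ∧ φ z.1 ≤ b := by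
      rw [hlaw]
      exact hfix.and hR
    exact ae_of_ae_map (hG j).aemeasurable this
  have hsub : {ω | t ≤ maximalDeviation φ v (fun j => G j ω) n} ≤ᵐ[P]
      ⋃ i, {ω | a ≤ |∑ k ∈ Finset.range n,
        stoppedIncrement s h v (weightedSeminorm φ v ε (2 * s)) (f i) n k fun j => G j ω|} := by
    filter_upwards [hgood] with ω hω hdev
    obtain ⟨k, hk, hk'⟩ := exists_le_recentredNorm hn hdev
    have h1 := le_weightedSeminorm_sum_mainIncrement hQ hs hφ hb hε1 hK1 hK hv (by linarith) hε
      (g := fun j => G j ω) (fun j => (hω j).1)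
      (fun j => seminorm_correctedIncrement_le hs hφ.lie_le hb hφ.map_smul hh hv (hω j).2) hh
      hnε1 hJε hBJε hstep ⟨k, hk, by rwa [hεdef, inv_inv]⟩
    have h2 := h1.trans (hf2 _)
    by_contra hnot
    have h3 : ∀ i ∈ Finset.univ, |f i (∑ k ∈ Finset.range n,
        ({k | ∀ j ≤ k, weightedSeminorm φ v ε (2 * s) (correctedWalk h v (fun j => G j ω) j) <
          1 / 2} : Set ℕ).indicator (mainIncrement s h v fun j => G j ω) k)| ≤ a := fun i _ => by
      rw [← sum_stoppedIncrement]
      exact (not_le.1 fun hi => hnot (Set.mem_iUnion.2 ⟨i, hi⟩)).le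
    have h4 := h2.trans (Finset.sum_le_sum h3)
    rw [Finset.sum_const, Finset.card_univ, Fintype.card_fin, nsmul_eq_mul, hadef,
      ← div_eq_mul_inv, div_le_div_iff₀ (by norm_num) (by positivity)] at h4
    linarith
  have hle : P.real {ω | t ≤ maximalDeviation φ v (fun j => G j ω) n} ≤
      P.real (⋃ i, {ω | a ≤ |∑ k ∈ Finset.range n,
        stoppedIncrement s h v (weightedSeminorm φ v ε (2 * s)) (f i) n k fun j => G j ω|}) :=
    ENNReal.toReal_mono (measure_ne_top _ _) (measure_mono_ae hsub)
  refine hle.trans ((measureReal_iUnion_fintype_le _).trans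
    ((Finset.sum_le_sum fun i _ => hAzuma i).trans ?_))
  rw [Finset.sum_const, Finset.card_univ, Fintype.card_fin, nsmul_eq_mul, hexp, neg_mul]
  exact le_of_eq (by ring)

end Concentration

theorem deviationRate_pos (d s : ℕ) {K b : ℝ} (hK1 : 1 ≤ K) (hb : 1 ≤ b) :
    0 < deviationRate d s K b := by
  have hJ0 := stepConstant_nonneg (s := s) hK1 hb
  have hB0 := productConstant_nonneg (s := s) hK1 hb
  rw [deviationRate]
  positivity

theorem ProjectionsBoundedBy.mono {𝔫 : Type*} [NormedAddCommGroup 𝔫] [InnerProductSpace ℝ 𝔫]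
    [EuclideanLieAlgebra 𝔫] [FiniteDimensional ℝ 𝔫] {φ : Seminorm ℝ 𝔫} {v : 𝔫} {K K' : ℝ}
    (hK : ProjectionsBoundedBy φ v K) (h : K ≤ K') : ProjectionsBoundedBy φ v K' := fun i u =>
  (hK i u).trans (mul_le_mul_of_nonneg_right h (apply_nonneg φ u))

end

/-! ### Assembly of the theorem -/

theorem mainTheorem2 :
    -- concentration, with constants depending on `d`, `s`, `R`, `κ`, `K` only
    (∀ (d s : ℕ) (R κ K : ℝ), ∃ c₁ c₂ : ℝ, 0 < c₁ ∧ 0 < c₂ ∧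
      ∀ (𝔫 : Type u) [NormedAddCommGroup 𝔫] [InnerProductSpace ℝ 𝔫] [EuclideanLieAlgebra 𝔫]
        [FiniteDimensional ℝ 𝔫] [LieRing.IsNilpotent 𝔫] [MeasurableSpace 𝔫] [BorelSpace 𝔫]
        (Q : Type v) [Group Q] [TopologicalSpace Q] [IsTopologicalGroup Q] [CompactSpace Q]
        [T2Space Q] [MeasurableSpace Q] [BorelSpace Q] [DistribMulAction Q 𝔫]
        [ContinuousSMul Q 𝔫] (hQ : IsEuclideanLieAction Q 𝔫)
        (φ : Seminorm ℝ 𝔫) (μ : Measure (𝔫 × Q)) [IsProbabilityMeasure μ],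
        Module.finrank ℝ 𝔫 = d → LieModule.nilpotencyLength 𝔫 𝔫 = s →
        IsAdmissibleNorm Q φ → IsCompactlySupported μ →
        supportRadius φ μ ≤ R → IsSpectralConstant hQ φ μ κ →
        ProjectionsBoundedBy φ (essentialAverage hQ μ) K →
        ∀ (Ω : Type w) [MeasurableSpace Ω] (P : Measure Ω) [IsProbabilityMeasure P]
          (g : ℕ → Ω → 𝔫 × Q), (∀ j, Measurable (g j)) → (∀ j, P.map (g j) = μ) →
          iIndepFun g P →
          ∀ n : ℕ, 1 ≤ n → ∀ t : ℝ, 0 < t →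
            P.real {ω | t ≤ maximalDeviation φ (essentialAverage hQ μ) (fun j => g j ω) n} ≤
              c₂ * Real.exp (-c₁ * t ^ 2)) ∧
    -- every such algebra and action has norms to which this applies with `K = 1`; every `Q`-invariant
    -- norm has some finite `K`, uniformly in the vector `v`; every step distribution has some `κ`
    (∀ (𝔫 : Type u) [NormedAddCommGroup 𝔫] [InnerProductSpace ℝ 𝔫] [EuclideanLieAlgebra 𝔫]
        [FiniteDimensional ℝ 𝔫] [LieRing.IsNilpotent 𝔫] [MeasurableSpace 𝔫] [BorelSpace 𝔫]
        (Q : Type v) [Group Q] [TopologicalSpace Q] [IsTopologicalGroup Q] [CompactSpace Q]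
        [T2Space Q] [MeasurableSpace Q] [BorelSpace Q] [DistribMulAction Q 𝔫]
        [ContinuousSMul Q 𝔫] (hQ : IsEuclideanLieAction Q 𝔫),
      (∃ φ : Seminorm ℝ 𝔫, IsAdmissibleNorm Q φ ∧ (∀ u, ‖u‖ ≤ φ u) ∧
        (∃ r : ℝ, 1 ≤ r ∧ r ≤ max 1 (bilinearityConstant (normSeminorm ℝ 𝔫)) ∧
          ∀ u ∈ abelianPart 𝔫, φ u = r * ‖u‖) ∧
        ∀ v : 𝔫, ProjectionsBoundedBy φ v 1) ∧
      ∀ φ : Seminorm ℝ 𝔫, IsAdmissibleNorm Q φ →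
        (∃ K : ℝ, ∀ v : 𝔫, ProjectionsBoundedBy φ v K) ∧
        ∀ μ : Measure (𝔫 × Q), IsProbabilityMeasure μ → IsCompactlySupported μ →
          ∃ κ : ℝ, IsSpectralConstant hQ φ μ κ) := by

  refine ⟨fun d s R κ K => ?_, fun 𝔫 _ _ _ _ _ _ _ Q _ _ _ _ _ _ _ _ _ hQ =>
    ⟨exists_admissibleNorm_of_isEuclideanLieAction hQ, fun φ hφ =>
      ⟨exists_projectionsBoundedBy hφ.eq_zero, fun μ _ _ =>
        exists_isSpectralConstant hQ μ hφ.eq_zero⟩⟩⟩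
  rcases le_or_gt κ 0 with hκ | hκ
  · exact ⟨1, 1, one_pos, one_pos, fun 𝔫 _ _ _ _ _ _ _ Q _ _ _ _ _ _ _ _ _ hQ φ μ _ _ _ _ _ _ hsp =>
      absurd hsp.1 (not_lt.2 hκ)⟩
  set K' := max K 1 with hK'
  set R' := max R 0 with hR'
  have hK1 : 1 ≤ K' := le_max_right _ _
  have hR0 : 0 ≤ R' := le_max_right _ _
  -- A single bound for the increments, for φ(v_μ) (third summand) and for the corrector (last
  -- summand).
  set b := 1 + R' + (K' * R' + 2 * (K' * R') / κ) + 2 * (K' * R') / κ / κ with hb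
  have h1 : 0 ≤ 2 * (K' * R') / κ := by positivity
  have h2 : 0 ≤ 2 * (K' * R') / κ / κ := by positivity
  have h3 : 0 ≤ K' * R' := by positivity
  have hb1 : 1 ≤ b := by linarith
  have hc := deviationRate_pos d s hK1 hb1
  -- The exponential term makes the right-hand side at least 1 for t below the threshold.
  refine ⟨deviationRate d s K' b, 2 * d + Real.exp (deviationRate d s K' b *
    deviationThreshold s K' b ^ 2), hc, by positivity, ?_⟩
  intro 𝔫 _ _ _ _ _ _ _ Q _ _ _ _ _ _ _ _ _ hQ φ μ _ hd hs hφ hμ hsupp hsp hproj Ω _ P _ G hG hlaw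
    hind n hn t ht
  rcases le_or_gt (deviationThreshold s K' b) t with hlt | hlt
  · have hR : ∀ᵐ g ∂μ, φ g.1 ≤ R' := by
      filter_upwards [ae_le_supportRadius hμ φ] with g hg
      exact hg.trans (hsupp.trans (le_max_left _ _))
    have hproj' := hproj.mono (le_max_left K 1)
    obtain ⟨h, hha, heq, hh⟩ := exists_corrector hQ hφ hR (by linarith) hproj'.abelianPart_le hsp
    have hv := seminorm_essentialAverage_le hQ hφ hR (by linarith) hproj'.abelianPart_le hsp
    have hvV := essentialAverage_mem_fixedPart hQ μ
    refine (measureReal_maximalDeviation_ge_le hQ hs hφ hb1 hK1 hproj' (by linarith) (by linarith)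
      hha hvV.1 (hR.mono fun g hg => by linarith) hvV.2 heq hd hG hlaw hind hn hlt).trans ?_
    gcongr
    exact le_add_of_nonneg_right (Real.exp_pos _).le
  · refine measureReal_le_one.trans ?_
    have h4 : 1 ≤ Real.exp (deviationRate d s K' b * deviationThreshold s K' b ^ 2) *
        Real.exp (-deviationRate d s K' b * t ^ 2) := by
      rw [← Real.exp_add]
      refine Real.one_le_exp ?_
      have : t ^ 2 ≤ deviationThreshold s K' b ^ 2 := pow_le_pow_left₀ ht.le hlt.le 2
      nlinarith
    have h5 : 0 ≤ 2 * (d : ℝ) * Real.exp (-deviationRate d s K' b * t ^ 2) := by positivity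
    linarith
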